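/- Let $\lambda\ge 0$, $T\in(0,\infty]$, $\mathbb R^+=(0,\infty)$, and let $f:\mathbb R^+\to\mathbb R$ be measurable. Let $\Delta_\lambda=-\frac{d^2}{dx^2}-\frac{2\lambda}{x}\frac{d}{dx}$. For $t,x,y>0$ let $$W_t^\lambda(x,y)=\frac{(xy)^{-\lambda+1/2}}{2t}\,e^{-\frac{x^2+y^2}{4t}}\,I_{\lambda-1/2}\!\left(\frac{xy}{2t}\right),\qquad P_t^\lambda(x,y)=\frac{t}{\sqrt{4\pi}}\int_0^\infty e^{-\frac{t^2}{4u}}\,W_u^\lambda(x,y)\,\frac{du}{u^{3/2}},$$ where $I_\nu$ is the modified Bessel function of the first kind, be the heat and Poisson kernels of $\Delta_\lambda$, and let $$W_t^\lambda f(x)=\int_0^\infty W_t^\lambda(x,y)f(y)\,y^{2\lambda}dy,\qquad P_t^\lambda f(x)=\int_0^\infty P_t^\lambda(x,y)f(y)\,y^{2\lambda}dy$$ be the heat and Poisson integrals of $f$. Put $$\phi_t^\lambda(y)=y^\lambda\Big(\frac{y}{y+1}\Big)^{\lambda}e^{-\frac{y^2}{4t}},\qquad \phi^\lambda(y)=\frac{y^{2\lambda}}{(y^2+1)^{\lambda+1}}.$$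 (Heat.) If $\int_0^\infty\phi_t^\lambda|f|\,dy<\infty$ for every $t\in(0,T)$, then the integral $u(t,x)=W_t^\lambda f(x)$ converges absolutely for all $t\in(0,T)$ and $x>0$; (i) $u\in C^\infty((0,T)\times\mathbb R^+)$ and $u_t=-\Delta_\lambda u$ there; (ii) $\lim_{t\to0^+}u(t,x)=f(x)$ for a.e. $x>0$. (Poisson.) If $\int_0^\infty\phi^\lambda|f|\,dy<\infty$, then the integral $u(t,x)=P_t^\lambda f(x)$ converges absolutely for all $t,x>0$; (i) $u\in C^\infty((0,\infty)\times\mathbb R^+)$ and $u_{tt}=\Delta_\lambda u$ there; (ii) $\lim_{t\to0^+}u(t,x)=f(x)$ for a.e. $x>0$. (Converse.) Let $f\ge0$. If $W_t^\lambda f(x)<\infty$ for some $t\in(0,T)$ and some $x>0$, then $\int_0^\infty\phi_s^\lambda f\,dy<\infty$ for all $s\in(0,t]$; in particular, if for every $t\in(0,T)$ there is $x>0$ with $W_t^\lambda f(x)<\infty$, then $\int_0^\infty\phi_t^\lambda f\,dy<\infty$ for every $t\in(0,T)$. If $P_t^\lambda f(x)<\infty$ for some $t>0$ and some $x>0$,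 then $\int_0^\infty\phi^\lambda f\,dy<\infty$. -/

import Mathlib

open Set Filter Topology MeasureTheory
open scoped ContDiff

noncomputable section

namespace BesselProblem

/-- The modified Bessel function of the first kind `I_ν(z)` (used for `z > 0`, `ν > -1`). -/
def besselI (ν z : ℝ) : ℝ :=
  ∑' k : ℕ, (z / 2) ^ (2 * (k : ℝ) + ν) / ((k.factorial : ℝ) * Real.Gamma ((k : ℝ) + ν + 1))

/-- The Bessel operator `Δ_λ g = -g'' - (2λ/x) g'` on `(0, ∞)`. -/
def besselOp (lam : ℝ) (g : ℝ → ℝ) (x : ℝ) : ℝ :=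
  -iteratedDeriv 2 g x - 2 * lam / x * deriv g x

/-- The Bessel heat kernel `W_t^λ(x, y)`, for `t, x, y > 0`, with respect to `y^{2λ} dy`. -/
def heatKernel (lam t x y : ℝ) : ℝ :=
  (x * y) ^ (-lam + 1 / 2) / (2 * t) * Real.exp (-(x ^ 2 + y ^ 2) / (4 * t)) *
    besselI (lam - 1 / 2) (x * y / (2 * t))

/-- The Bessel Poisson kernel `P_t^λ(x, y)`, for `t, x, y > 0`, with respect to `y^{2λ} dy`,
subordinated to the heat kernel. -/
def poissonKernel (lam t x y : ℝ) : ℝ :=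
  t / Real.sqrt (4 * Real.pi) *
    ∫ u in Ioi (0 : ℝ), Real.exp (-t ^ 2 / (4 * u)) * heatKernel lam u x y / u ^ (3 / 2 : ℝ)

/-- The heat integral `W_t^λ f(x)`. -/
def heatIntegral (lam : ℝ) (f : ℝ → ℝ) (t x : ℝ) : ℝ :=
  ∫ y in Ioi (0 : ℝ), heatKernel lam t x y * f y * y ^ (2 * lam)

/-- The Poisson integral `P_t^λ f(x)`. -/
def poissonIntegral (lam : ℝ) (f : ℝ → ℝ) (t x : ℝ) : ℝ :=
  ∫ y in Ioi (0 : ℝ), poissonKernel lam t x y * f y * y ^ (2 * lam)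

/-- The integrability factor `φ_t^λ` of the heat problem. -/
def heatFactor (lam t y : ℝ) : ℝ :=
  y ^ lam * (y / (y + 1)) ^ lam * Real.exp (-y ^ 2 / (4 * t))

/-- The integrability factor `φ^λ` of the Poisson problem. -/
def poissonFactor (lam y : ℝ) : ℝ :=
  y ^ (2 * lam) / (y ^ 2 + 1) ^ (lam + 1)

/-- `∫_0^∞ φ(y) |f(y)| dy < ∞`. -/
def FiniteAgainst (φ f : ℝ → ℝ) : Prop :=
  (∫⁻ y in Ioi (0 : ℝ), ENNReal.ofReal (φ y * |f y|)) < ⊤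

end BesselProblem

end

noncomputable section

namespace BesselProblem

/-! Everything rests on Poisson's integral for the Bessel function: up to a constant, `I_{λ-1/2}(z)`
is `z^{λ-1/2} ∫ e^{zs} dμ(s)`, where `μ` is the normalised density `(1-s²)^{λ-1}` on `(-1,1)`, or
half the sum of the point masses at `±1` when `λ = 0`. `IsAngular` records the few properties of `μ`
that matter, so that `λ = 0` is not an exception later. Consequently the heat kernel is an average
over `s` of Gaussians in `x²+y²-2xys` (`heatKernel_eq`), and the Poisson kernel an average of the
powers `(t²+x²+y²-2xys)^{-(λ+1)}` (`poissonKernel_eq`).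

Smoothness and equations: up to elementary factors, both integrals are two-parameter Laplace
transforms `∫ exp(a p₁ + b p₂) g dm` composed with a smooth change of variables. For heat, `p =
(1/(4t), x/(2t))`; for Poisson, after writing the power as a Gamma integral in an extra variable
`r`, `p = (t²+x², x)`. Such a transform is smooth on any open set of absolute convergence
(`contDiffOn_laplace`), and its derivatives are moments. Each differential equation becomes one
linear relation between moments (`heatMoment_relation`, `poissonMoment_relation`), which is the
integration by parts formula of `μ` applied to an exponential, supplemented for Poisson by the
functional equation of `Gamma`.

Boundary values: both kernels have mass one against `y^{2λ} dy`, are dominated near `x` by a dilated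
Cauchy kernel, and away from `x` by a vanishing multiple of the integrability factor.
`tendsto_integral_of_lebesguePoint` then gives convergence at every Lebesgue point.

Converse: pointwise lower bounds of the kernels by multiples of Gaussians or powers dominate the
factors directly. For heat the bound follows from `e^{zs} ≥ 1 + zs` and the mean zero of `μ`. -/

/-- Powers are dominated by exponentials, with an arbitrary rate. -/
theorem exists_one_add_rpow_le_exp (p : ℝ) (hp : 0 ≤ p) {ε : ℝ} (hε : 0 < ε) :
    ∃ C > 0, ∀ z : ℝ, 0 ≤ z → (1 + z) ^ p ≤ C * Real.exp (ε * z) := by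
  -- Raise `v ≤ e^v`, for `v = ε(1+z)/(p+1)`, to the power `p`. Dividing by `p + 1` instead of `p`
  -- keeps `p = 0` admissible and costs only `p/(p+1) ≤ 1` in the exponent.
  refine ⟨((p + 1) / ε) ^ p * Real.exp ε, by positivity, fun z hz => ?_⟩
  have h1 : 1 + z ≤ (p + 1) / ε * Real.exp (ε * (1 + z) / (p + 1)) := by
    have h := Real.add_one_le_exp (ε * (1 + z) / (p + 1))
    calc 1 + z = (p + 1) / ε * (ε * (1 + z) / (p + 1)) := by field_simp
      _ ≤ _ := by gcongr; linarith
  calc (1 + z) ^ p ≤ ((p + 1) / ε * Real.exp (ε * (1 + z) / (p + 1))) ^ p := by gcongr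
    _ = ((p + 1) / ε) ^ p * Real.exp (ε * (1 + z) / (p + 1) * p) := by
      rw [Real.mul_rpow (by positivity) (by positivity), Real.exp_mul]
    _ ≤ ((p + 1) / ε) ^ p * Real.exp (ε * (1 + z)) := by
      refine mul_le_mul_of_nonneg_left (Real.exp_le_exp.2 ?_) (by positivity)
      rw [div_mul_eq_mul_div, div_le_iff₀ (by positivity)]
      nlinarith [mul_nonneg hε.le (by linarith : (0 : ℝ) ≤ 1 + z)]
    _ = ((p + 1) / ε) ^ p * Real.exp ε * Real.exp (ε * z) := by
      rw [mul_assoc, ← Real.exp_add]; ring_nf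

/-! ### The angular measure and its moments -/

/-- A probability measure on `[-1, 1]` behaving like the normalisation of `(1 - s²) ^ (λ - 1) ds`:
it satisfies the corresponding integration by parts formula, and its Laplace transform has the
right growth. -/
structure IsAngular (lam : ℝ) (μ : Measure ℝ) : Prop where
  prob : IsProbabilityMeasure μ
  ae_abs_le : ∀ᵐ s ∂μ, |s| ≤ 1
  integral_parts : ∀ g g' : ℝ → ℝ, (∀ s, HasDerivAt g (g' s) s) → Continuous g' →
    ∫ s, ((s ^ 2 - 1) * g' s + 2 * lam * s * g s) ∂μ = 0
  integral_id : ∫ s, s ∂μ = 0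
  laplace_le : ∃ C > 0, ∀ z : ℝ, 0 < z →
    ∫ s, Real.exp (z * s) ∂μ ≤ C * (z ^ (-lam) * Real.exp z)

/-- As `λ → 0` the normalised density concentrates at the endpoints. There `s² - 1` vanishes, and so
does the coefficient `2λ`, so the integration by parts formula is trivial. -/
theorem isAngular_zero :
    IsAngular 0 ((2⁻¹ : ENNReal) • (Measure.dirac (1 : ℝ) + Measure.dirac (-1 : ℝ))) := by
  have hint : ∀ h : ℝ → ℝ,
      ∫ s, h s ∂((2⁻¹ : ENNReal) • (Measure.dirac (1 : ℝ) + Measure.dirac (-1 : ℝ)))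
        = 2⁻¹ * (h 1 + h (-1)) := by
    intro h
    rw [integral_smul_measure, integral_add_measure, integral_dirac, integral_dirac]
    · simp
    · exact integrable_dirac (by simp)
    · exact integrable_dirac (by simp)
  refine ⟨⟨?_⟩, ?_, ?_, ?_, ?_⟩
  · simp [ENNReal.inv_two_add_inv_two]
  · refine Measure.ae_smul_measure ?_ _
    rw [ae_add_measure_iff]
    constructor <;> rw [ae_dirac_eq] <;> simp
  · intro g g' _ _
    rw [hint]; norm_num
  · rw [hint]; norm_num
  · refine ⟨1, one_pos, fun z hz => ?_⟩
    rw [hint]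
    have : Real.exp (z * -1) ≤ Real.exp z := Real.exp_le_exp.2 (by linarith)
    simp only [mul_one, neg_zero, Real.rpow_zero, one_mul]
    linarith

/-- In `1 - s² = (1+s)(1-s)` the first factor lies in `[1, 2]`, so its power is at most `1` or `2^p`
according to the sign of `p`. -/
theorem one_sub_sq_rpow_le (p : ℝ) {s : ℝ} (h0 : 0 ≤ s) (h1 : s < 1) :
    (1 - s ^ 2) ^ p ≤ (1 + 2 ^ p) * (1 - s) ^ p := by
  have h : (1 + s) ^ p ≤ 1 + 2 ^ p := by
    rcases le_total 0 p with hp | hp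
    · have : (1 + s) ^ p ≤ 2 ^ p := Real.rpow_le_rpow (by linarith) (by linarith) hp
      linarith
    · have : (1 + s) ^ p ≤ 1 := Real.rpow_le_one_of_one_le_of_nonpos (by linarith) hp
      have : (0 : ℝ) ≤ 2 ^ p := by positivity
      linarith
  have h2 : (0 : ℝ) ≤ (1 - s) ^ p := Real.rpow_nonneg (by linarith) _
  rw [show 1 - s ^ 2 = (1 + s) * (1 - s) by ring, Real.mul_rpow (by linarith) (by linarith)]
  gcongr

theorem integrableOn_one_sub_sq_rpow {lam : ℝ} (hlam : 0 < lam) :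
    IntegrableOn (fun s : ℝ => (1 - s ^ 2) ^ (lam - 1)) (Ioo (-1) 1) := by
  have hA : IntegrableOn (fun s : ℝ => (1 - s) ^ (lam - 1)) (Ioo (-1) 1) := by
    have h := (intervalIntegral.intervalIntegrable_rpow' (a := 2) (b := 0)
      (show -1 < lam - 1 by linarith)).comp_sub_left 1
    norm_num at h
    exact (intervalIntegrable_iff_integrableOn_Ioo_of_le (by norm_num)).1 h
  have hB : IntegrableOn (fun s : ℝ => (1 + s) ^ (lam - 1)) (Ioo (-1) 1) := by
    have h := (intervalIntegral.intervalIntegrable_rpow' (a := 0) (b := 2)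
      (show -1 < lam - 1 by linarith)).comp_add_left 1
    norm_num at h
    exact (intervalIntegrable_iff_integrableOn_Ioo_of_le (by norm_num)).1 h
  refine Integrable.mono' ((hA.add hB).const_mul (1 + 2 ^ (lam - 1))) ?_ ?_
  · exact (Measurable.pow_const (by fun_prop) _).aestronglyMeasurable
  · refine (ae_restrict_mem measurableSet_Ioo).mono fun s hs => ?_
    have h0 : 0 ≤ 1 - s ^ 2 := by nlinarith [hs.1, hs.2]
    have hp : (0 : ℝ) ≤ 2 ^ (lam - 1) := by positivity
    have ha : 0 ≤ (1 - s) ^ (lam - 1) := Real.rpow_nonneg (by linarith [hs.2]) _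
    have hb : 0 ≤ (1 + s) ^ (lam - 1) := Real.rpow_nonneg (by linarith [hs.1]) _
    rw [Real.norm_of_nonneg (Real.rpow_nonneg h0 _)]
    simp only [Pi.add_apply, mul_add]
    rcases le_total 0 s with h | h
    · have := one_sub_sq_rpow_le (lam - 1) h hs.2
      nlinarith [mul_nonneg (by linarith : 0 ≤ 1 + (2 : ℝ) ^ (lam - 1)) hb]
    · have := one_sub_sq_rpow_le (lam - 1) (s := -s) (by linarith) (by linarith [hs.1])
      rw [neg_sq, sub_neg_eq_add] at this
      nlinarith [mul_nonneg (by linarith : 0 ≤ 1 + (2 : ℝ) ^ (lam - 1)) ha]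

/-- The integrand is minus the derivative of `(1-s²)^λ g`, whose boundary values vanish because `λ >
0`. -/
theorem integral_one_sub_sq_rpow_parts {lam : ℝ} (hlam : 0 < lam) (g g' : ℝ → ℝ)
    (hg : ∀ s, HasDerivAt g (g' s) s) (hg' : Continuous g') :
    ∫ s in Ioo (-1 : ℝ) 1,
      (1 - s ^ 2) ^ (lam - 1) * ((s ^ 2 - 1) * g' s + 2 * lam * s * g s) = 0 := by
  have hgc : Continuous g := continuous_iff_continuousAt.2 fun s => (hg s).continuousAt
  have hint : IntegrableOn (fun s : ℝ =>
      (1 - s ^ 2) ^ (lam - 1) * ((s ^ 2 - 1) * g' s + 2 * lam * s * g s)) (Ioo (-1) 1) := by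
    refine ((integrableOn_Icc_iff_integrableOn_Ioo (f := fun s : ℝ => (1 - s ^ 2) ^ (lam - 1))).2
      (integrableOn_one_sub_sq_rpow hlam)).mul_continuousOn (K := Icc (-1) 1)
      (Continuous.continuousOn (by fun_prop)) isCompact_Icc |>.mono_set Ioo_subset_Icc_self
  have key := intervalIntegral.integral_eq_sub_of_hasDerivAt_of_le (a := -1) (b := 1)
    (f := fun s : ℝ => (1 - s ^ 2) ^ lam * g s)
    (f' := fun s => -((1 - s ^ 2) ^ (lam - 1) * ((s ^ 2 - 1) * g' s + 2 * lam * s * g s)))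
    (by norm_num)
    (Continuous.continuousOn
      ((Continuous.rpow_const (by fun_prop) (fun _ => Or.inr hlam.le)).mul hgc))
    (fun s hs => by
      have h0 : 0 < 1 - s ^ 2 := by nlinarith [hs.1, hs.2]
      have h := ((((hasDerivAt_id s).pow 2).const_sub 1).rpow_const (p := lam)
        (Or.inl (by simpa using h0.ne'))).mul (hg s)
      refine h.congr_deriv ?_
      have : (1 - s ^ 2) ^ lam = (1 - s ^ 2) ^ (lam - 1) * (1 - s ^ 2) := by
        rw [Real.rpow_sub_one h0.ne']; field_simp
      simp only [id, Pi.pow_apply, this]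
      push_cast
      ring)
    ((intervalIntegrable_iff_integrableOn_Ioo_of_le (by norm_num)).2 hint.neg)
  rw [intervalIntegral.integral_of_le (by norm_num), integral_Ioc_eq_integral_Ioo,
    integral_neg] at key
  have h0 : (0 : ℝ) ^ lam = 0 := Real.zero_rpow hlam.ne'
  norm_num [h0] at key
  exact key

/-- On `s ≥ 0` the substitution `r = 1 - s` leaves `e^z` times a truncated Gamma integral of size
`z^{-λ}`. On `s ≤ 0` the exponential is at most `1`, and the total mass `M` is absorbed through `z^λ
≤ A e^z`. -/
theorem integral_exp_mul_one_sub_sq_rpow_le {lam : ℝ} (hlam : 0 < lam) :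
    ∃ C > 0, ∀ z : ℝ, 0 < z →
      ∫ s in Ioo (-1 : ℝ) 1, (1 - s ^ 2) ^ (lam - 1) * Real.exp (z * s)
        ≤ C * (z ^ (-lam) * Real.exp z) := by
  obtain ⟨A, hA, hA'⟩ := exists_one_add_rpow_le_exp lam hlam.le one_pos
  set M := ∫ s in Ioo (-1 : ℝ) 1, (1 - s ^ 2) ^ (lam - 1)
  have hM : 0 ≤ M := setIntegral_nonneg measurableSet_Ioo fun s hs =>
    Real.rpow_nonneg (by nlinarith [hs.1, hs.2]) _
  have hG : 0 < Real.Gamma lam := Real.Gamma_pos_of_pos hlam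
  refine ⟨(1 + 2 ^ (lam - 1)) * Real.Gamma lam + M * A, by positivity, fun z hz => ?_⟩
  have hI : IntegrableOn (fun r : ℝ => r ^ (lam - 1) * Real.exp (-(z * r))) (Ioi 0) := by
    -- A non-integrable function has integral `0` by convention, so a nonzero value proves
    -- integrability.
    have h : ∫ r in Ioi (0 : ℝ), r ^ (lam - 1) * Real.exp (-(z * r)) ≠ 0 := by
      rw [Real.integral_rpow_mul_exp_neg_mul_Ioi hlam hz]; positivity
    exact not_imp_comm.1 integral_undef h
  have hsub : ∀ h : ℝ → ℝ, ∫ s in Ioo (-1 : ℝ) 1, h (1 - s) = ∫ r in Ioo (0 : ℝ) 2, h r := by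
    intro h
    rw [← integral_Ioc_eq_integral_Ioo, ← integral_Ioc_eq_integral_Ioo,
      ← intervalIntegral.integral_of_le (by norm_num),
      ← intervalIntegral.integral_of_le (by norm_num), intervalIntegral.integral_comp_sub_left]
    norm_num
  have hI' : IntegrableOn (fun s : ℝ => (1 - s) ^ (lam - 1) * Real.exp (-(z * (1 - s))))
      (Ioo (-1) 1) := by
    have h1 : IntervalIntegrable (fun r : ℝ => r ^ (lam - 1) * Real.exp (-(z * r))) volume 0 2 :=
      (intervalIntegrable_iff_integrableOn_Ioo_of_le (by norm_num)).2
        (hI.mono_set Ioo_subset_Ioi_self)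
    have h2 := h1.symm.comp_sub_left 1
    norm_num at h2
    exact (intervalIntegrable_iff_integrableOn_Ioo_of_le (by norm_num)).1 h2
  calc ∫ s in Ioo (-1 : ℝ) 1, (1 - s ^ 2) ^ (lam - 1) * Real.exp (z * s)
      ≤ ∫ s in Ioo (-1 : ℝ) 1, ((1 + 2 ^ (lam - 1)) * Real.exp z *
          ((1 - s) ^ (lam - 1) * Real.exp (-(z * (1 - s)))) + (1 - s ^ 2) ^ (lam - 1)) := by
        refine setIntegral_mono_on ?_ ((hI'.const_mul _).add (integrableOn_one_sub_sq_rpow hlam))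
          measurableSet_Ioo fun s hs => ?_
        · refine ((integrableOn_Icc_iff_integrableOn_Ioo
            (f := fun s : ℝ => (1 - s ^ 2) ^ (lam - 1))).2
            (integrableOn_one_sub_sq_rpow hlam)).mul_continuousOn (K := Icc (-1) 1)
            (Continuous.continuousOn (by fun_prop)) isCompact_Icc |>.mono_set Ioo_subset_Icc_self
        · have hw : 0 ≤ (1 - s ^ 2) ^ (lam - 1) :=
            Real.rpow_nonneg (by nlinarith [hs.1, hs.2]) _
          have ha : 0 ≤ (1 - s) ^ (lam - 1) := Real.rpow_nonneg (by linarith [hs.2]) _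
          rcases le_total 0 s with h | h
          · have h1 := one_sub_sq_rpow_le (lam - 1) h hs.2
            have h2 : Real.exp (z * s) = Real.exp z * Real.exp (-(z * (1 - s))) := by
              rw [← Real.exp_add]; ring_nf
            calc (1 - s ^ 2) ^ (lam - 1) * Real.exp (z * s)
                ≤ (1 + 2 ^ (lam - 1)) * (1 - s) ^ (lam - 1) * Real.exp (z * s) := by gcongr
              _ = (1 + 2 ^ (lam - 1)) * Real.exp z *
                    ((1 - s) ^ (lam - 1) * Real.exp (-(z * (1 - s)))) := by rw [h2]; ring
              _ ≤ _ := le_add_of_nonneg_right hw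
          · have h1 : Real.exp (z * s) ≤ 1 := Real.exp_le_one_iff.2 (by nlinarith)
            calc (1 - s ^ 2) ^ (lam - 1) * Real.exp (z * s)
                ≤ (1 - s ^ 2) ^ (lam - 1) * 1 := by gcongr
              _ = (1 - s ^ 2) ^ (lam - 1) := mul_one _
              _ ≤ _ := le_add_of_nonneg_left (by positivity)
    _ = (1 + 2 ^ (lam - 1)) * Real.exp z *
          (∫ r in Ioo (0 : ℝ) 2, r ^ (lam - 1) * Real.exp (-(z * r))) + M := by
        rw [integral_add (hI'.const_mul _) (integrableOn_one_sub_sq_rpow hlam),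
          integral_const_mul, hsub (fun r => r ^ (lam - 1) * Real.exp (-(z * r)))]
    _ ≤ (1 + 2 ^ (lam - 1)) * Real.exp z * (Real.Gamma lam * z ^ (-lam)) +
          M * (A * (z ^ (-lam) * Real.exp z)) := by
        gcongr
        · calc _ ≤ ∫ r in Ioi (0 : ℝ), r ^ (lam - 1) * Real.exp (-(z * r)) := by
                refine setIntegral_mono_set hI ?_ Ioo_subset_Ioi_self.eventuallyLE
                exact (ae_restrict_mem measurableSet_Ioi).mono fun r hr =>
                  mul_nonneg (Real.rpow_nonneg (le_of_lt hr) _) (Real.exp_nonneg _)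
            _ = _ := by
                rw [Real.integral_rpow_mul_exp_neg_mul_Ioi hlam hz, one_div, Real.inv_rpow hz.le,
                  Real.rpow_neg hz.le, mul_comm]
        · refine le_mul_of_one_le_right hM ?_
          rw [Real.rpow_neg hz.le]
          have h1 : z ^ lam ≤ (1 + z) ^ lam := by gcongr; linarith
          have h2 := hA' z hz.le
          rw [one_mul] at h2
          rw [mul_left_comm, inv_mul_eq_div, le_div_iff₀ (by positivity)]
          linarith
    _ = _ := by ring

theorem exists_isAngular {lam : ℝ} (hlam : 0 ≤ lam) : ∃ μ : Measure ℝ, IsAngular lam μ := by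
  rcases hlam.eq_or_lt with rfl | hlam
  · exact ⟨_, isAngular_zero⟩
  set w : ℝ → ℝ := fun s => (1 - s ^ 2) ^ (lam - 1) with hw
  have hwm : Measurable w := Measurable.pow_const (by fun_prop) _
  have hwpos : ∀ s ∈ Ioo (-1 : ℝ) 1, 0 < w s := fun s hs =>
    Real.rpow_pos_of_pos (by nlinarith [hs.1, hs.2]) _
  have hwI : IntegrableOn w (Ioo (-1) 1) := integrableOn_one_sub_sq_rpow hlam
  set M := ∫ s in Ioo (-1 : ℝ) 1, w s with hM
  have hMpos : 0 < M := by
    rw [hM, setIntegral_pos_iff_support_of_nonneg_ae _ hwI]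
    · refine lt_of_lt_of_le ?_ (measure_mono (show Ioo (-1 : ℝ) 1 ⊆ _ from fun s hs =>
        ⟨(hwpos s hs).ne', hs⟩))
      simp
    · exact (ae_restrict_mem measurableSet_Ioo).mono fun s hs => (hwpos s hs).le
  set μ : Measure ℝ := (volume.restrict (Ioo (-1 : ℝ) 1)).withDensity
    fun s => ENNReal.ofReal (M⁻¹ * w s) with hμ
  have hint : ∀ h : ℝ → ℝ, ∫ s, h s ∂μ = M⁻¹ * ∫ s in Ioo (-1 : ℝ) 1, w s * h s := by
    intro h
    rw [hμ, integral_withDensity_eq_integral_toReal_smul (by fun_prop) (by simp),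
      ← integral_const_mul]
    refine setIntegral_congr_fun measurableSet_Ioo fun s hs => ?_
    have := hwpos s hs
    simp only [smul_eq_mul]
    rw [ENNReal.toReal_ofReal (by positivity), mul_assoc]
  refine ⟨μ, ⟨?_⟩, ?_, ?_, ?_, ?_⟩
  · rw [hμ, withDensity_apply _ MeasurableSet.univ, Measure.restrict_univ,
      ← ofReal_integral_eq_lintegral_ofReal (hwI.const_mul _), integral_const_mul,
      inv_mul_cancel₀ hMpos.ne', ENNReal.ofReal_one]
    exact (ae_restrict_mem measurableSet_Ioo).mono fun s hs =>
      mul_nonneg (by positivity) (hwpos s hs).le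
  · refine (withDensity_absolutelyContinuous _ _).ae_le ?_
    exact (ae_restrict_mem measurableSet_Ioo).mono fun s hs => abs_le.2 ⟨hs.1.le, hs.2.le⟩
  · intro g g' hg hg'
    rw [hint, integral_one_sub_sq_rpow_parts hlam g g' hg hg', mul_zero]
  -- Taking `g = 1` gives `2λ ∫ s = 0`. This says nothing at `λ = 0`, which is why the vanishing
  -- mean is a separate field.
  · have h := integral_one_sub_sq_rpow_parts hlam (fun _ => 1) (fun _ => 0)
      (fun s => hasDerivAt_const s 1) continuous_const
    rw [hint]
    have h2 : ∫ s in Ioo (-1 : ℝ) 1, (2 * lam) * (w s * s) = 0 := by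
      rw [← h]; congr 1; ext s; simp only [hw]; ring
    rw [integral_const_mul] at h2
    rcases mul_eq_zero.1 h2 with h3 | h3
    · linarith
    · rw [h3, mul_zero]
  · obtain ⟨C, hC, hC'⟩ := integral_exp_mul_one_sub_sq_rpow_le hlam
    refine ⟨M⁻¹ * C, by positivity, fun z hz => ?_⟩
    rw [hint, mul_assoc]
    exact mul_le_mul_of_nonneg_left (hC' z hz) (by positivity)

namespace IsAngular

variable {lam : ℝ} {μ : Measure ℝ}

theorem integrable_of_continuous (h : IsAngular lam μ) {g : ℝ → ℝ} (hg : Continuous g) :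
    Integrable g μ := by
  have := h.prob
  obtain ⟨C, hC⟩ := (isCompact_Icc (a := (-1 : ℝ)) (b := 1)).exists_bound_of_continuousOn
    hg.continuousOn
  exact Integrable.of_bound hg.aestronglyMeasurable C
    (h.ae_abs_le.mono fun s hs => hC s (abs_le.1 hs))

/-- Integration by parts with `g = s^{n+1}`. With mass one and mean zero, this recursion determines
every moment, without further reference to the density. -/
theorem integral_pow_succ_succ (h : IsAngular lam μ) (n : ℕ) :
    (n + 1 + 2 * lam) * ∫ s, s ^ (n + 2) ∂μ = (n + 1) * ∫ s, s ^ n ∂μ := by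
  have h1 := h.integral_parts (fun s => s ^ (n + 1)) (fun s => (n + 1) * s ^ n)
    (fun s => by simpa using hasDerivAt_pow (n + 1) s) (by fun_prop)
  have h2 : (fun s : ℝ => (s ^ 2 - 1) * ((n + 1) * s ^ n) + 2 * lam * s * s ^ (n + 1)) =
      fun s => (n + 1 + 2 * lam) * s ^ (n + 2) - (n + 1) * s ^ n := by
    ext s; ring
  rw [h2, integral_sub (h.integrable_of_continuous (by fun_prop))
    (h.integrable_of_continuous (by fun_prop)), integral_const_mul, integral_const_mul] at h1
  linarith

theorem integral_pow_odd (h : IsAngular lam μ) (hlam : 0 ≤ lam) (k : ℕ) :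
    ∫ s, s ^ (2 * k + 1) ∂μ = 0 := by
  induction k with
  | zero => simpa using h.integral_id
  | succ k ih =>
    have h1 := h.integral_pow_succ_succ (2 * k + 1)
    rw [ih, mul_zero] at h1
    refine (mul_eq_zero.1 h1).resolve_left ?_
    positivity

/-- One step of the recursion multiplies the left side by `(2k+1)/(2k+1+2λ)` and divides it by
`(2k+1)(2k+2)`. The net factor `1/(4(k+1)(k+λ+1/2))` is the ratio of consecutive coefficients of the
Bessel series. -/
theorem integral_pow_even (h : IsAngular lam μ) (hlam : 0 ≤ lam) (k : ℕ) :
    (∫ s, s ^ (2 * k) ∂μ) / (2 * k).factorial =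
      Real.Gamma (lam + 1 / 2) / (4 ^ k * k.factorial * Real.Gamma (k + lam + 1 / 2)) := by
  have := h.prob
  induction k with
  | zero =>
    have : Real.Gamma (lam + 1 / 2) ≠ 0 := (Real.Gamma_pos_of_pos (by linarith)).ne'
    simp only [mul_zero, pow_zero, integral_const, probReal_univ, Nat.factorial_zero, Nat.cast_one,
      Nat.cast_zero, zero_add, one_mul, smul_eq_mul, div_one]
    rw [div_self this]
  | succ k ih =>
    have h1 := h.integral_pow_succ_succ (2 * k)
    have hp : (0 : ℝ) < k + lam + 1 / 2 := by positivity
    have hG : Real.Gamma ((k + 1 : ℕ) + lam + 1 / 2)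
        = (k + lam + 1 / 2) * Real.Gamma (k + lam + 1 / 2) := by
      rw [← Real.Gamma_add_one hp.ne']; push_cast; ring_nf
    have hG0 := (Real.Gamma_pos_of_pos hp).ne'
    have hf : ((2 * (k + 1)).factorial : ℝ) = (2 * k + 2) * (2 * k + 1) * (2 * k).factorial := by
      rw [show 2 * (k + 1) = 2 * k + 1 + 1 by ring, Nat.factorial_succ, Nat.factorial_succ]
      push_cast; ring
    have hk0 : ((2 * k).factorial : ℝ) ≠ 0 := by positivity
    have hk1 : (k.factorial : ℝ) ≠ 0 := by positivity
    rw [div_eq_div_iff hk0 (by positivity)] at ih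
    have h2 : ∫ s, s ^ (2 * k + 2) ∂μ = (2 * k + 1) * (∫ s, s ^ (2 * k) ∂μ) / (2 * k + 1 + 2 * lam) := by
      rw [eq_div_iff (by positivity)]; push_cast at h1; linarith
    rw [show 2 * (k + 1) = 2 * k + 2 by ring] at *
    rw [hf, hG, h2, Nat.factorial_succ, div_eq_div_iff (by positivity) (by positivity),
      div_mul_eq_mul_div, div_eq_iff (by positivity)]
    push_cast
    linear_combination ((2 * k + 1) * (2 * k + 2) * (2 * k + 1 + 2 * lam)) * ih

/-- Poisson's representation of `I_{λ-1/2}`: expand `e^{zs}` and integrate term by term, with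
majorant `|z|^n/n!`. The odd moments vanish and the even ones give the Bessel coefficients. -/
theorem hasSum_laplace (h : IsAngular lam μ) (hlam : 0 ≤ lam) (z : ℝ) :
    HasSum (fun k : ℕ => Real.Gamma (lam + 1 / 2) * (z / 2) ^ (2 * k) /
      (k.factorial * Real.Gamma (k + lam + 1 / 2))) (∫ s, Real.exp (z * s) ∂μ) := by
  have := h.prob
  have h1 : HasSum (fun n : ℕ => ∫ s, z ^ n / n.factorial * s ^ n ∂μ)
      (∫ s, ∑' n : ℕ, z ^ n / n.factorial * s ^ n ∂μ) := by
    refine hasSum_integral_of_summable_integral_norm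
      (fun n => h.integrable_of_continuous (by fun_prop)) ?_
    refine Summable.of_nonneg_of_le (fun n => integral_nonneg fun s => norm_nonneg _) (fun n => ?_)
      (Real.summable_pow_div_factorial |z|)
    calc ∫ s, ‖z ^ n / n.factorial * s ^ n‖ ∂μ ≤ ∫ s, |z| ^ n / n.factorial ∂μ := by
          refine integral_mono_ae (h.integrable_of_continuous (by fun_prop)) (integrable_const _) ?_
          refine h.ae_abs_le.mono fun s hs => ?_
          simp only [norm_mul, norm_div, norm_pow, Real.norm_eq_abs, Nat.abs_cast]
          exact mul_le_of_le_one_right (by positivity) (pow_le_one₀ (abs_nonneg _) hs)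
      _ = _ := by simp
  have h2 : ∀ s : ℝ, ∑' n : ℕ, z ^ n / n.factorial * s ^ n = Real.exp (z * s) := by
    intro s
    rw [Real.exp_eq_exp_ℝ, NormedSpace.exp_eq_tsum_div]
    congr 1; ext n; rw [mul_pow]; ring
  simp_rw [h2] at h1
  have hinj : Function.Injective (fun k : ℕ => 2 * k) := fun a b hab => by simpa using hab
  rw [← hinj.hasSum_iff] at h1
  · convert! h1 using 2 with k
    have h3 := h.integral_pow_even hlam k
    simp only [Function.comp_apply]
    rw [integral_const_mul, div_mul_eq_mul_div, mul_div_assoc (z ^ (2 * k)), h3, div_pow,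
      pow_mul 2 2 k, show (2 : ℝ) ^ 2 = 4 by norm_num, ← div_div, ← div_div]
    ring
  · intro n hn
    rcases Nat.even_or_odd' n with ⟨k, rfl | rfl⟩
    · exact absurd ⟨k, rfl⟩ hn
    · rw [integral_const_mul, h.integral_pow_odd hlam, mul_zero]

end IsAngular

/-! ### The heat kernel as an angular average -/

/-- The normalising constant of the Bessel heat kernel. -/
def heatConst (lam : ℝ) : ℝ := 2 ^ (-(2 * lam)) / Real.Gamma (lam + 1 / 2)

theorem heatConst_pos {lam : ℝ} (hlam : 0 ≤ lam) : 0 < heatConst lam :=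
  div_pos (by positivity) (Real.Gamma_pos_of_pos (by linarith))

/-- The Bessel heat kernel as an average of Gaussians. -/
theorem heatKernel_eq {lam : ℝ} {μ : Measure ℝ} (h : IsAngular lam μ) (hlam : 0 ≤ lam)
    {t x y : ℝ} (ht : 0 < t) (hx : 0 < x) (hy : 0 < y) :
    heatKernel lam t x y = heatConst lam * t ^ (-(lam + 1 / 2)) *
      ∫ s, Real.exp (-(x ^ 2 + y ^ 2 - 2 * x * y * s) / (4 * t)) ∂μ := by
  have hG : 0 < Real.Gamma (lam + 1 / 2) := Real.Gamma_pos_of_pos (by linarith)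
  have hz : 0 < x * y / (2 * t) := by positivity
  have h1 : besselI (lam - 1 / 2) (x * y / (2 * t)) =
      (x * y / (2 * t) / 2) ^ (lam - 1 / 2) / Real.Gamma (lam + 1 / 2) *
        ∫ s, Real.exp (x * y / (2 * t) * s) ∂μ := by
    rw [← (h.hasSum_laplace hlam _).tsum_eq, ← tsum_mul_left, besselI]
    congr 1; ext k
    rw [Real.rpow_add (by positivity), show (2 * (k : ℝ)) = ((2 * k : ℕ) : ℝ) by push_cast; ring,
      Real.rpow_natCast, show (k : ℝ) + (lam - 1 / 2) + 1 = k + lam + 1 / 2 by ring]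
    field_simp
  have h2 : ∫ s, Real.exp (-(x ^ 2 + y ^ 2 - 2 * x * y * s) / (4 * t)) ∂μ =
      Real.exp (-(x ^ 2 + y ^ 2) / (4 * t)) * ∫ s, Real.exp (x * y / (2 * t) * s) ∂μ := by
    rw [← integral_const_mul]
    congr 1; ext s
    rw [← Real.exp_add]; congr 1; field_simp; ring
  rw [heatKernel, h1, h2]
  -- The powers of `xy` cancel, so the prefactor depends on `t` alone.
  have h3 : (x * y) ^ (-lam + 1 / 2) / (2 * t) * (x * y / (2 * t) / 2) ^ (lam - 1 / 2) =
      2 ^ (-(2 * lam)) * t ^ (-(lam + 1 / 2)) := by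
    have hxy : (0 : ℝ) < x * y := by positivity
    rw [show x * y / (2 * t) / 2 = (x * y) * (2 ^ (-2 : ℝ) * t⁻¹) by
      rw [Real.rpow_neg (by norm_num)]; norm_num; field_simp; norm_num,
      Real.mul_rpow hxy.le (by positivity : (0 : ℝ) ≤ 2 ^ (-2 : ℝ) * t⁻¹),
      Real.mul_rpow (by positivity : (0 : ℝ) ≤ 2 ^ (-2 : ℝ)) (by positivity : (0 : ℝ) ≤ t⁻¹),
      Real.inv_rpow ht.le, ← Real.rpow_mul (by norm_num), ← Real.rpow_neg ht.le]
    calc _ = ((x * y) ^ (-lam + 1 / 2) * (x * y) ^ (lam - 1 / 2)) *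
          (2 ^ (-1 : ℝ) * 2 ^ (-2 * (lam - 1 / 2))) * (t ^ (-1 : ℝ) * t ^ (-(lam - 1 / 2))) := by
          rw [Real.rpow_neg_one, Real.rpow_neg_one]; field_simp
      _ = _ := by
          rw [← Real.rpow_add hxy, ← Real.rpow_add (by norm_num), ← Real.rpow_add ht,
            show -lam + 1 / 2 + (lam - 1 / 2) = 0 by ring, Real.rpow_zero, one_mul]
          ring_nf
  calc _ = (x * y) ^ (-lam + 1 / 2) / (2 * t) * (x * y / (2 * t) / 2) ^ (lam - 1 / 2) /
        Real.Gamma (lam + 1 / 2) * (Real.exp (-(x ^ 2 + y ^ 2) / (4 * t)) *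
          ∫ s, Real.exp (x * y / (2 * t) * s) ∂μ) := by ring
    _ = _ := by rw [h3, heatConst]; ring

/-! ### Smoothness of two-parameter Laplace transforms -/

section Laplace

variable {Ω : Type*} [MeasurableSpace Ω] {m : Measure Ω}

/-- The two-parameter Laplace transform `∫ exp (a p₁ + b p₂) g dm`. -/
def laplace (m : Measure Ω) (a b g : Ω → ℝ) (p : ℝ × ℝ) : ℝ :=
  ∫ w, Real.exp (a w * p.1 + b w * p.2) * g w ∂m

/-- The factor `|a|+|b|` costs `ε⁻¹ e^{ε(|a|+|b|)}`, and moving from `q` to `p` costs another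
`e^{ε(|a|+|b|)}`. The total `e^{2ε(|a|+|b|)}` is attained at one of the four corners, according to
the signs of `a` and `b`. The majorant is thus a sum of exponentials of the same kind at nearby
parameters, independent of `q`. -/
theorem abs_add_abs_mul_exp_le (a b p₁ p₂ q₁ q₂ : ℝ) {ε : ℝ} (hε : 0 < ε)
    (h₁ : |q₁ - p₁| ≤ ε) (h₂ : |q₂ - p₂| ≤ ε) :
    (|a| + |b|) * Real.exp (a * q₁ + b * q₂) ≤
      ε⁻¹ * (Real.exp (a * (p₁ + 2 * ε) + b * (p₂ + 2 * ε)) +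
        Real.exp (a * (p₁ + 2 * ε) + b * (p₂ - 2 * ε)) +
        Real.exp (a * (p₁ - 2 * ε) + b * (p₂ + 2 * ε)) +
        Real.exp (a * (p₁ - 2 * ε) + b * (p₂ - 2 * ε))) := by
  have key : (|a| + |b|) * Real.exp (a * q₁ + b * q₂) ≤
      ε⁻¹ * Real.exp (a * p₁ + b * p₂ + 2 * ε * |a| + 2 * ε * |b|) := by
    have e1 : |a| + |b| ≤ ε⁻¹ * Real.exp (ε * (|a| + |b|)) := by
      have := Real.add_one_le_exp (ε * (|a| + |b|))
      rw [inv_mul_eq_div, le_div_iff₀ hε]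
      linarith
    have e2 : a * q₁ + b * q₂ ≤ a * p₁ + b * p₂ + ε * (|a| + |b|) := by
      have i1 : a * (q₁ - p₁) ≤ |a| * ε :=
        (le_abs_self _).trans (by rw [abs_mul]; gcongr)
      have i2 : b * (q₂ - p₂) ≤ |b| * ε :=
        (le_abs_self _).trans (by rw [abs_mul]; gcongr)
      linarith
    calc _ ≤ ε⁻¹ * Real.exp (ε * (|a| + |b|)) *
          Real.exp (a * p₁ + b * p₂ + ε * (|a| + |b|)) := by gcongr
      _ = _ := by rw [mul_assoc, ← Real.exp_add]; ring_nf
  refine key.trans ?_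
  gcongr
  have e1 := Real.exp_nonneg (a * (p₁ + 2 * ε) + b * (p₂ + 2 * ε))
  have e2 := Real.exp_nonneg (a * (p₁ + 2 * ε) + b * (p₂ - 2 * ε))
  have e3 := Real.exp_nonneg (a * (p₁ - 2 * ε) + b * (p₂ + 2 * ε))
  have e4 := Real.exp_nonneg (a * (p₁ - 2 * ε) + b * (p₂ - 2 * ε))
  rcases abs_cases a with ⟨ha, -⟩ | ⟨ha, -⟩ <;> rcases abs_cases b with ⟨hb, -⟩ | ⟨hb, -⟩ <;>
    rw [ha, hb]
  · rw [show a * p₁ + b * p₂ + 2 * ε * a + 2 * ε * b =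
      a * (p₁ + 2 * ε) + b * (p₂ + 2 * ε) by ring]; linarith
  · rw [show a * p₁ + b * p₂ + 2 * ε * a + 2 * ε * -b =
      a * (p₁ + 2 * ε) + b * (p₂ - 2 * ε) by ring]; linarith
  · rw [show a * p₁ + b * p₂ + 2 * ε * -a + 2 * ε * b =
      a * (p₁ - 2 * ε) + b * (p₂ + 2 * ε) by ring]; linarith
  · rw [show a * p₁ + b * p₂ + 2 * ε * -a + 2 * ε * -b =
      a * (p₁ - 2 * ε) + b * (p₂ - 2 * ε) by ring]; linarith

/-- Exponential integrability on an open set gives, around each of its points, an integrable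
majorant of `(|a| + |b|) exp (a q₁ + b q₂) |g|`. -/
theorem exists_laplace_majorant {a b g : Ω → ℝ} {U : Set (ℝ × ℝ)} (hU : IsOpen U)
    (hg : ∀ p ∈ U, Integrable (fun w => Real.exp (a w * p.1 + b w * p.2) * g w) m)
    {p : ℝ × ℝ} (hp : p ∈ U) :
    ∃ ε > 0, ∃ B : Ω → ℝ, Integrable B m ∧ ∀ w, ∀ q ∈ Metric.ball p ε,
      (|a w| + |b w|) * (Real.exp (a w * q.1 + b w * q.2) * |g w|) ≤ B w := by
  obtain ⟨δ, hδ, hδU⟩ := Metric.isOpen_iff.1 hU p hp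
  -- The corners lie at sup-distance `2 · δ/4 < δ` from `p`, hence inside `U`.
  have hε : 0 < δ / 4 := by positivity
  have hmem : ∀ r₁ r₂ : ℝ, |r₁| ≤ 2 * (δ / 4) → |r₂| ≤ 2 * (δ / 4) → (p.1 + r₁, p.2 + r₂) ∈ U := by
    intro r₁ r₂ h₁ h₂
    refine hδU ?_
    rw [Metric.mem_ball, Prod.dist_eq, Real.dist_eq, Real.dist_eq, add_sub_cancel_left,
      add_sub_cancel_left]
    exact max_lt (by linarith) (by linarith)
  have hpos : |2 * (δ / 4)| ≤ 2 * (δ / 4) := by rw [abs_of_pos (by positivity)]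
  have hneg : |-(2 * (δ / 4))| ≤ 2 * (δ / 4) := by rw [abs_neg]; exact hpos
  refine ⟨δ / 4, hε, _, ((((hg _ (hmem _ _ hpos hpos)).abs.add (hg _ (hmem _ _ hpos hneg)).abs).add
    (hg _ (hmem _ _ hneg hpos)).abs).add (hg _ (hmem _ _ hneg hneg)).abs).const_mul (δ / 4)⁻¹, ?_⟩
  intro w q hq
  rw [Metric.mem_ball, Prod.dist_eq, max_lt_iff, Real.dist_eq, Real.dist_eq] at hq
  have h := abs_add_abs_mul_exp_le (a w) (b w) p.1 p.2 q.1 q.2 hε hq.1.le hq.2.le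
  simp only [Pi.add_apply, abs_mul, Real.abs_exp, ← sub_eq_add_neg]
  calc _ = (|a w| + |b w|) * Real.exp (a w * q.1 + b w * q.2) * |g w| := by ring
    _ ≤ _ := mul_le_mul_of_nonneg_right h (abs_nonneg _)
    _ = _ := by ring

/-- On an open set, exponential integrability survives multiplication of the weight by `a` or `b`;
this allows differentiation to be iterated. -/
theorem integrable_exp_mul_of_abs_le {a b g c : Ω → ℝ} (hc : AEStronglyMeasurable c m)
    {U : Set (ℝ × ℝ)}
    (hU : IsOpen U) (hcab : ∀ w, |c w| ≤ |a w| + |b w|)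
    (hg : ∀ p ∈ U, Integrable (fun w => Real.exp (a w * p.1 + b w * p.2) * g w) m) :
    ∀ p ∈ U, Integrable (fun w => Real.exp (a w * p.1 + b w * p.2) * (c w * g w)) m := by
  intro p hp
  obtain ⟨ε, hε, B, hB, hBle⟩ := exists_laplace_majorant hU hg hp
  refine hB.mono' ?_ (ae_of_all _ fun w => ?_)
  · refine (hc.mul (hg p hp).aestronglyMeasurable).congr (ae_of_all _ fun w => ?_)
    simp only [Pi.mul_apply]; ring
  · refine le_trans ?_ (hBle w p (Metric.mem_ball_self hε))
    rw [Real.norm_eq_abs, abs_mul, abs_mul, Real.abs_exp, mul_left_comm]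
    exact mul_le_mul_of_nonneg_right (hcab w) (by positivity)

theorem hasFDerivAt_laplace {a b g : Ω → ℝ} (ha : AEStronglyMeasurable a m)
    (hb : AEStronglyMeasurable b m) {U : Set (ℝ × ℝ)} (hU : IsOpen U)
    (hg : ∀ p ∈ U, Integrable (fun w => Real.exp (a w * p.1 + b w * p.2) * g w) m)
    {p : ℝ × ℝ} (hp : p ∈ U) :
    HasFDerivAt (laplace m a b g)
      (laplace m a b (fun w => a w * g w) p • ContinuousLinearMap.fst ℝ ℝ ℝ +
        laplace m a b (fun w => b w * g w) p • ContinuousLinearMap.snd ℝ ℝ ℝ) p := by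
  obtain ⟨ε, hε, B, hB, hBle⟩ := exists_laplace_majorant hU hg hp
  have hag := integrable_exp_mul_of_abs_le ha hU
    (fun w => le_add_of_nonneg_right (abs_nonneg _)) hg p hp
  have hbg := integrable_exp_mul_of_abs_le hb hU
    (fun w => le_add_of_nonneg_left (abs_nonneg _)) hg p hp
  have key := hasFDerivAt_integral_of_dominated_of_fderiv_le (μ := m) (x₀ := p)
    (F := fun p w => Real.exp (a w * p.1 + b w * p.2) * g w)
    (F' := fun p w => (Real.exp (a w * p.1 + b w * p.2) * (a w * g w)) •
        ContinuousLinearMap.fst ℝ ℝ ℝ +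
      (Real.exp (a w * p.1 + b w * p.2) * (b w * g w)) • ContinuousLinearMap.snd ℝ ℝ ℝ)
    (bound := B) (Metric.ball_mem_nhds p hε) ?_ (hg p hp) ?_ ?_ hB ?_
  · have h2 := integral_add (hag.smul_const (ContinuousLinearMap.fst ℝ ℝ ℝ))
      (hbg.smul_const (ContinuousLinearMap.snd ℝ ℝ ℝ))
    rw [integral_smul_const, integral_smul_const] at h2
    rw [h2] at key
    exact key
  · filter_upwards [hU.mem_nhds hp] with q hq using (hg q hq).aestronglyMeasurable
  · exact ((hag.smul_const (ContinuousLinearMap.fst ℝ ℝ ℝ)).add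
      (hbg.smul_const (ContinuousLinearMap.snd ℝ ℝ ℝ))).aestronglyMeasurable
  · refine ae_of_all _ fun w q hq => le_trans ?_ (hBle w q hq)
    refine (norm_add_le _ _).trans ?_
    rw [norm_smul, norm_smul]
    calc _ ≤ ‖Real.exp (a w * q.1 + b w * q.2) * (a w * g w)‖ * 1 +
          ‖Real.exp (a w * q.1 + b w * q.2) * (b w * g w)‖ * 1 := by
            gcongr
            · exact ContinuousLinearMap.norm_fst_le ..
            · exact ContinuousLinearMap.norm_snd_le ..
      _ = _ := by
            simp only [norm_mul, Real.norm_eq_abs, Real.abs_exp]; ring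
  · refine ae_of_all _ fun w q _ => ?_
    have h1 : HasFDerivAt (fun p : ℝ × ℝ => a w * p.1 + b w * p.2)
        (a w • ContinuousLinearMap.fst ℝ ℝ ℝ + b w • ContinuousLinearMap.snd ℝ ℝ ℝ) q :=
      (hasFDerivAt_fst.const_mul _).add (hasFDerivAt_snd.const_mul _)
    refine (h1.exp.mul_const (g w)).congr_fderiv ?_
    ext <;> simp <;> ring

/-- The Laplace transform is smooth on any open set on which it converges absolutely. -/
theorem contDiffOn_laplace {a b : Ω → ℝ} (ha : AEStronglyMeasurable a m)
    (hb : AEStronglyMeasurable b m) {U : Set (ℝ × ℝ)} (hU : IsOpen U) {g : Ω → ℝ}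
    (hg : ∀ p ∈ U, Integrable (fun w => Real.exp (a w * p.1 + b w * p.2) * g w) m) :
    ContDiffOn ℝ ∞ (laplace m a b g) U := by
  rw [contDiffOn_infty]
  intro n
  -- The weight must vary: the derivative is built from transforms with weights `a g` and `b g`.
  induction n generalizing g with
  | zero =>
    rw [Nat.cast_zero, contDiffOn_zero]
    exact fun p hp => (hasFDerivAt_laplace ha hb hU hg hp).continuousAt.continuousWithinAt
  | succ n ih =>
    push_cast
    rw [contDiffOn_succ_iff_fderiv_of_isOpen hU]
    refine ⟨fun p hp =>
      (hasFDerivAt_laplace ha hb hU hg hp).differentiableAt.differentiableWithinAt, by simp, ?_⟩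
    have hag := integrable_exp_mul_of_abs_le ha hU
      (fun w => le_add_of_nonneg_right (abs_nonneg _)) hg
    have hbg := integrable_exp_mul_of_abs_le hb hU
      (fun w => le_add_of_nonneg_left (abs_nonneg _)) hg
    refine (((ih hag).smul contDiffOn_const).add ((ih hbg).smul contDiffOn_const)).congr
      fun p hp => (hasFDerivAt_laplace ha hb hU hg hp).fderiv

/-- The derivatives of the Laplace transform: `∫ exp (a p₁ + b p₂) a ^ i b ^ j g dm`. -/
def laplaceMoment (m : Measure Ω) (a b g : Ω → ℝ) (i j : ℕ) : ℝ × ℝ → ℝ :=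
  laplace m a b fun w => a w ^ i * b w ^ j * g w

theorem laplaceMoment_zero_zero (a b g : Ω → ℝ) :
    laplaceMoment m a b g 0 0 = laplace m a b g := by
  simp [laplaceMoment]

theorem integrable_laplaceMoment {a b g : Ω → ℝ} (ha : AEStronglyMeasurable a m)
    (hb : AEStronglyMeasurable b m) {U : Set (ℝ × ℝ)} (hU : IsOpen U)
    (hg : ∀ p ∈ U, Integrable (fun w => Real.exp (a w * p.1 + b w * p.2) * g w) m) (i j : ℕ) :
    ∀ p ∈ U, Integrable
      (fun w => Real.exp (a w * p.1 + b w * p.2) * (a w ^ i * b w ^ j * g w)) m := by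
  induction i with
  | zero =>
    induction j with
    | zero => simpa using hg
    | succ j ih =>
      have := integrable_exp_mul_of_abs_le hb hU (fun w => le_add_of_nonneg_left (abs_nonneg _)) ih
      simpa only [pow_succ', mul_assoc, mul_comm, mul_left_comm] using this
  | succ i ih =>
    have := integrable_exp_mul_of_abs_le ha hU (fun w => le_add_of_nonneg_right (abs_nonneg _)) ih
    simpa only [pow_succ', mul_assoc, mul_comm, mul_left_comm] using this

theorem hasDerivAt_laplaceMoment_comp {a b g : Ω → ℝ} (ha : AEStronglyMeasurable a m)
    (hb : AEStronglyMeasurable b m) {U : Set (ℝ × ℝ)} (hU : IsOpen U)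
    (hg : ∀ p ∈ U, Integrable (fun w => Real.exp (a w * p.1 + b w * p.2) * g w) m) (i j : ℕ)
    {α β : ℝ → ℝ} {α' β' t : ℝ} (hα : HasDerivAt α α' t) (hβ : HasDerivAt β β' t)
    (hU' : (α t, β t) ∈ U) :
    HasDerivAt (fun t => laplaceMoment m a b g i j (α t, β t))
      (laplaceMoment m a b g (i + 1) j (α t, β t) * α' +
        laplaceMoment m a b g i (j + 1) (α t, β t) * β') t := by
  have h := (hasFDerivAt_laplace ha hb hU
    (integrable_laplaceMoment ha hb hU hg i j) hU').comp_hasDerivAt t (hα.prodMk hβ)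
  refine h.congr_deriv ?_
  have e1 : (fun w => a w * (a w ^ i * b w ^ j * g w)) =
      fun w => a w ^ (i + 1) * b w ^ j * g w := by ext w; ring
  have e2 : (fun w => b w * (a w ^ i * b w ^ j * g w)) =
      fun w => a w ^ i * b w ^ (j + 1) * g w := by ext w; ring
  simp only [e1, e2, laplaceMoment]
  simp

end Laplace

/-! ### The Bessel operator and the growth condition of the heat problem -/

theorem besselOp_of_hasDerivAt {lam x : ℝ} (hx : 0 < x) {u u₁ u₂ : ℝ → ℝ}
    (h₁ : ∀ z, 0 < z → HasDerivAt u (u₁ z) z) (h₂ : HasDerivAt u₁ (u₂ x) x) :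
    besselOp lam u x = -u₂ x - 2 * lam / x * u₁ x := by
  have h : deriv u =ᶠ[𝓝 x] u₁ := by
    filter_upwards [lt_mem_nhds hx] with z hz using (h₁ z hz).deriv
  rw [besselOp, iteratedDeriv_succ, iteratedDeriv_one, h.deriv_eq, h₂.deriv, (h₁ x hx).deriv]

theorem FiniteAgainst.integrableOn {φ f : ℝ → ℝ} (h : FiniteAgainst φ f)
    (hφ : Measurable φ) (hφ0 : ∀ y, 0 < y → 0 ≤ φ y)
    (hf : AEMeasurable f (volume.restrict (Ioi (0 : ℝ)))) :
    IntegrableOn (fun y => φ y * |f y|) (Ioi 0) := by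
  refine ⟨(hφ.aemeasurable.mul hf.norm).aestronglyMeasurable, ?_⟩
  rw [hasFiniteIntegral_iff_ofReal]
  · exact h
  · exact (ae_restrict_mem measurableSet_Ioi).mono fun y hy => mul_nonneg (hφ0 y hy) (abs_nonneg _)

theorem measurable_heatFactor (lam t : ℝ) : Measurable (heatFactor lam t) := by
  unfold heatFactor; fun_prop

theorem heatFactor_eq {lam t y : ℝ} (hy : 0 < y) :
    heatFactor lam t y = y ^ (2 * lam) * (1 + y) ^ (-lam) * Real.exp (-y ^ 2 / (4 * t)) := by
  rw [heatFactor, Real.div_rpow hy.le (by positivity), Real.rpow_neg (by positivity), two_mul,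
    Real.rpow_add hy, add_comm 1 y]
  ring

theorem heatFactor_nonneg {lam t y : ℝ} (hy : 0 < y) : 0 ≤ heatFactor lam t y := by
  rw [heatFactor_eq hy]; positivity

/-- Gaussians of a strictly smaller variance are controlled by the integrability factor. -/
theorem exists_exp_mul_rpow_le_heatFactor {lam : ℝ} (hlam : 0 ≤ lam) {t α : ℝ}
    (hα : 1 / (4 * t) < α) (β : ℝ) :
    ∃ C > 0, ∀ y, 0 < y →
      Real.exp (-α * y ^ 2 + β * y) * y ^ (2 * lam) ≤ C * heatFactor lam t y := by
  obtain ⟨A, hA, hA'⟩ := exists_one_add_rpow_le_exp lam hlam one_pos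
  -- `γ` is the spare Gaussian decay. It absorbs both `e^{βy}` and `(1+y)^λ ≤ A e^y`; maximising
  -- `(β+1)y - γy²` produces the constant.
  set γ := α - 1 / (4 * t) with hγ
  have hγ0 : 0 < γ := by linarith
  refine ⟨A * Real.exp ((β + 1) ^ 2 / (4 * γ)), by positivity, fun y hy => ?_⟩
  rw [heatFactor_eq hy, Real.rpow_neg (by positivity)]
  have h1 := hA' y hy.le
  rw [one_mul] at h1
  have h2 : -α * y ^ 2 + β * y + y ≤ (β + 1) ^ 2 / (4 * γ) + -y ^ 2 / (4 * t) := by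
    have h3 : α = γ + 1 / (4 * t) := by rw [hγ]; ring
    have h4 : (β + 1) * y - γ * y ^ 2 ≤ (β + 1) ^ 2 / (4 * γ) := by
      rw [le_div_iff₀ (by positivity)]
      nlinarith [sq_nonneg (2 * γ * y - (β + 1))]
    have h5 : -y ^ 2 / (4 * t) = -(1 / (4 * t)) * y ^ 2 := by ring
    rw [h5, h3]; linarith
  have h3 : Real.exp (-α * y ^ 2 + β * y) * (1 + y) ^ lam ≤
      A * Real.exp ((β + 1) ^ 2 / (4 * γ)) * Real.exp (-y ^ 2 / (4 * t)) := by
    calc _ ≤ Real.exp (-α * y ^ 2 + β * y) * (A * Real.exp y) := by gcongr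
      _ = A * Real.exp (-α * y ^ 2 + β * y + y) := by rw [Real.exp_add _ y]; ring
      _ ≤ A * Real.exp ((β + 1) ^ 2 / (4 * γ) + -y ^ 2 / (4 * t)) := by gcongr
      _ = _ := by rw [Real.exp_add]; ring
  have hp : 0 < (1 + y) ^ lam := by positivity
  calc _ = (Real.exp (-α * y ^ 2 + β * y) * (1 + y) ^ lam) * (y ^ (2 * lam) * ((1 + y) ^ lam)⁻¹) := by
        field_simp
    _ ≤ (A * Real.exp ((β + 1) ^ 2 / (4 * γ)) * Real.exp (-y ^ 2 / (4 * t))) *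
          (y ^ (2 * lam) * ((1 + y) ^ lam)⁻¹) := by gcongr
    _ = _ := by ring

theorem integrableOn_exp_mul_of_heatFactor {lam : ℝ} (hlam : 0 ≤ lam) {f : ℝ → ℝ}
    (hf : AEMeasurable f (volume.restrict (Ioi (0 : ℝ)))) {t α : ℝ}
    (h : FiniteAgainst (heatFactor lam t) f) (hα : 1 / (4 * t) < α) (β : ℝ) :
    IntegrableOn (fun y => Real.exp (-α * y ^ 2 + β * y) * (f y * y ^ (2 * lam))) (Ioi 0) := by
  obtain ⟨C, hC, hC'⟩ := exists_exp_mul_rpow_le_heatFactor hlam hα β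
  refine Integrable.mono' ((h.integrableOn (measurable_heatFactor _ _)
    (fun y hy => heatFactor_nonneg hy) hf).const_mul C) ?_ ?_
  · exact ((by fun_prop : Measurable fun y : ℝ => Real.exp (-α * y ^ 2 + β * y)).aemeasurable.mul
      (hf.mul (by fun_prop : Measurable fun y : ℝ => y ^ (2 * lam)).aemeasurable)).aestronglyMeasurable
  · refine (ae_restrict_mem measurableSet_Ioi).mono fun y (hy : 0 < y) => ?_
    rw [norm_mul, norm_mul, Real.norm_of_nonneg (Real.exp_nonneg _),
      Real.norm_of_nonneg (by positivity : 0 ≤ y ^ (2 * lam)), Real.norm_eq_abs]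
    calc _ = (Real.exp (-α * y ^ 2 + β * y) * y ^ (2 * lam)) * |f y| := by ring
      _ ≤ (C * heatFactor lam t y) * |f y| :=
        mul_le_mul_of_nonneg_right (hC' y hy) (abs_nonneg _)
      _ = _ := by ring

/-! ### The heat integral: convergence, smoothness and the heat equation -/

section Heat

variable {lam : ℝ} {μ : Measure ℝ} {f : ℝ → ℝ} {t₀ : ℝ}

theorem integrable_heatLaplace (h : IsAngular lam μ) (hlam : 0 ≤ lam)
    (hf : AEMeasurable f (volume.restrict (Ioi (0 : ℝ))))
    (hfin : FiniteAgainst (heatFactor lam t₀) f) :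
    ∀ p ∈ {p : ℝ × ℝ | 1 / (4 * t₀) < p.1}, Integrable
      (fun w : ℝ × ℝ => Real.exp (-w.1 ^ 2 * p.1 + w.1 * w.2 * p.2) * (f w.1 * w.1 ^ (2 * lam)))
      ((volume.restrict (Ioi (0 : ℝ))).prod μ) := by
  intro p hp
  have := h.prob
  -- Since `|s| ≤ 1`, the rate `|p.2|` gives a majorant independent of `s`.
  have h1 := ((integrableOn_exp_mul_of_heatFactor hlam hf hfin hp |p.2|).norm).comp_fst μ
  refine h1.mono' ?_ ?_
  · refine ((by fun_prop : Measurable fun w : ℝ × ℝ =>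
      Real.exp (-w.1 ^ 2 * p.1 + w.1 * w.2 * p.2)).aemeasurable.mul
      (AEMeasurable.mul hf.comp_fst ?_)).aestronglyMeasurable
    exact (by fun_prop : Measurable fun w : ℝ × ℝ => w.1 ^ (2 * lam)).aemeasurable
  · have a1 : ∀ᵐ w ∂((volume.restrict (Ioi (0 : ℝ))).prod μ), 0 < w.1 :=
      Measure.quasiMeasurePreserving_fst.ae (ae_restrict_mem measurableSet_Ioi)
    have a2 : ∀ᵐ w ∂((volume.restrict (Ioi (0 : ℝ))).prod μ), |w.2| ≤ 1 :=
      Measure.quasiMeasurePreserving_snd.ae h.ae_abs_le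
    filter_upwards [a1, a2] with w hw1 hw2
    rw [norm_mul, norm_mul (Real.exp _)]
    gcongr ?_ * _
    rw [Real.norm_of_nonneg (Real.exp_nonneg _), Real.norm_of_nonneg (Real.exp_nonneg _)]
    refine Real.exp_le_exp.2 ?_
    have : w.2 * p.2 ≤ |p.2| := (le_abs_self _).trans (by
      rw [abs_mul]; exact mul_le_of_le_one_left (abs_nonneg _) hw2)
    nlinarith

/-- The heat integral is an elementary modification of these Laplace transforms. -/
def heatMoment (lam : ℝ) (μ : Measure ℝ) (f : ℝ → ℝ) : ℕ → ℕ → ℝ × ℝ → ℝ :=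
  laplaceMoment ((volume.restrict (Ioi (0 : ℝ))).prod μ) (fun w => -w.1 ^ 2)
    (fun w => w.1 * w.2) (fun w => f w.1 * w.1 ^ (2 * lam))

theorem isOpen_fst_gt (c : ℝ) : IsOpen {p : ℝ × ℝ | c < p.1} :=
  isOpen_lt continuous_const continuous_fst

theorem one_div_four_mul_lt {t : ℝ} (ht : 0 < t) (ht₀ : t < t₀) : 1 / (4 * t₀) < 1 / (4 * t) :=
  one_div_lt_one_div_of_lt (by positivity) (by linarith)

/-- Once `e^{-x²/(4t)}` is factored out, the exponent is linear in `(1/(4t), x/(2t))`, with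
coefficients `-y²` and `ys`. -/
theorem heatKernel_mul_eq (h : IsAngular lam μ) (hlam : 0 ≤ lam) {t x y : ℝ} (ht : 0 < t)
    (hx : 0 < x) (hy : 0 < y) :
    heatKernel lam t x y * f y * y ^ (2 * lam) =
      heatConst lam * t ^ (-(lam + 1 / 2)) * Real.exp (-x ^ 2 / (4 * t)) *
      ∫ s, Real.exp (-y ^ 2 * (1 / (4 * t)) + y * s * (x / (2 * t))) *
        (f y * y ^ (2 * lam)) ∂μ := by
  rw [heatKernel_eq h hlam ht hx hy, integral_mul_const]
  have : ∫ s, Real.exp (-(x ^ 2 + y ^ 2 - 2 * x * y * s) / (4 * t)) ∂μ =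
      Real.exp (-x ^ 2 / (4 * t)) *
        ∫ s, Real.exp (-y ^ 2 * (1 / (4 * t)) + y * s * (x / (2 * t))) ∂μ := by
    rw [← integral_const_mul]
    congr 1; ext s
    rw [← Real.exp_add]; congr 1; field_simp; ring
  rw [this]; ring

theorem integrableOn_heatKernel_mul (h : IsAngular lam μ) (hlam : 0 ≤ lam)
    (hf : AEMeasurable f (volume.restrict (Ioi (0 : ℝ))))
    (hfin : FiniteAgainst (heatFactor lam t₀) f) {t x : ℝ} (ht : 0 < t) (ht₀ : t < t₀)
    (hx : 0 < x) :
    IntegrableOn (fun y => heatKernel lam t x y * f y * y ^ (2 * lam)) (Ioi 0) := by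
  have := h.prob
  have h1 := (integrable_heatLaplace h hlam hf hfin (1 / (4 * t), x / (2 * t))
    (one_div_four_mul_lt ht ht₀)).integral_prod_left
  refine (h1.const_mul (heatConst lam * t ^ (-(lam + 1 / 2)) * Real.exp (-x ^ 2 / (4 * t)))).congr
    ((ae_restrict_mem measurableSet_Ioi).mono fun y hy => ?_)
  exact (heatKernel_mul_eq h hlam ht hx hy).symm

theorem heatIntegral_eq (h : IsAngular lam μ) (hlam : 0 ≤ lam)
    (hf : AEMeasurable f (volume.restrict (Ioi (0 : ℝ))))
    (hfin : FiniteAgainst (heatFactor lam t₀) f) {t x : ℝ} (ht : 0 < t) (ht₀ : t < t₀)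
    (hx : 0 < x) :
    heatIntegral lam f t x = heatConst lam * t ^ (-(lam + 1 / 2)) * Real.exp (-x ^ 2 / (4 * t)) *
      heatMoment lam μ f 0 0 (1 / (4 * t), x / (2 * t)) := by
  have := h.prob
  rw [heatMoment, laplaceMoment_zero_zero, laplace, integral_prod _
    (integrable_heatLaplace h hlam hf hfin (1 / (4 * t), x / (2 * t))
    (one_div_four_mul_lt ht ht₀)), ← integral_const_mul, heatIntegral]
  exact setIntegral_congr_fun measurableSet_Ioi fun y hy => heatKernel_mul_eq h hlam ht hx hy

/-- The integrated form of the Bessel equation. -/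
theorem heatMoment_relation (h : IsAngular lam μ) (hlam : 0 ≤ lam)
    (hf : AEMeasurable f (volume.restrict (Ioi (0 : ℝ))))
    (hfin : FiniteAgainst (heatFactor lam t₀) f) {p : ℝ × ℝ} (hp : 1 / (4 * t₀) < p.1)
    (hp2 : p.2 ≠ 0) :
    heatMoment lam μ f 0 2 p + 2 * lam / p.2 * heatMoment lam μ f 0 1 p +
      heatMoment lam μ f 1 0 p = 0 := by
  have := h.prob
  have hI := fun i j => integrable_laplaceMoment
    (by fun_prop : AEStronglyMeasurable (fun w : ℝ × ℝ => -w.1 ^ 2) _)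
    (by fun_prop : AEStronglyMeasurable (fun w : ℝ × ℝ => w.1 * w.2) _)
    (isOpen_fst_gt _) (integrable_heatLaplace h hlam hf hfin) i j p hp
  have hsum := ((hI 0 2).add ((hI 0 1).const_mul (2 * lam / p.2))).add (hI 1 0)
  rw [heatMoment]
  simp only [laplaceMoment, laplace]
  have hadd := integral_add ((hI 0 2).add ((hI 0 1).const_mul (2 * lam / p.2))) (hI 1 0)
  simp only [Pi.add_apply] at hadd
  rw [← integral_const_mul, ← integral_add (hI 0 2) ((hI 0 1).const_mul (2 * lam / p.2)), ← hadd]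
  refine (integral_prod _ hsum).trans (integral_eq_zero_of_ae (ae_of_all _ fun y => ?_))
  -- The three moments combine through `(ys)² + (2λ/p₂) ys - y² = (y/p₂)((s²-1) y p₂ + 2λ s)`, which
  -- is the integration by parts expression for `e^{y p₂ s}`.
  have h2 := h.integral_parts (fun s => Real.exp (y * p.2 * s))
    (fun s => y * p.2 * Real.exp (y * p.2 * s))
    (fun s => by simpa [mul_comm] using ((hasDerivAt_id s).const_mul (y * p.2)).exp) (by fun_prop)
  simp only [Pi.add_apply, Pi.zero_apply]
  trans ∫ s, (y / p.2 * Real.exp (-y ^ 2 * p.1) * (f y * y ^ (2 * lam))) *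
    ((s ^ 2 - 1) * (y * p.2 * Real.exp (y * p.2 * s)) + 2 * lam * s * Real.exp (y * p.2 * s)) ∂μ
  · congr 1; ext s
    rw [show -y ^ 2 * p.1 + y * s * p.2 = -y ^ 2 * p.1 + y * p.2 * s by ring, Real.exp_add]
    field_simp
    ring
  · rw [integral_const_mul, h2, mul_zero]

theorem contDiffOn_heatIntegral (h : IsAngular lam μ) (hlam : 0 ≤ lam)
    (hf : AEMeasurable f (volume.restrict (Ioi (0 : ℝ))))
    (hfin : FiniteAgainst (heatFactor lam t₀) f) :
    ContDiffOn ℝ ∞ (fun p : ℝ × ℝ => heatIntegral lam f p.1 p.2)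
      {p : ℝ × ℝ | 0 < p.1 ∧ p.1 < t₀ ∧ 0 < p.2} := by
  have h1 : ContDiffOn ℝ ∞ (heatMoment lam μ f 0 0) {p : ℝ × ℝ | 1 / (4 * t₀) < p.1} := by
    rw [heatMoment, laplaceMoment_zero_zero]
    exact contDiffOn_laplace (by fun_prop) (by fun_prop) (isOpen_fst_gt _)
      (integrable_heatLaplace h hlam hf hfin)
  have h2 : ContDiffOn ℝ ∞ (fun p : ℝ × ℝ => (1 / (4 * p.1), p.2 / (2 * p.1)))
      {p : ℝ × ℝ | 0 < p.1 ∧ p.1 < t₀ ∧ 0 < p.2} := by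
    refine ContDiffOn.prodMk ?_ ?_
    · exact contDiffOn_const.div (by fun_prop) fun p hp => by have := hp.1; positivity
    · exact contDiffOn_snd.div (by fun_prop) fun p hp => by have := hp.1; positivity
  have h3 : ContDiffOn ℝ ∞ (fun p : ℝ × ℝ =>
      heatConst lam * p.1 ^ (-(lam + 1 / 2)) * Real.exp (-p.2 ^ 2 / (4 * p.1)))
      {p : ℝ × ℝ | 0 < p.1 ∧ p.1 < t₀ ∧ 0 < p.2} := by
    refine (contDiffOn_const.mul (contDiffOn_fst.rpow_const_of_ne fun p hp => hp.1.ne')).mul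
      (ContDiffOn.exp (ContDiffOn.div (by fun_prop) (by fun_prop) fun p hp => ?_))
    have := hp.1; positivity
  refine (h3.mul (h1.comp h2 fun p hp => one_div_four_mul_lt hp.1 hp.2.1)).congr fun p hp => ?_
  exact heatIntegral_eq h hlam hf hfin hp.1 hp.2.1 hp.2.2

theorem hasDerivAt_heatMoment_comp (h : IsAngular lam μ) (hlam : 0 ≤ lam)
    (hf : AEMeasurable f (volume.restrict (Ioi (0 : ℝ))))
    (hfin : FiniteAgainst (heatFactor lam t₀) f) (i j : ℕ)
    {α β : ℝ → ℝ} {α' β' t : ℝ} (hα : HasDerivAt α α' t) (hβ : HasDerivAt β β' t)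
    (hU : 1 / (4 * t₀) < α t) :
    HasDerivAt (fun t => heatMoment lam μ f i j (α t, β t))
      (heatMoment lam μ f (i + 1) j (α t, β t) * α' +
        heatMoment lam μ f i (j + 1) (α t, β t) * β') t :=
  hasDerivAt_laplaceMoment_comp (by fun_prop) (by fun_prop) (isOpen_fst_gt _)
    (integrable_heatLaplace h hlam hf hfin) i j hα hβ hU

/-- The time derivative involves the moments `00`, `10`, `01`, and the space derivatives `00`, `01`,
`02`. Eliminating `10` by `heatMoment_relation` makes the two sides agree. -/
theorem deriv_heatIntegral (h : IsAngular lam μ) (hlam : 0 ≤ lam)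
    (hf : AEMeasurable f (volume.restrict (Ioi (0 : ℝ))))
    (hfin : FiniteAgainst (heatFactor lam t₀) f) {t x : ℝ} (ht : 0 < t) (ht₀ : t < t₀)
    (hx : 0 < x) :
    deriv (fun s => heatIntegral lam f s x) t = -besselOp lam (heatIntegral lam f t) x := by
  set c := heatConst lam
  set L := heatMoment lam μ f
  have hmem := one_div_four_mul_lt ht ht₀
  -- derivative in time
  have dt : HasDerivAt (fun s => heatIntegral lam f s x)
      (c * t ^ (-(lam + 1 / 2)) * Real.exp (-x ^ 2 / (4 * t)) *
        ((-(lam + 1 / 2) / t + x ^ 2 / (4 * t ^ 2)) * L 0 0 (1 / (4 * t), x / (2 * t))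
          - L 1 0 (1 / (4 * t), x / (2 * t)) / (4 * t ^ 2)
          - L 0 1 (1 / (4 * t), x / (2 * t)) * x / (2 * t ^ 2))) t := by
    have e1 : HasDerivAt (fun s : ℝ => 1 / (4 * s)) (-1 / (4 * t ^ 2)) t := by
      refine ((hasDerivAt_const t (1 : ℝ)).div ((hasDerivAt_id t).const_mul 4)
        (by simp [ht.ne'])).congr_deriv ?_
      simp only [id]; field_simp; ring
    have e2 : HasDerivAt (fun s : ℝ => x / (2 * s)) (-x / (2 * t ^ 2)) t := by
      refine ((hasDerivAt_const t x).div ((hasDerivAt_id t).const_mul 2)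
        (by simp [ht.ne'])).congr_deriv ?_
      simp only [id]; field_simp; ring
    have e3 : HasDerivAt (fun s : ℝ => Real.exp (-x ^ 2 / (4 * s)))
        (Real.exp (-x ^ 2 / (4 * t)) * (x ^ 2 / (4 * t ^ 2))) t := by
      have : HasDerivAt (fun s : ℝ => -x ^ 2 / (4 * s)) (x ^ 2 / (4 * t ^ 2)) t := by
        refine ((hasDerivAt_const t (-x ^ 2)).div ((hasDerivAt_id t).const_mul 4)
          (by simp [ht.ne'])).congr_deriv ?_
        simp only [id]; field_simp; ring
      exact this.exp
    have e4 := Real.hasDerivAt_rpow_const (x := t) (p := -(lam + 1 / 2)) (Or.inl ht.ne')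
    have e5 := hasDerivAt_heatMoment_comp h hlam hf hfin 0 0 e1 e2 hmem
    have e6 := ((e4.const_mul c).mul e3).mul e5
    refine (e6.congr_of_eventuallyEq ?_).congr_deriv ?_
    · filter_upwards [lt_mem_nhds ht, gt_mem_nhds ht₀] with s hs hs₀
      exact heatIntegral_eq h hlam hf hfin hs hs₀ hx
    · rw [Real.rpow_sub_one ht.ne']
      simp only [Pi.mul_apply, zero_add]
      field_simp
      ring
  -- derivatives in space
  have dk : ∀ j : ℕ, ∀ z, HasDerivAt (fun z => L 0 j (1 / (4 * t), z / (2 * t)))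
      (L 0 (j + 1) (1 / (4 * t), z / (2 * t)) / (2 * t)) z := by
    intro j z
    refine (hasDerivAt_heatMoment_comp h hlam hf hfin 0 j (hasDerivAt_const z (1 / (4 * t)))
      ((hasDerivAt_id z).div_const (2 * t)) hmem).congr_deriv ?_
    simp only [id, mul_zero, zero_add, mul_one_div]
    rfl
  have de : ∀ z, HasDerivAt (fun z => c * t ^ (-(lam + 1 / 2)) * Real.exp (-z ^ 2 / (4 * t)))
      (c * t ^ (-(lam + 1 / 2)) * (Real.exp (-z ^ 2 / (4 * t)) * (-z / (2 * t)))) z := by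
    intro z
    refine HasDerivAt.const_mul _ ?_
    refine (((hasDerivAt_id z).pow 2).neg.div_const (4 * t)).exp.congr_deriv ?_
    simp only [id, Pi.pow_apply, Pi.neg_apply]
    push_cast
    field_simp
    ring
  have d1 : ∀ z, 0 < z → HasDerivAt (heatIntegral lam f t)
      (c * t ^ (-(lam + 1 / 2)) * Real.exp (-z ^ 2 / (4 * t)) *
        (-z / (2 * t) * L 0 0 (1 / (4 * t), z / (2 * t)) +
          L 0 1 (1 / (4 * t), z / (2 * t)) / (2 * t))) z := by
    intro z hz
    refine (((de z).mul (dk 0 z)).congr_of_eventuallyEq ?_).congr_deriv ?_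
    · filter_upwards [lt_mem_nhds hz] with s hs
      exact heatIntegral_eq h hlam hf hfin ht ht₀ hs
    · simp only [zero_add]; ring
  have d2 : HasDerivAt (fun z => c * t ^ (-(lam + 1 / 2)) * Real.exp (-z ^ 2 / (4 * t)) *
        (-z / (2 * t) * L 0 0 (1 / (4 * t), z / (2 * t)) +
          L 0 1 (1 / (4 * t), z / (2 * t)) / (2 * t)))
      (c * t ^ (-(lam + 1 / 2)) * Real.exp (-x ^ 2 / (4 * t)) *
        ((x ^ 2 / (4 * t ^ 2) - 1 / (2 * t)) * L 0 0 (1 / (4 * t), x / (2 * t))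
          - x * L 0 1 (1 / (4 * t), x / (2 * t)) / (2 * t ^ 2)
          + L 0 2 (1 / (4 * t), x / (2 * t)) / (4 * t ^ 2))) x := by
    refine ((de x).mul ((((hasDerivAt_id x).neg.div_const (2 * t)).mul (dk 0 x)).add
      ((dk 1 x).div_const (2 * t)))).congr_deriv ?_
    simp only [Pi.mul_apply, Pi.add_apply, Pi.neg_apply, id, zero_add, one_add_one_eq_two]
    field_simp
    ring
  rw [dt.deriv, besselOp_of_hasDerivAt hx d1 (u₂ := fun x => _) d2]
  have hrel := heatMoment_relation h hlam hf hfin (p := (1 / (4 * t), x / (2 * t))) hmem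
    (by positivity : x / (2 * t) ≠ 0)
  have hrel' : L 1 0 (1 / (4 * t), x / (2 * t)) = -(L 0 2 (1 / (4 * t), x / (2 * t)) +
      4 * lam * t / x * L 0 1 (1 / (4 * t), x / (2 * t))) := by
    have : 2 * lam / (x / (2 * t)) = 4 * lam * t / x := by field_simp; ring
    rw [← this]
    simp only [L] at hrel ⊢
    linarith
  rw [hrel']
  field_simp
  ring

end Heat

/-! ### The Poisson kernel as an angular average -/

theorem iteratedDeriv_two_of_hasDerivAt {t : ℝ} (ht : 0 < t) {u u₁ : ℝ → ℝ} {u₂ : ℝ}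
    (h₁ : ∀ z, 0 < z → HasDerivAt u (u₁ z) z) (h₂ : HasDerivAt u₁ u₂ t) :
    iteratedDeriv 2 u t = u₂ := by
  have h : deriv u =ᶠ[𝓝 t] u₁ := by
    filter_upwards [lt_mem_nhds ht] with z hz using (h₁ z hz).deriv
  rw [iteratedDeriv_succ, iteratedDeriv_one, h.deriv_eq, h₂.deriv]

/-- The substitution `r = 1/u` turns it into a Gamma integral. It serves with `p = λ+1` for the
kernel, `p = 1/2` for the mass of the subordinator and `p = 1` for the Cauchy bound. -/
theorem integral_rpow_mul_exp_neg_div {p D : ℝ} (hp : 0 < p) (hD : 0 < D) :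
    ∫ u in Ioi (0 : ℝ), u ^ (-(p + 1)) * Real.exp (-D / (4 * u)) =
      Real.Gamma p * 4 ^ p * D ^ (-p) := by
  have h1 := integral_comp_rpow_Ioi (fun r : ℝ => r ^ (p - 1) * Real.exp (-(D / 4 * r)))
    (show (-1 : ℝ) ≠ 0 by norm_num)
  rw [Real.integral_rpow_mul_exp_neg_mul_Ioi hp (by positivity)] at h1
  have h2 : (1 / (D / 4)) ^ p * Real.Gamma p = Real.Gamma p * 4 ^ p * D ^ (-p) := by
    rw [one_div_div, Real.div_rpow (by norm_num) hD.le, Real.rpow_neg hD.le]; ring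
  rw [← h2, ← h1]
  refine setIntegral_congr_fun measurableSet_Ioi fun u (hu : 0 < u) => ?_
  simp only [smul_eq_mul]
  rw [← Real.rpow_mul hu.le, abs_neg, abs_one, one_mul, ← mul_assoc, ← Real.rpow_add hu,
    Real.rpow_neg_one]
  congr 2
  · ring
  · field_simp

theorem integrableOn_rpow_mul_exp_neg_div {p D : ℝ} (hp : 0 < p) (hD : 0 < D) :
    IntegrableOn (fun u : ℝ => u ^ (-(p + 1)) * Real.exp (-D / (4 * u))) (Ioi 0) := by
  refine not_imp_comm.1 integral_undef ?_
  rw [integral_rpow_mul_exp_neg_div hp hD]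
  have := Real.Gamma_pos_of_pos hp
  positivity

theorem integrableOn_rpow_mul_exp_neg {p D : ℝ} (hp : 0 < p) (hD : 0 < D) :
    IntegrableOn (fun r : ℝ => r ^ (p - 1) * Real.exp (-(D * r))) (Ioi 0) := by
  refine not_imp_comm.1 integral_undef ?_
  rw [Real.integral_rpow_mul_exp_neg_mul_Ioi hp hD]
  have := Real.Gamma_pos_of_pos hp
  positivity

/-- The normalising constant of the Bessel Poisson kernel. -/
def poissonConst (lam : ℝ) : ℝ :=
  heatConst lam * Real.Gamma (lam + 1) * 4 ^ (lam + 1) / Real.sqrt (4 * Real.pi)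

theorem poissonConst_pos {lam : ℝ} (hlam : 0 ≤ lam) : 0 < poissonConst lam := by
  have h1 := heatConst_pos hlam
  have h2 := Real.Gamma_pos_of_pos (by linarith : 0 < lam + 1)
  have := Real.pi_pos
  unfold poissonConst; positivity

theorem sq_sub_le {x y s : ℝ} (hx : 0 < x) (hy : 0 < y) (hs : |s| ≤ 1) :
    (x - y) ^ 2 ≤ x ^ 2 + y ^ 2 - 2 * x * y * s := by
  nlinarith [(abs_le.1 hs).2, mul_pos hx hy]

/-- The Bessel Poisson kernel as an average of powers. -/
theorem poissonKernel_eq {lam : ℝ} {μ : Measure ℝ} (h : IsAngular lam μ) (hlam : 0 ≤ lam)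
    {t x y : ℝ} (ht : 0 < t) (hx : 0 < x) (hy : 0 < y) :
    poissonKernel lam t x y = poissonConst lam * t *
      ∫ s, (t ^ 2 + (x ^ 2 + y ^ 2 - 2 * x * y * s)) ^ (-(lam + 1)) ∂μ := by
  have := h.prob
  have hD : ∀ᵐ s ∂μ, t ^ 2 ≤ t ^ 2 + (x ^ 2 + y ^ 2 - 2 * x * y * s) :=
    h.ae_abs_le.mono fun s hs => by nlinarith [sq_sub_le hx hy hs, sq_nonneg (x - y)]
  have h1 : ∀ u ∈ Ioi (0 : ℝ), Real.exp (-t ^ 2 / (4 * u)) * heatKernel lam u x y / u ^ (3 / 2 : ℝ) =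
      heatConst lam * ∫ s, u ^ (-(lam + 1 + 1)) *
        Real.exp (-(t ^ 2 + (x ^ 2 + y ^ 2 - 2 * x * y * s)) / (4 * u)) ∂μ := by
    intro u (hu : 0 < u)
    have e1 : ∀ s, Real.exp (-(t ^ 2 + (x ^ 2 + y ^ 2 - 2 * x * y * s)) / (4 * u)) =
        Real.exp (-t ^ 2 / (4 * u)) * Real.exp (-(x ^ 2 + y ^ 2 - 2 * x * y * s) / (4 * u)) := by
      intro s; rw [← Real.exp_add]; ring_nf
    have e2 : u ^ (-(lam + 1 + 1)) = u ^ (-(lam + 1 / 2)) / u ^ (3 / 2 : ℝ) := by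
      rw [← Real.rpow_sub hu]; ring_nf
    simp_rw [e1]
    rw [integral_const_mul, integral_const_mul, heatKernel_eq h hlam hu hx hy, e2]
    ring
  rw [poissonKernel, setIntegral_congr_fun measurableSet_Ioi h1, integral_const_mul,
    integral_integral_swap]
  · have h2 : ∀ᵐ s ∂μ, ∫ u in Ioi (0 : ℝ), u ^ (-(lam + 1 + 1)) *
        Real.exp (-(t ^ 2 + (x ^ 2 + y ^ 2 - 2 * x * y * s)) / (4 * u)) =
        Real.Gamma (lam + 1) * 4 ^ (lam + 1) *
          (t ^ 2 + (x ^ 2 + y ^ 2 - 2 * x * y * s)) ^ (-(lam + 1)) := by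
      filter_upwards [hD] with s hs
      exact integral_rpow_mul_exp_neg_div (by linarith) (lt_of_lt_of_le (by positivity) hs)
    rw [integral_congr_ae h2, integral_const_mul, poissonConst]
    ring
  -- Fubini: replacing the denominator by its lower bound `t²` gives a majorant independent of `s`.
  · refine ((integrableOn_rpow_mul_exp_neg_div (by linarith : 0 < lam + 1)
      (by positivity : 0 < t ^ 2)).comp_fst μ).mono' ?_ ?_
    · exact Measurable.aestronglyMeasurable (by fun_prop)
    · have a1 : ∀ᵐ w ∂((volume.restrict (Ioi (0 : ℝ))).prod μ), 0 < w.1 :=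
        Measure.quasiMeasurePreserving_fst.ae (ae_restrict_mem measurableSet_Ioi)
      have a2 := Measure.quasiMeasurePreserving_snd (μ := volume.restrict (Ioi (0 : ℝ))).ae hD
      filter_upwards [a1, a2] with w hw1 hw2
      simp only [Function.uncurry]
      rw [Real.norm_of_nonneg (by positivity)]
      gcongr

theorem measurable_poissonFactor (lam : ℝ) : Measurable (poissonFactor lam) := by
  unfold poissonFactor; fun_prop

theorem poissonFactor_nonneg {lam y : ℝ} (hy : 0 < y) : 0 ≤ poissonFactor lam y := by
  unfold poissonFactor; positivity

/-- With `κ(1+q) = q - x²`, the quadratic `(1-κ)|y|² - 2|x||y| + (q-κ)` has reduced discriminant `x²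
- (1-κ)(q-κ) = -κ²`, so it is nonnegative. This makes the denominator at least a multiple of `1+y²`,
as `poissonFactor` requires. -/
theorem le_poissonDenominator {q x y s : ℝ} (hq : x ^ 2 < q) (hs : |s| ≤ 1) :
    (q - x ^ 2) / (1 + q) * (1 + y ^ 2) ≤ q + y ^ 2 - 2 * x * y * s := by
  have hq0 : 0 < q := lt_of_le_of_lt (sq_nonneg x) hq
  set κ := (q - x ^ 2) / (1 + q) with hκ
  have hκ1 : κ * (1 + q) = q - x ^ 2 := by rw [hκ]; field_simp
  have hκ2 : κ < 1 := by rw [hκ, div_lt_one (by positivity)]; nlinarith [sq_nonneg x]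
  have h1 : x * y * s ≤ |x| * |y| := by
    refine (le_abs_self _).trans ?_
    rw [abs_mul, abs_mul]
    exact mul_le_of_le_one_right (by positivity) hs
  have h2 : 0 ≤ (1 - κ) * ((1 - κ) * |y| ^ 2 - 2 * (|x| * |y|) + (q - κ)) := by
    have : (1 - κ) * ((1 - κ) * |y| ^ 2 - 2 * (|x| * |y|) + (q - κ)) =
        ((1 - κ) * |y| - |x|) ^ 2 + κ ^ 2 + (q - |x| ^ 2 - κ * (1 + q)) := by ring
    rw [this, sq_abs, hκ1]
    nlinarith [sq_nonneg κ, sq_nonneg ((1 - κ) * |y| - |x|)]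
  have h3 := nonneg_of_mul_nonneg_right h2 (by linarith)
  rw [sq_abs] at h3
  linarith

/-! ### The Poisson integral: convergence, smoothness and the Poisson equation -/

section Poisson

variable {lam : ℝ} {μ : Measure ℝ} {f : ℝ → ℝ}

/-- The product measure `dy ⊗ dμ(s) ⊗ dr`. -/
def poissonMeasure (μ : Measure ℝ) : Measure ((ℝ × ℝ) × ℝ) :=
  ((volume.restrict (Ioi (0 : ℝ))).prod μ).prod (volume.restrict (Ioi (0 : ℝ)))

theorem ae_poissonMeasure_base (h : IsAngular lam μ) :
    ∀ᵐ w ∂((volume.restrict (Ioi (0 : ℝ))).prod μ), 0 < w.1 ∧ |w.2| ≤ 1 := by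
  have := h.prob
  exact (Measure.quasiMeasurePreserving_fst.ae (ae_restrict_mem measurableSet_Ioi)).and
    (Measure.quasiMeasurePreserving_snd.ae h.ae_abs_le)

/-- Integrating `r` out of the absolute value leaves `Γ(ρ) D^{-σ}` times the weight; as `σ ≥ λ+1`,
this is controlled by `(1+y²)^{-(λ+1)}`. The case `ρ = σ = λ+1` is the transform itself, while `σ =
λ+2` with `ρ = λ+2, λ+3` enters the Poisson equation. -/
theorem integrable_poisson_weight (h : IsAngular lam μ) (hlam : 0 ≤ lam)
    (hf : AEMeasurable f (volume.restrict (Ioi (0 : ℝ))))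
    (hfin : FiniteAgainst (poissonFactor lam) f) {p : ℝ × ℝ} (hp : p.2 ^ 2 < p.1)
    {ρ σ : ℝ} (hρ : 0 < ρ) (hσ : lam + 1 ≤ σ) :
    Integrable (fun w : (ℝ × ℝ) × ℝ =>
      (p.1 + w.1.1 ^ 2 - 2 * p.2 * w.1.1 * w.1.2) ^ (ρ - σ) * (w.2 ^ (ρ - 1) *
        Real.exp (-((p.1 + w.1.1 ^ 2 - 2 * p.2 * w.1.1 * w.1.2) * w.2))) *
        (f w.1.1 * w.1.1 ^ (2 * lam))) (poissonMeasure μ) := by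
  have := h.prob
  set D : ℝ × ℝ → ℝ := fun w => p.1 + w.1 ^ 2 - 2 * p.2 * w.1 * w.2 with hDdef
  have hDm : Measurable D := by fun_prop
  set κ := (p.1 - p.2 ^ 2) / (1 + p.1) with hκdef
  have hp0 : 0 < p.1 := lt_of_le_of_lt (sq_nonneg _) hp
  have hκ : 0 < κ := div_pos (by linarith) (by linarith)
  have hD : ∀ w : ℝ × ℝ, |w.2| ≤ 1 → κ * (1 + w.1 ^ 2) ≤ D w := fun w hw =>
    le_poissonDenominator hp hw
  have hΓ := Real.Gamma_pos_of_pos hρ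
  have hfm : AEMeasurable (fun w : ℝ × ℝ => f w.1 * w.1 ^ (2 * lam))
      ((volume.restrict (Ioi (0 : ℝ))).prod μ) :=
    AEMeasurable.mul hf.comp_fst
      (by fun_prop : Measurable fun w : ℝ × ℝ => w.1 ^ (2 * lam)).aemeasurable
  rw [poissonMeasure, integrable_prod_iff]
  · constructor
    · filter_upwards [ae_poissonMeasure_base h] with w hw
      have hDw : 0 < D w := lt_of_lt_of_le (by positivity) (hD w hw.2)
      exact ((integrableOn_rpow_mul_exp_neg hρ hDw).const_mul _).mul_const _
    · have hnorm : ∀ᵐ w ∂((volume.restrict (Ioi (0 : ℝ))).prod μ),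
          ∫ r in Ioi (0 : ℝ), ‖D w ^ (ρ - σ) * (r ^ (ρ - 1) * Real.exp (-(D w * r))) *
            (f w.1 * w.1 ^ (2 * lam))‖ =
          Real.Gamma ρ * D w ^ (-σ) * |f w.1 * w.1 ^ (2 * lam)| := by
        filter_upwards [ae_poissonMeasure_base h] with w hw
        have hDw : 0 < D w := lt_of_lt_of_le (by positivity) (hD w hw.2)
        rw [setIntegral_congr_fun measurableSet_Ioi (g := fun r => D w ^ (ρ - σ) *
          (r ^ (ρ - 1) * Real.exp (-(D w * r))) * |f w.1 * w.1 ^ (2 * lam)|), integral_mul_const,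
          integral_const_mul, Real.integral_rpow_mul_exp_neg_mul_Ioi hρ hDw, one_div,
          Real.inv_rpow hDw.le, ← Real.rpow_neg hDw.le, ← mul_assoc, ← Real.rpow_add hDw]
        · ring_nf
        · intro r (hr : 0 < r)
          simp only
          rw [norm_mul, Real.norm_of_nonneg (by positivity), Real.norm_eq_abs]
      refine Integrable.congr ?_ (hnorm.mono fun w hw => hw.symm)
      have hI := ((hfin.integrableOn (measurable_poissonFactor lam)
        (fun y hy => poissonFactor_nonneg hy) hf).const_mul
          (Real.Gamma ρ * (κ ^ (-σ)))).comp_fst μ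
      refine hI.mono' ?_ ?_
      · exact ((Measurable.aemeasurable (by fun_prop)).mul hfm.norm).aestronglyMeasurable
      · filter_upwards [ae_poissonMeasure_base h] with w hw
        have hDw : 0 < D w := lt_of_lt_of_le (by positivity) (hD w hw.2)
        have hw1 := hw.1
        rw [Real.norm_of_nonneg (by positivity), abs_mul,
          abs_of_nonneg (by positivity : 0 ≤ w.1 ^ (2 * lam)), poissonFactor]
        have e1 : D w ^ (-σ) ≤ κ ^ (-σ) * (w.1 ^ 2 + 1) ^ (-(lam + 1)) := by
          calc D w ^ (-σ) ≤ (κ * (1 + w.1 ^ 2)) ^ (-σ) :=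
                Real.rpow_le_rpow_of_nonpos (by positivity) (hD w hw.2) (by linarith)
            _ = κ ^ (-σ) * (w.1 ^ 2 + 1) ^ (-σ) := by
                rw [Real.mul_rpow hκ.le (by positivity), add_comm]
            _ ≤ _ := by
                gcongr
                nlinarith [sq_nonneg w.1]
        rw [Real.rpow_neg (by positivity : 0 ≤ w.1 ^ 2 + 1)] at e1
        calc _ ≤ Real.Gamma ρ * (κ ^ (-σ) * ((w.1 ^ 2 + 1) ^ (lam + 1))⁻¹) *
              (|f w.1| * w.1 ^ (2 * lam)) := by gcongr
          _ = _ := by ring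
  · refine ((Measurable.aemeasurable ?_).mul hfm.comp_fst).aestronglyMeasurable
    fun_prop

/-- The Poisson integral is an elementary modification of these Laplace transforms. -/
def poissonMoment (lam : ℝ) (μ : Measure ℝ) (f : ℝ → ℝ) : ℕ → ℕ → ℝ × ℝ → ℝ :=
  laplaceMoment (poissonMeasure μ) (fun w => -w.2) (fun w => 2 * w.2 * w.1.1 * w.1.2)
    (fun w => w.2 ^ lam * Real.exp (-(w.2 * w.1.1 ^ 2)) * (f w.1.1 * w.1.1 ^ (2 * lam)))

theorem integrable_poissonLaplace (h : IsAngular lam μ) (hlam : 0 ≤ lam)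
    (hf : AEMeasurable f (volume.restrict (Ioi (0 : ℝ))))
    (hfin : FiniteAgainst (poissonFactor lam) f) :
    ∀ p ∈ {p : ℝ × ℝ | p.2 ^ 2 < p.1}, Integrable (fun w : (ℝ × ℝ) × ℝ =>
      Real.exp (-w.2 * p.1 + 2 * w.2 * w.1.1 * w.1.2 * p.2) *
        (w.2 ^ lam * Real.exp (-(w.2 * w.1.1 ^ 2)) * (f w.1.1 * w.1.1 ^ (2 * lam))))
      (poissonMeasure μ) := by
  intro p hp
  refine (integrable_poisson_weight h hlam hf hfin hp (by linarith : 0 < lam + 1)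
    le_rfl).congr (ae_of_all _ fun w => ?_)
  simp only [sub_self, Real.rpow_zero, one_mul, add_sub_cancel_right]
  rw [show -((p.1 + w.1.1 ^ 2 - 2 * p.2 * w.1.1 * w.1.2) * w.2) =
    -w.2 * p.1 + 2 * w.2 * w.1.1 * w.1.2 * p.2 + -(w.2 * w.1.1 ^ 2) by ring, Real.exp_add]
  ring

theorem isOpen_sq_snd_lt_fst : IsOpen {p : ℝ × ℝ | p.2 ^ 2 < p.1} :=
  isOpen_lt (by fun_prop) continuous_fst

/-- Writing the power as the Gamma integral `∫ r^λ e^{-Dr} dr` makes the exponent linear in `(t²+x²,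
x)`. -/
theorem poissonKernel_mul_eq (h : IsAngular lam μ) (hlam : 0 ≤ lam) {t x y : ℝ} (ht : 0 < t)
    (hx : 0 < x) (hy : 0 < y) :
    poissonKernel lam t x y * f y * y ^ (2 * lam) =
      poissonConst lam / Real.Gamma (lam + 1) * t *
      ∫ s, (∫ r in Ioi (0 : ℝ), Real.exp (-r * (t ^ 2 + x ^ 2) + 2 * r * y * s * x) *
        (r ^ lam * Real.exp (-(r * y ^ 2)) * (f y * y ^ (2 * lam)))) ∂μ := by
  have hΓ := Real.Gamma_pos_of_pos (by linarith : 0 < lam + 1)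
  have e1 : ∀ᵐ s ∂μ, ∫ r in Ioi (0 : ℝ), Real.exp (-r * (t ^ 2 + x ^ 2) + 2 * r * y * s * x) *
        (r ^ lam * Real.exp (-(r * y ^ 2)) * (f y * y ^ (2 * lam))) =
      (t ^ 2 + (x ^ 2 + y ^ 2 - 2 * x * y * s)) ^ (-(lam + 1)) *
        (Real.Gamma (lam + 1) * (f y * y ^ (2 * lam))) := by
    filter_upwards [h.ae_abs_le] with s hs
    have hD : 0 < t ^ 2 + (x ^ 2 + y ^ 2 - 2 * x * y * s) := by
      nlinarith [sq_sub_le hx hy hs, sq_nonneg (x - y), sq_pos_of_pos ht]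
    have h1 := Real.integral_rpow_mul_exp_neg_mul_Ioi (by linarith : 0 < lam + 1) hD
    rw [one_div, Real.inv_rpow hD.le, ← Real.rpow_neg hD.le] at h1
    rw [← mul_assoc, ← h1, ← integral_mul_const]
    congr 1; ext r
    rw [add_sub_cancel_right, show -((t ^ 2 + (x ^ 2 + y ^ 2 - 2 * x * y * s)) * r) =
      (-r * (t ^ 2 + x ^ 2) + 2 * r * y * s * x) + -(r * y ^ 2) by ring,
      Real.exp_add (-r * (t ^ 2 + x ^ 2) + 2 * r * y * s * x)]
    ring
  rw [poissonKernel_eq h hlam ht hx hy, integral_congr_ae e1, integral_mul_const]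
  field_simp

theorem integrable_poissonLaplace_base (h : IsAngular lam μ) (hlam : 0 ≤ lam)
    (hf : AEMeasurable f (volume.restrict (Ioi (0 : ℝ))))
    (hfin : FiniteAgainst (poissonFactor lam) f) {t : ℝ} (x : ℝ) (ht : 0 < t) :
    Integrable (fun w : ℝ × ℝ => ∫ r in Ioi (0 : ℝ),
      Real.exp (-r * (t ^ 2 + x ^ 2) + 2 * r * w.1 * w.2 * x) *
        (r ^ lam * Real.exp (-(r * w.1 ^ 2)) * (f w.1 * w.1 ^ (2 * lam))))
      ((volume.restrict (Ioi (0 : ℝ))).prod μ) := by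
  have := h.prob
  exact (integrable_poissonLaplace h hlam hf hfin (t ^ 2 + x ^ 2, x)
    (show x ^ 2 < t ^ 2 + x ^ 2 by nlinarith)).integral_prod_left

theorem integrableOn_poissonKernel_mul (h : IsAngular lam μ) (hlam : 0 ≤ lam)
    (hf : AEMeasurable f (volume.restrict (Ioi (0 : ℝ))))
    (hfin : FiniteAgainst (poissonFactor lam) f) {t x : ℝ} (ht : 0 < t) (hx : 0 < x) :
    IntegrableOn (fun y => poissonKernel lam t x y * f y * y ^ (2 * lam)) (Ioi 0) := by
  have := h.prob
  refine ((integrable_poissonLaplace_base h hlam hf hfin x ht).integral_prod_left.const_mul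
    (poissonConst lam / Real.Gamma (lam + 1) * t)).congr
    ((ae_restrict_mem measurableSet_Ioi).mono fun y hy => ?_)
  exact (poissonKernel_mul_eq h hlam ht hx hy).symm

theorem poissonIntegral_eq (h : IsAngular lam μ) (hlam : 0 ≤ lam)
    (hf : AEMeasurable f (volume.restrict (Ioi (0 : ℝ))))
    (hfin : FiniteAgainst (poissonFactor lam) f) {t x : ℝ} (ht : 0 < t) (hx : 0 < x) :
    poissonIntegral lam f t x = poissonConst lam / Real.Gamma (lam + 1) * t *
      poissonMoment lam μ f 0 0 (t ^ 2 + x ^ 2, x) := by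
  have := h.prob
  rw [poissonMoment, laplaceMoment_zero_zero, laplace, poissonMeasure, integral_prod _
    (integrable_poissonLaplace h hlam hf hfin (t ^ 2 + x ^ 2, x)
      (show x ^ 2 < t ^ 2 + x ^ 2 by nlinarith)),
    integral_prod _ (integrable_poissonLaplace_base h hlam hf hfin x ht), ← integral_const_mul,
    poissonIntegral]
  exact setIntegral_congr_fun measurableSet_Ioi fun y hy => poissonKernel_mul_eq h hlam ht hx hy

theorem contDiffOn_poissonIntegral (h : IsAngular lam μ) (hlam : 0 ≤ lam)
    (hf : AEMeasurable f (volume.restrict (Ioi (0 : ℝ))))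
    (hfin : FiniteAgainst (poissonFactor lam) f) :
    ContDiffOn ℝ ∞ (fun p : ℝ × ℝ => poissonIntegral lam f p.1 p.2)
      {p : ℝ × ℝ | 0 < p.1 ∧ 0 < p.2} := by
  have h1 : ContDiffOn ℝ ∞ (poissonMoment lam μ f 0 0) {p : ℝ × ℝ | p.2 ^ 2 < p.1} := by
    rw [poissonMoment, laplaceMoment_zero_zero]
    exact contDiffOn_laplace (by fun_prop) (by fun_prop) isOpen_sq_snd_lt_fst
      (integrable_poissonLaplace h hlam hf hfin)
  have h2 : ContDiffOn ℝ ∞ (fun p : ℝ × ℝ => (p.1 ^ 2 + p.2 ^ 2, p.2))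
      {p : ℝ × ℝ | 0 < p.1 ∧ 0 < p.2} := by fun_prop
  refine ((contDiffOn_const.mul contDiffOn_fst).mul (h1.comp h2 fun p hp => ?_)).congr
    fun p hp => poissonIntegral_eq h hlam hf hfin hp.1 hp.2
  have := hp.1
  show p.2 ^ 2 < p.1 ^ 2 + p.2 ^ 2
  nlinarith

theorem hasDerivAt_poissonMoment_comp (h : IsAngular lam μ) (hlam : 0 ≤ lam)
    (hf : AEMeasurable f (volume.restrict (Ioi (0 : ℝ))))
    (hfin : FiniteAgainst (poissonFactor lam) f) (i j : ℕ)
    {α β : ℝ → ℝ} {α' β' t : ℝ} (hα : HasDerivAt α α' t) (hβ : HasDerivAt β β' t)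
    (hU : β t ^ 2 < α t) :
    HasDerivAt (fun t => poissonMoment lam μ f i j (α t, β t))
      (poissonMoment lam μ f (i + 1) j (α t, β t) * α' +
        poissonMoment lam μ f i (j + 1) (α t, β t) * β') t :=
  hasDerivAt_laplaceMoment_comp (by fun_prop) (by fun_prop) isOpen_sq_snd_lt_fst
    (integrable_poissonLaplace h hlam hf hfin) i j hα hβ hU

/-- The integrated form of the Poisson equation. -/
theorem poissonMoment_relation (h : IsAngular lam μ) (hlam : 0 ≤ lam)
    (hf : AEMeasurable f (volume.restrict (Ioi (0 : ℝ))))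
    (hfin : FiniteAgainst (poissonFactor lam) f) {p : ℝ × ℝ} (hp : p.2 ^ 2 < p.1)
    (hp2 : p.2 ≠ 0) :
    (8 + 4 * lam) * poissonMoment lam μ f 1 0 p + 4 * p.1 * poissonMoment lam μ f 2 0 p +
      4 * p.2 * poissonMoment lam μ f 1 1 p + poissonMoment lam μ f 0 2 p +
      2 * lam / p.2 * poissonMoment lam μ f 0 1 p = 0 := by
  have := h.prob
  have hI := fun i j => integrable_laplaceMoment
    (by fun_prop : AEStronglyMeasurable (fun w : (ℝ × ℝ) × ℝ => -w.2) _)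
    (by fun_prop : AEStronglyMeasurable (fun w : (ℝ × ℝ) × ℝ => 2 * w.2 * w.1.1 * w.1.2) _)
    isOpen_sq_snd_lt_fst (integrable_poissonLaplace h hlam hf hfin) i j p hp
  set D : ℝ × ℝ → ℝ := fun w => p.1 + w.1 ^ 2 - 2 * p.2 * w.1 * w.2 with hDdef
  -- the part that vanishes after integration in `r`
  set F : (ℝ × ℝ) × ℝ → ℝ := fun w => 4 * (D w.1 ^ (lam + 3 - (lam + 2)) *
      (w.2 ^ (lam + 3 - 1) * Real.exp (-(D w.1 * w.2))) * (f w.1.1 * w.1.1 ^ (2 * lam)) -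
      (lam + 2) * (D w.1 ^ (lam + 2 - (lam + 2)) *
      (w.2 ^ (lam + 2 - 1) * Real.exp (-(D w.1 * w.2))) * (f w.1.1 * w.1.1 ^ (2 * lam)))) with hF
  have hFI : Integrable F (poissonMeasure μ) :=
    ((integrable_poisson_weight h hlam hf hfin hp (by linarith : 0 < lam + 3)
      (by linarith : lam + 1 ≤ lam + 2)).sub
      ((integrable_poisson_weight h hlam hf hfin hp (by linarith : 0 < lam + 2)
      (by linarith : lam + 1 ≤ lam + 2)).const_mul (lam + 2))).const_mul 4
  -- Integration in `r` reduces this to `Γ(λ+3) = (λ+2) Γ(λ+2)`.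
  have hF0 : ∫ w, F w ∂(poissonMeasure μ) = 0 := by
    rw [poissonMeasure, integral_prod _ hFI]
    refine integral_eq_zero_of_ae ?_
    filter_upwards [ae_poissonMeasure_base h] with w hw
    have hDw : 0 < D w := lt_of_lt_of_le (mul_pos (div_pos (by linarith)
      (by nlinarith [sq_nonneg p.2])) (by positivity)) (le_poissonDenominator hp hw.2)
    have i1 := ((integrableOn_rpow_mul_exp_neg (by linarith : 0 < lam + 3) hDw).const_mul
      (D w ^ (lam + 3 - (lam + 2)))).mul_const (f w.1 * w.1 ^ (2 * lam))
    have i2 := (((integrableOn_rpow_mul_exp_neg (by linarith : 0 < lam + 2) hDw).const_mul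
      (D w ^ (lam + 2 - (lam + 2)))).mul_const (f w.1 * w.1 ^ (2 * lam))).const_mul (lam + 2)
    simp only [hF, Pi.zero_apply]
    rw [integral_const_mul, integral_sub i1 i2, integral_const_mul, integral_mul_const,
      integral_mul_const, integral_const_mul, integral_const_mul,
      Real.integral_rpow_mul_exp_neg_mul_Ioi (by linarith) hDw,
      Real.integral_rpow_mul_exp_neg_mul_Ioi (by linarith) hDw, sub_self, Real.rpow_zero,
      show lam + 3 - (lam + 2) = 1 by ring, Real.rpow_one,
      show lam + 3 = lam + 2 + 1 by ring, Real.Gamma_add_one (by linarith),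
      Real.rpow_add_one (by positivity)]
    field_simp
    ring
  -- the part that vanishes after integration in `s`
  set G : (ℝ × ℝ) × ℝ → ℝ := fun w =>
    (2 * w.2 * w.1.1 / p.2 * Real.exp (-w.2 * p.1) *
      (w.2 ^ lam * Real.exp (-(w.2 * w.1.1 ^ 2)) * (f w.1.1 * w.1.1 ^ (2 * lam)))) *
    ((w.1.2 ^ 2 - 1) * (2 * w.2 * w.1.1 * p.2 * Real.exp (2 * w.2 * w.1.1 * p.2 * w.1.2)) +
      2 * lam * w.1.2 * Real.exp (2 * w.2 * w.1.1 * p.2 * w.1.2)) with hG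
  have hsum := (((((hI 1 0).const_mul (8 + 4 * lam)).add ((hI 2 0).const_mul (4 * p.1))).add
    ((hI 1 1).const_mul (4 * p.2))).add (hI 0 2)).add ((hI 0 1).const_mul (2 * lam / p.2))
  -- The term `4r²y²` coming from `D` in `F` cancels the one coming from `s² - 1` in `G`; what
  -- remains is the combination of moments.
  have hFG : ∀ᵐ w ∂(poissonMeasure μ),
      (8 + 4 * lam) * (Real.exp (-w.2 * p.1 + 2 * w.2 * w.1.1 * w.1.2 * p.2) *
        ((-w.2) ^ 1 * (2 * w.2 * w.1.1 * w.1.2) ^ 0 *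
          (w.2 ^ lam * Real.exp (-(w.2 * w.1.1 ^ 2)) * (f w.1.1 * w.1.1 ^ (2 * lam))))) +
      4 * p.1 * (Real.exp (-w.2 * p.1 + 2 * w.2 * w.1.1 * w.1.2 * p.2) *
        ((-w.2) ^ 2 * (2 * w.2 * w.1.1 * w.1.2) ^ 0 *
          (w.2 ^ lam * Real.exp (-(w.2 * w.1.1 ^ 2)) * (f w.1.1 * w.1.1 ^ (2 * lam))))) +
      4 * p.2 * (Real.exp (-w.2 * p.1 + 2 * w.2 * w.1.1 * w.1.2 * p.2) *
        ((-w.2) ^ 1 * (2 * w.2 * w.1.1 * w.1.2) ^ 1 *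
          (w.2 ^ lam * Real.exp (-(w.2 * w.1.1 ^ 2)) * (f w.1.1 * w.1.1 ^ (2 * lam))))) +
      Real.exp (-w.2 * p.1 + 2 * w.2 * w.1.1 * w.1.2 * p.2) *
        ((-w.2) ^ 0 * (2 * w.2 * w.1.1 * w.1.2) ^ 2 *
          (w.2 ^ lam * Real.exp (-(w.2 * w.1.1 ^ 2)) * (f w.1.1 * w.1.1 ^ (2 * lam)))) +
      2 * lam / p.2 * (Real.exp (-w.2 * p.1 + 2 * w.2 * w.1.1 * w.1.2 * p.2) *
        ((-w.2) ^ 0 * (2 * w.2 * w.1.1 * w.1.2) ^ 1 *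
          (w.2 ^ lam * Real.exp (-(w.2 * w.1.1 ^ 2)) * (f w.1.1 * w.1.1 ^ (2 * lam))))) =
      F w + G w := by
    have hr : ∀ᵐ w ∂(poissonMeasure μ), 0 < w.2 :=
      Measure.quasiMeasurePreserving_snd.ae (ae_restrict_mem measurableSet_Ioi)
    filter_upwards [hr] with w hw
    have e1 : w.2 ^ (lam + 3 - 1) = w.2 ^ lam * w.2 ^ 2 := by
      rw [show lam + 3 - 1 = lam + 2 by ring, Real.rpow_add hw, Real.rpow_two]
    have e2 : w.2 ^ (lam + 2 - 1) = w.2 ^ lam * w.2 := by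
      rw [show lam + 2 - 1 = lam + 1 by ring, Real.rpow_add hw, Real.rpow_one]
    have e3 : Real.exp (-(D w.1 * w.2)) = Real.exp (-w.2 * p.1) *
        Real.exp (2 * w.2 * w.1.1 * p.2 * w.1.2) * Real.exp (-(w.2 * w.1.1 ^ 2)) := by
      rw [← Real.exp_add, ← Real.exp_add]; congr 1; simp only [hDdef]; ring
    have e4 : Real.exp (-w.2 * p.1 + 2 * w.2 * w.1.1 * w.1.2 * p.2) = Real.exp (-w.2 * p.1) *
        Real.exp (2 * w.2 * w.1.1 * p.2 * w.1.2) := by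
      rw [← Real.exp_add]; congr 1; ring
    simp only [hF, hG, e1, e2, e3, e4, sub_self, Real.rpow_zero,
      show lam + 3 - (lam + 2) = 1 by ring, Real.rpow_one]
    simp only [hDdef]
    field_simp
    ring
  -- `G` is the combination of moments minus `F`, both already known to be integrable.
  have hGI : Integrable G (poissonMeasure μ) := by
    refine (hsum.sub hFI).congr ?_
    filter_upwards [hFG] with w hw
    simp only [Pi.add_apply, Pi.sub_apply]
    rw [hw, add_sub_cancel_left]
  have hG0 : ∫ w, G w ∂(poissonMeasure μ) = 0 := by
    -- With `r` outermost and `y` next, `s` is the innermost variable, where the integration by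
    -- parts formula applies.
    rw [poissonMeasure, integral_prod_symm _ hGI]
    refine integral_eq_zero_of_ae ?_
    filter_upwards [hGI.prod_left_ae] with r hr
    rw [integral_prod _ hr]
    refine integral_eq_zero_of_ae (ae_of_all _ fun y => ?_)
    have h2 := h.integral_parts (fun s => Real.exp (2 * r * y * p.2 * s))
      (fun s => 2 * r * y * p.2 * Real.exp (2 * r * y * p.2 * s))
      (fun s => by simpa [mul_comm] using ((hasDerivAt_id s).const_mul (2 * r * y * p.2)).exp)
      (by fun_prop)
    simp only [hG, Pi.zero_apply]
    rw [integral_const_mul, h2, mul_zero]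
  have hadd1 := integral_add ((((hI 1 0).const_mul (8 + 4 * lam)).add
    ((hI 2 0).const_mul (4 * p.1))).add ((hI 1 1).const_mul (4 * p.2))) (hI 0 2)
  have hadd2 := integral_add (((((hI 1 0).const_mul (8 + 4 * lam)).add
    ((hI 2 0).const_mul (4 * p.1))).add ((hI 1 1).const_mul (4 * p.2))).add (hI 0 2))
    ((hI 0 1).const_mul (2 * lam / p.2))
  have hadd3 := integral_add (((hI 1 0).const_mul (8 + 4 * lam)).add
    ((hI 2 0).const_mul (4 * p.1))) ((hI 1 1).const_mul (4 * p.2))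
  simp only [Pi.add_apply] at hadd1 hadd2 hadd3
  rw [poissonMoment]
  simp only [laplaceMoment, laplace]
  rw [← integral_const_mul, ← integral_const_mul, ← integral_const_mul, ← integral_const_mul,
    ← integral_add ((hI 1 0).const_mul (8 + 4 * lam)) ((hI 2 0).const_mul (4 * p.1)), ← hadd3,
    ← hadd1, ← hadd2, integral_congr_ae hFG, integral_add hFI hGI, hF0, hG0, add_zero]

/-- In terms of moments, `u_tt + u_xx + (2λ/x) u_x` is `c t` times the left side of
`poissonMoment_relation` at `(t²+x², x)`. -/
theorem iteratedDeriv_poissonIntegral (h : IsAngular lam μ) (hlam : 0 ≤ lam)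
    (hf : AEMeasurable f (volume.restrict (Ioi (0 : ℝ))))
    (hfin : FiniteAgainst (poissonFactor lam) f) {t x : ℝ} (ht : 0 < t) (hx : 0 < x) :
    iteratedDeriv 2 (fun s => poissonIntegral lam f s x) t =
      besselOp lam (poissonIntegral lam f t) x := by
  set c := poissonConst lam / Real.Gamma (lam + 1)
  set L := poissonMoment lam μ f
  have hmem : ∀ s z : ℝ, 0 < s → z ^ 2 < s ^ 2 + z ^ 2 := fun s z hs => by nlinarith
  have kt : ∀ i j : ℕ, ∀ s, 0 < s → HasDerivAt (fun s => L i j (s ^ 2 + x ^ 2, x))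
      (L (i + 1) j (s ^ 2 + x ^ 2, x) * (2 * s)) s := by
    intro i j s hs
    have e : HasDerivAt (fun s : ℝ => s ^ 2 + x ^ 2) (2 * s) s := by
      simpa using (hasDerivAt_pow 2 s).add_const (x ^ 2)
    refine (hasDerivAt_poissonMoment_comp h hlam hf hfin i j e (hasDerivAt_const s x)
      (hmem s x hs)).congr_deriv ?_
    simp only [mul_zero, add_zero]; rfl
  have kx : ∀ i j : ℕ, ∀ z, HasDerivAt (fun z => L i j (t ^ 2 + z ^ 2, z))
      (L (i + 1) j (t ^ 2 + z ^ 2, z) * (2 * z) + L i (j + 1) (t ^ 2 + z ^ 2, z)) z := by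
    intro i j z
    have e : HasDerivAt (fun z : ℝ => t ^ 2 + z ^ 2) (2 * z) z := by
      simpa using (hasDerivAt_pow 2 z).const_add (t ^ 2)
    refine (hasDerivAt_poissonMoment_comp h hlam hf hfin i j e (hasDerivAt_id z)
      (hmem t z ht)).congr_deriv ?_
    simp only [mul_one, id]; rfl
  have dt : ∀ s, 0 < s → HasDerivAt (fun s => poissonIntegral lam f s x)
      (c * (L 0 0 (s ^ 2 + x ^ 2, x) + 2 * s ^ 2 * L 1 0 (s ^ 2 + x ^ 2, x))) s := by
    intro s hs
    refine ((((hasDerivAt_id s).const_mul c).mul (kt 0 0 s hs)).congr_of_eventuallyEq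
      ?_).congr_deriv ?_
    · filter_upwards [lt_mem_nhds hs] with r hr
      exact poissonIntegral_eq h hlam hf hfin hr hx
    · simp only [id, zero_add]; ring
  have dtt : HasDerivAt (fun s => c * (L 0 0 (s ^ 2 + x ^ 2, x) +
        2 * s ^ 2 * L 1 0 (s ^ 2 + x ^ 2, x)))
      (c * (6 * t * L 1 0 (t ^ 2 + x ^ 2, x) + 4 * t ^ 3 * L 2 0 (t ^ 2 + x ^ 2, x))) t := by
    refine (((kt 0 0 t ht).add (((hasDerivAt_pow 2 t).const_mul 2).mul
      (kt 1 0 t ht))).const_mul c).congr_deriv ?_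
    simp only [zero_add, one_add_one_eq_two]; push_cast; ring
  have d1 : ∀ z, 0 < z → HasDerivAt (poissonIntegral lam f t)
      (c * t * (L 1 0 (t ^ 2 + z ^ 2, z) * (2 * z) + L 0 1 (t ^ 2 + z ^ 2, z))) z := by
    intro z hz
    refine ((kx 0 0 z).const_mul (c * t)).congr_of_eventuallyEq ?_
    filter_upwards [lt_mem_nhds hz] with r hr
    exact poissonIntegral_eq h hlam hf hfin ht hr
  have d2 : HasDerivAt (fun z => c * t * (L 1 0 (t ^ 2 + z ^ 2, z) * (2 * z) +
        L 0 1 (t ^ 2 + z ^ 2, z)))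
      (c * t * (2 * L 1 0 (t ^ 2 + x ^ 2, x) + 4 * x ^ 2 * L 2 0 (t ^ 2 + x ^ 2, x) +
        4 * x * L 1 1 (t ^ 2 + x ^ 2, x) + L 0 2 (t ^ 2 + x ^ 2, x))) x := by
    refine ((((kx 1 0 x).mul ((hasDerivAt_id x).const_mul 2)).add (kx 0 1 x)).const_mul
      (c * t)).congr_deriv ?_
    simp only [id, zero_add, one_add_one_eq_two]; ring
  rw [iteratedDeriv_two_of_hasDerivAt ht dt dtt,
    besselOp_of_hasDerivAt hx d1 (u₂ := fun x => _) d2]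
  have hrel := poissonMoment_relation h hlam hf hfin (p := (t ^ 2 + x ^ 2, x)) (hmem t x ht) hx.ne'
  have hrel' : L 0 2 (t ^ 2 + x ^ 2, x) = -((8 + 4 * lam) * L 1 0 (t ^ 2 + x ^ 2, x) +
      4 * (t ^ 2 + x ^ 2) * L 2 0 (t ^ 2 + x ^ 2, x) + 4 * x * L 1 1 (t ^ 2 + x ^ 2, x) +
      2 * lam / x * L 0 1 (t ^ 2 + x ^ 2, x)) := by
    simp only [L] at hrel ⊢
    linarith
  rw [hrel']
  field_simp
  ring

end Poisson

/-! ### Lebesgue points and approximate identities -/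

/-- Almost every positive point is a Lebesgue point of a function that is integrable on compact
subintervals of `(0, ∞)`. -/
theorem ae_lebesguePoint {f : ℝ → ℝ} (hf : ∀ a b : ℝ, 0 < a → IntegrableOn f (Icc a b)) :
    ∀ᵐ x ∂(volume.restrict (Ioi (0 : ℝ))), ∀ ε > 0, ∃ δ > 0, ∀ r : ℝ, 0 < r → r < δ →
      ∫⁻ y in Metric.closedBall x r, ‖f y - f x‖ₑ ≤ ENNReal.ofReal (ε * r) := by
  -- Truncation makes the differentiation theorem applicable; countably many truncations exhaust
  -- `(0, ∞)`.
  have hI : ∀ n : ℕ, Integrable ((Icc (1 / (n + 1 : ℝ)) (n + 1)).indicator f) := fun n =>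
    (integrable_indicator_iff measurableSet_Icc).2 (hf _ _ (by positivity))
  have hae := ae_all_iff.2 fun n : ℕ => (Besicovitch.vitaliFamily
    (volume : Measure ℝ)).ae_tendsto_lintegral_enorm_sub_div (hI n).locallyIntegrable
  rw [ae_restrict_iff' measurableSet_Ioi]
  filter_upwards [hae] with x hx (hx0 : 0 < x) ε hε
  obtain ⟨n, hn1⟩ := exists_nat_gt (max x (1 / x))
  have hxn : x ∈ Ioo (1 / (n + 1 : ℝ)) (n + 1) := by
    have h1 := (max_lt_iff.1 hn1).1
    have h2 := (max_lt_iff.1 hn1).2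
    refine ⟨?_, by linarith⟩
    rw [div_lt_iff₀ (by positivity)]
    rw [div_lt_iff₀ hx0] at h2
    nlinarith
  have h1 := (hx n).comp (Besicovitch.tendsto_filterAt volume x)
  have h2 : ∀ᶠ r in 𝓝[>] (0 : ℝ), Metric.closedBall x r ⊆ Icc (1 / (n + 1 : ℝ)) (n + 1) := by
    obtain ⟨δ, hδ, hδ'⟩ := Metric.nhds_basis_closedBall.mem_iff.1 (Ioo_mem_nhds hxn.1 hxn.2)
    filter_upwards [Ioo_mem_nhdsGT hδ] with r hr
    exact (Metric.closedBall_subset_closedBall hr.2.le).trans (hδ'.trans Ioo_subset_Icc_self)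
  have h3 := h1.eventually (gt_mem_nhds (show (0 : ENNReal) < ENNReal.ofReal (ε / 2) by
    simpa using hε))
  obtain ⟨δ, hδ, hδ'⟩ := mem_nhdsGT_iff_exists_Ioo_subset.1 (h2.and h3)
  refine ⟨δ, hδ, fun r hr hrδ => ?_⟩
  obtain ⟨hsub, hlt⟩ := hδ' ⟨hr, hrδ⟩
  have hvol : volume (Metric.closedBall x r) = ENNReal.ofReal (2 * r) := by
    rw [Real.volume_closedBall]
  have hcongr : ∫⁻ y in Metric.closedBall x r,
      ‖(Icc (1 / (n + 1 : ℝ)) (n + 1)).indicator f y -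
        (Icc (1 / (n + 1 : ℝ)) (n + 1)).indicator f x‖ₑ =
      ∫⁻ y in Metric.closedBall x r, ‖f y - f x‖ₑ := by
    refine setLIntegral_congr_fun Metric.isClosed_closedBall.measurableSet fun y hy => ?_
    rw [indicator_of_mem (hsub hy), indicator_of_mem (Ioo_subset_Icc_self hxn)]
  simp only [Function.comp_apply, hcongr, hvol] at hlt
  have hpos : ENNReal.ofReal (2 * r) ≠ 0 := by simpa using hr
  have h4 := (ENNReal.div_le_iff hpos ENNReal.ofReal_ne_top).1 hlt.le
  rwa [← ENNReal.ofReal_mul (by positivity), show ε / 2 * (2 * r) = ε * r by ring] at h4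

/-- A single term suffices: the one of least index `n` with `r < 2^n t`. If `n = k+1`, then `2^k t ≤
r` bounds the left side by `4^{-k}/t`, which is that term. -/
theorem div_sq_add_sq_le_tsum {t : ℝ} (ht : 0 < t) (r : ℝ) :
    ENNReal.ofReal (t / (t ^ 2 + r ^ 2)) ≤
      ∑' k : ℕ, ENNReal.ofReal (4 / t * (1 / 4) ^ k) * (if r < 2 ^ k * t then 1 else 0) := by
  have hex : ∃ k : ℕ, r < 2 ^ k * t := by
    obtain ⟨k, hk⟩ := pow_unbounded_of_one_lt (r / t) one_lt_two
    exact ⟨k, (div_lt_iff₀ ht).1 hk⟩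
  classical
  refine le_trans ?_ (ENNReal.le_tsum (Nat.find hex))
  rw [if_pos (Nat.find_spec hex), mul_one]
  refine ENNReal.ofReal_le_ofReal ?_
  rcases Nat.eq_zero_or_pos (Nat.find hex) with h0 | hpos
  · rw [h0, pow_zero, mul_one, div_le_div_iff₀ (by positivity) ht]
    nlinarith [sq_nonneg r, sq_nonneg t]
  · obtain ⟨k, hk⟩ := Nat.exists_eq_succ_of_ne_zero hpos.ne'
    have h1 := Nat.find_min hex (m := k) (by omega)
    rw [not_lt] at h1
    rw [hk, Nat.succ_eq_add_one, pow_succ, div_le_iff₀ (by positivity)]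
    have h2 : (2 ^ k * t) ^ 2 ≤ r ^ 2 := by gcongr
    have h3 : ((2 : ℝ) ^ k) ^ 2 = 4 ^ k := by rw [← pow_mul, mul_comm, pow_mul]; norm_num
    rw [mul_pow, h3] at h2
    have h4 : (1 / 4 : ℝ) ^ k * 4 ^ k = 1 := by rw [← mul_pow]; norm_num
    calc t = 4 / t * ((1 / 4) ^ k * (1 / 4)) * (4 ^ k * t ^ 2) := by
          field_simp
          linarith
      _ ≤ _ := by refine mul_le_mul_of_nonneg_left ?_ (by positivity); nlinarith [sq_nonneg t]

/-- The Cauchy kernel at a point where the averages are small. -/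
theorem lintegral_cauchy_mul_le {g : ℝ → ENNReal} {x δ ε : ℝ}
    (hg : AEMeasurable g (volume.restrict (Metric.closedBall x δ)))
    (hε : 0 ≤ ε)
    (h : ∀ r : ℝ, 0 < r → r ≤ δ → ∫⁻ y in Metric.closedBall x r, g y ≤ ENNReal.ofReal (ε * r))
    (hδ : 0 < δ) {t : ℝ} (ht : 0 < t) :
    ∫⁻ y in Metric.closedBall x δ, ENNReal.ofReal (t / (t ^ 2 + (y - x) ^ 2)) * g y ≤
      ENNReal.ofReal (8 * ε) := by
  have hm : ∀ k : ℕ, MeasurableSet {y : ℝ | |y - x| < 2 ^ k * t} := fun k =>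
    measurableSet_lt (by fun_prop) measurable_const
  calc ∫⁻ y in Metric.closedBall x δ, ENNReal.ofReal (t / (t ^ 2 + (y - x) ^ 2)) * g y
      ≤ ∫⁻ y in Metric.closedBall x δ, ∑' k : ℕ, ENNReal.ofReal (4 / t * (1 / 4) ^ k) *
          {y : ℝ | |y - x| < 2 ^ k * t}.indicator g y := by
        refine lintegral_mono fun y => ?_
        have h1 := div_sq_add_sq_le_tsum ht |y - x|
        rw [sq_abs] at h1
        refine (mul_le_mul_left h1 (g y)).trans (le_of_eq ?_)
        rw [← ENNReal.tsum_mul_right]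
        congr 1; ext k
        by_cases hk : |y - x| < 2 ^ k * t
        · rw [if_pos hk, indicator_of_mem (show y ∈ {y : ℝ | |y - x| < 2 ^ k * t} from hk), mul_one]
        · rw [if_neg hk,
            indicator_of_notMem (show y ∉ {y : ℝ | |y - x| < 2 ^ k * t} from hk)]; simp
    _ = ∑' k : ℕ, ENNReal.ofReal (4 / t * (1 / 4) ^ k) *
          ∫⁻ y in Metric.closedBall x δ, {y : ℝ | |y - x| < 2 ^ k * t}.indicator g y := by
        rw [lintegral_tsum fun k => (hg.indicator (hm k)).const_mul _]
        congr 1; ext k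
        rw [lintegral_const_mul' _ _ ENNReal.ofReal_ne_top]
    _ ≤ ∑' k : ℕ, ENNReal.ofReal (4 * ε * (1 / 2) ^ k) := by
        refine ENNReal.tsum_le_tsum fun k => ?_
        have hpos : 0 < 2 ^ k * t := by positivity
        have h2 : ∫⁻ y in Metric.closedBall x δ, {y : ℝ | |y - x| < 2 ^ k * t}.indicator g y ≤
            ENNReal.ofReal (ε * (2 ^ k * t)) := by
          rw [setLIntegral_indicator (hm k)]
          -- The averages are controlled only up to radius `δ`. The `k`-th term is then at most
          -- `(4/t) 4^{-k} · ε 2^k t = 4ε 2^{-k}`, with sum `8ε`.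
          have hmin : 0 < min δ (2 ^ k * t) := lt_min hδ hpos
          calc _ ≤ ∫⁻ y in Metric.closedBall x (min δ (2 ^ k * t)), g y := by
                refine lintegral_mono_set fun y hy => ?_
                rw [Metric.mem_closedBall, le_min_iff]
                exact ⟨hy.2, (show |y - x| < _ from hy.1).le⟩
            _ ≤ _ := h _ hmin (min_le_left _ _)
            _ ≤ _ := by gcongr; exact min_le_right _ _
        calc _ ≤ ENNReal.ofReal (4 / t * (1 / 4) ^ k) * ENNReal.ofReal (ε * (2 ^ k * t)) := by
              gcongr
          _ = _ := by
              rw [← ENNReal.ofReal_mul (by positivity)]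
              congr 1
              have : (1 / 4 : ℝ) ^ k * 2 ^ k = (1 / 2) ^ k := by rw [← mul_pow]; norm_num
              rw [← this]; field_simp
    _ = ENNReal.ofReal (8 * ε) := by
        rw [← ENNReal.ofReal_tsum_of_nonneg (fun k => by positivity)
          (summable_geometric_two.mul_left _), tsum_mul_left, tsum_geometric_two]
        ring_nf

/-- Convergence at a Lebesgue point of the integrals against an approximate identity that is
dominated by a dilated Cauchy kernel near the point. -/
theorem tendsto_integral_of_lebesguePoint {H : ℝ → ℝ → ℝ} {f φ ρ : ℝ → ℝ} {x : ℝ} (hx : 0 < x)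
    (hf : AEMeasurable f (volume.restrict (Ioi (0 : ℝ))))
    (hH0 : ∀ t y, 0 < t → 0 < y → 0 ≤ H t y)
    (hHI : ∀ t, 0 < t → IntegrableOn (H t) (Ioi 0))
    (hH1 : ∀ t, 0 < t → ∫ y in Ioi (0 : ℝ), H t y = 1)
    (hρ : ∀ t, 0 < t → 0 < ρ t)
    (hnear : ∃ C > 0, ∀ t y, 0 < t → 0 < y → y ≤ 2 * x →
      H t y ≤ C * (ρ t / (ρ t ^ 2 + (y - x) ^ 2)))
    (hfar : ∀ δ > 0, ∃ η : ℝ → ℝ, Tendsto η (𝓝[>] 0) (𝓝 0) ∧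
      ∀ᶠ t in 𝓝[>] 0, 0 ≤ η t ∧ ∀ y, 0 < y → δ ≤ |y - x| → H t y ≤ η t * φ y)
    (hφ0 : ∀ y, 0 < y → 0 ≤ φ y)
    (hφ : IntegrableOn φ (Ioi 0)) (hφf : IntegrableOn (fun y => φ y * |f y|) (Ioi 0))
    (hHf : ∀ᶠ t in 𝓝[>] 0, IntegrableOn (fun y => H t y * f y) (Ioi 0))
    (hL : ∀ ε > 0, ∃ δ > 0, ∀ r : ℝ, 0 < r → r < δ →
      ∫⁻ y in Metric.closedBall x r, ‖f y - f x‖ₑ ≤ ENNReal.ofReal (ε * r)) :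
    Tendsto (fun t => ∫ y in Ioi (0 : ℝ), H t y * f y) (𝓝[>] 0) (𝓝 (f x)) := by
  obtain ⟨C, hC, hnear⟩ := hnear
  rw [Metric.tendsto_nhds]
  intro ε hε
  -- The near part is then at most `C · 8 · ε/(32C) = ε/4`, and the far part is made smaller than
  -- `ε/2`. Below, `δ ≤ x/2` keeps the ball inside `(0, 2x]`, where `hnear` holds.
  obtain ⟨δ₀, hδ₀, hL'⟩ := hL (ε / (32 * C)) (by positivity)
  set δ := min (δ₀ / 2) (x / 2) with hδdef
  have hδ : 0 < δ := lt_min (by positivity) (by positivity)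
  have hδ₀' : δ < δ₀ := (min_le_left _ _).trans_lt (by linarith)
  have hδx : δ ≤ x / 2 := min_le_right _ _
  set B := Metric.closedBall x δ with hB
  have hBm : MeasurableSet B := Metric.isClosed_closedBall.measurableSet
  have hBpos : B ⊆ Ioi 0 := fun y hy => by
    have := abs_le.1 (show |y - x| ≤ δ from hy)
    show 0 < y
    linarith
  obtain ⟨η, hη, hηle⟩ := hfar δ hδ
  set K := ∫ y in Ioi (0 : ℝ), φ y * |f y - f x| with hK
  have hφI : IntegrableOn (fun y => φ y * |f y - f x|) (Ioi 0) := by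
    refine Integrable.mono' (hφf.norm.add (hφ.norm.mul_const |f x|)) ?_ ?_
    · exact hφ.aestronglyMeasurable.mul (hf.sub_const _).norm.aestronglyMeasurable
    · refine ae_of_all _ fun y => ?_
      simp only [Pi.add_apply, norm_mul, Real.norm_eq_abs, abs_abs]
      rw [← mul_add]
      gcongr
      exact abs_sub _ _
  have hηK : Tendsto (fun t => η t * K) (𝓝[>] 0) (𝓝 0) := by simpa using hη.mul_const K
  filter_upwards [self_mem_nhdsWithin, hηle, hHf,
    hηK.eventually (gt_mem_nhds (show (0 : ℝ) < ε / 2 by positivity))] with t ht hfar' hI hsmall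
  have ht : 0 < t := ht
  have hint : IntegrableOn (fun y => H t y * (f y - f x)) (Ioi 0) := by
    refine (hI.sub ((hHI t ht).mul_const (f x))).congr (ae_of_all _ fun y => ?_)
    simp only [Pi.sub_apply]; ring
  have e1 : (∫ y in Ioi (0 : ℝ), H t y * f y) - f x =
      ∫ y in Ioi (0 : ℝ), H t y * (f y - f x) := by
    simp_rw [mul_sub]
    rw [integral_sub hI ((hHI t ht).mul_const (f x)), integral_mul_const, hH1 t ht, one_mul]
  have e2 : ∫ y in Ioi (0 : ℝ), H t y * (f y - f x) =
      (∫ y in B, H t y * (f y - f x)) + ∫ y in Ioi 0 \ B, H t y * (f y - f x) := by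
    rw [← integral_inter_add_sdiff hBm hint, inter_eq_self_of_subset_right hBpos]
  have e3 : ‖∫ y in B, H t y * (f y - f x)‖ ≤ ε / 4 := by
    have hgm : AEMeasurable (fun y => ‖f y - f x‖ₑ) (volume.restrict B) :=
      ((hf.mono_measure (Measure.restrict_mono hBpos le_rfl)).sub_const _).enorm
    have h1 := lintegral_cauchy_mul_le hgm (by positivity)
      (fun r hr hrδ => hL' r hr (hrδ.trans_lt hδ₀')) hδ (hρ t ht)
    have h2 : ∫⁻ y in B, ENNReal.ofReal ‖H t y * (f y - f x)‖ ≤ ENNReal.ofReal (ε / 4) := by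
      calc _ ≤ ∫⁻ y in B, ENNReal.ofReal C * (ENNReal.ofReal (ρ t / (ρ t ^ 2 + (y - x) ^ 2)) *
            ‖f y - f x‖ₑ) := by
            refine setLIntegral_mono' hBm fun y hy => ?_
            have hy0 : 0 < y := hBpos hy
            have hy2 : y ≤ 2 * x := by
              have := abs_le.1 (show |y - x| ≤ δ from hy); linarith
            have := hρ t ht
            rw [norm_mul, ENNReal.ofReal_mul (norm_nonneg _), ofReal_norm (f y - f x), ← mul_assoc,
              ← ENNReal.ofReal_mul hC.le]
            gcongr
            rw [Real.norm_of_nonneg (hH0 t y ht hy0)]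
            exact hnear t y ht hy0 hy2
        _ = ENNReal.ofReal C * ∫⁻ y in B, ENNReal.ofReal (ρ t / (ρ t ^ 2 + (y - x) ^ 2)) *
            ‖f y - f x‖ₑ := lintegral_const_mul' _ _ ENNReal.ofReal_ne_top
        _ ≤ ENNReal.ofReal C * ENNReal.ofReal (8 * (ε / (32 * C))) := by gcongr
        _ = _ := by
            rw [← ENNReal.ofReal_mul hC.le]; congr 1; field_simp; norm_num
    calc _ ≤ (∫⁻ y in B, ENNReal.ofReal ‖H t y * (f y - f x)‖).toReal :=
          norm_integral_le_lintegral_norm _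
      _ ≤ (ENNReal.ofReal (ε / 4)).toReal := ENNReal.toReal_mono ENNReal.ofReal_ne_top h2
      _ = ε / 4 := ENNReal.toReal_ofReal (by positivity)
  have hsub : Ioi 0 \ B ⊆ Ioi (0 : ℝ) := sdiff_subset
  have e4 : ‖∫ y in Ioi 0 \ B, H t y * (f y - f x)‖ ≤
      ∫ y in Ioi 0 \ B, η t * (φ y * |f y - f x|) := by
    refine norm_integral_le_of_norm_le ((hφI.mono_set hsub).const_mul _) ?_
    refine (ae_restrict_mem (measurableSet_Ioi.diff hBm)).mono fun y hy => ?_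
    have hy0 : 0 < y := hy.1
    have hyδ : δ ≤ |y - x| := (not_le.1 (show ¬ |y - x| ≤ δ from hy.2)).le
    rw [norm_mul, Real.norm_of_nonneg (hH0 t y ht hy0), Real.norm_eq_abs, ← mul_assoc]
    exact mul_le_mul_of_nonneg_right (hfar'.2 y hy0 hyδ) (abs_nonneg _)
  have e5 : ∫ y in Ioi 0 \ B, η t * (φ y * |f y - f x|) ≤ η t * K := by
    rw [hK, ← integral_const_mul]
    refine setIntegral_mono_set (hφI.const_mul _) ?_ hsub.eventuallyLE
    exact (ae_restrict_mem measurableSet_Ioi).mono fun y hy =>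
      mul_nonneg hfar'.1 (mul_nonneg (hφ0 y hy) (abs_nonneg _))
  rw [Real.dist_eq, e1, e2, ← Real.norm_eq_abs]
  refine (norm_add_le _ _).trans_lt ?_
  linarith

/-! ### Kernel bounds and mass one -/

section

variable {lam : ℝ} {μ : Measure ℝ}

/-- Integrate `e^{zs} ≥ 1 + zs` and use the mean zero. -/
theorem IsAngular.one_le_laplace (h : IsAngular lam μ) (z : ℝ) :
    1 ≤ ∫ s, Real.exp (z * s) ∂μ := by
  have := h.prob
  calc (1 : ℝ) = ∫ s, (1 + z * s) ∂μ := by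
        rw [integral_add (integrable_const _) (h.integrable_of_continuous (by fun_prop)),
          integral_const_mul, h.integral_id]
        simp
    _ ≤ _ := integral_mono (h.integrable_of_continuous (by fun_prop))
        (h.integrable_of_continuous (by fun_prop)) fun s => by
          have := Real.add_one_le_exp (z * s)
          simp only; linarith

theorem heatKernel_eq_laplace (h : IsAngular lam μ) (hlam : 0 ≤ lam) {t x y : ℝ} (ht : 0 < t)
    (hx : 0 < x) (hy : 0 < y) :
    heatKernel lam t x y = heatConst lam * t ^ (-(lam + 1 / 2)) *
      (Real.exp (-(x ^ 2 + y ^ 2) / (4 * t)) * ∫ s, Real.exp (x * y / (2 * t) * s) ∂μ) := by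
  rw [heatKernel_eq h hlam ht hx hy, ← integral_const_mul (Real.exp _)]
  congr 2
  ext s
  rw [← Real.exp_add]; congr 1; field_simp; ring

theorem heatKernel_nonneg (hlam : 0 ≤ lam) {t x y : ℝ} (ht : 0 < t) (hx : 0 < x) (hy : 0 < y) :
    0 ≤ heatKernel lam t x y := by
  obtain ⟨μ, h⟩ := exists_isAngular hlam
  rw [heatKernel_eq h hlam ht hx hy]
  have := heatConst_pos hlam
  exact mul_nonneg (by positivity) (integral_nonneg fun s => Real.exp_nonneg _)

theorem le_heatKernel (hlam : 0 ≤ lam) {t x y : ℝ} (ht : 0 < t) (hx : 0 < x) (hy : 0 < y) :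
    heatConst lam * t ^ (-(lam + 1 / 2)) * Real.exp (-(x ^ 2 + y ^ 2) / (4 * t)) ≤
      heatKernel lam t x y := by
  obtain ⟨μ, h⟩ := exists_isAngular hlam
  rw [heatKernel_eq_laplace h hlam ht hx hy]
  have := heatConst_pos hlam
  exact mul_le_mul_of_nonneg_left
    (le_mul_of_one_le_right (Real.exp_nonneg _) (h.one_le_laplace _)) (by positivity)

theorem heatKernel_le (hlam : 0 ≤ lam) {t x y : ℝ} (ht : 0 < t) (hx : 0 < x) (hy : 0 < y) :
    heatKernel lam t x y ≤
      heatConst lam * t ^ (-(lam + 1 / 2)) * Real.exp (-(x - y) ^ 2 / (4 * t)) := by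
  obtain ⟨μ, h⟩ := exists_isAngular hlam
  have := h.prob
  rw [heatKernel_eq h hlam ht hx hy]
  have := heatConst_pos hlam
  refine mul_le_mul_of_nonneg_left ?_ (by positivity)
  calc _ ≤ ∫ _, Real.exp (-(x - y) ^ 2 / (4 * t)) ∂μ := by
        refine integral_mono_ae (h.integrable_of_continuous (by fun_prop)) (integrable_const _) ?_
        filter_upwards [h.ae_abs_le] with s hs
        have := sq_sub_le hx hy hs
        gcongr
    _ = _ := by simp

/-- With `z = xy/(2t)`, the growth `z^{-λ} e^z` of the Laplace transform meets the weight: `z^{-λ}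
y^{2λ} = (2ty/x)^λ ≤ (4t)^λ`. This lowers `t^{-(λ+1/2)}` to the one-dimensional `t^{-1/2}`. -/
theorem exists_heatKernel_near_le (hlam : 0 ≤ lam) {x : ℝ} (hx : 0 < x) :
    ∃ C > 0, ∀ t y, 0 < t → 0 < y → y ≤ 2 * x →
      heatKernel lam t x y * y ^ (2 * lam) ≤
        C * (t ^ (-(1 / 2) : ℝ) * Real.exp (-(x - y) ^ 2 / (4 * t))) := by
  obtain ⟨μ, h⟩ := exists_isAngular hlam
  obtain ⟨C, hC, hC'⟩ := h.laplace_le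
  have hc := heatConst_pos hlam
  refine ⟨heatConst lam * C * 4 ^ lam, by positivity, fun t y ht hy hyx => ?_⟩
  have hz : 0 < x * y / (2 * t) := by positivity
  have e1 : (x * y / (2 * t)) ^ (-lam) * y ^ (2 * lam) ≤ 4 ^ lam * t ^ lam := by
    rw [two_mul lam, Real.rpow_add hy, Real.rpow_neg hz.le, ← Real.inv_rpow hz.le, ← mul_assoc,
      ← Real.mul_rpow (by positivity) hy.le, ← Real.mul_rpow (by positivity) hy.le,
      ← Real.mul_rpow (by positivity) ht.le]
    refine Real.rpow_le_rpow (by positivity) ?_ hlam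
    rw [inv_div, div_mul_eq_mul_div, div_mul_eq_mul_div, div_le_iff₀ (by positivity)]
    nlinarith [mul_pos ht hy, mul_le_mul_of_nonneg_left hyx (mul_pos ht hy).le]
  have e2 : t ^ (-(lam + 1 / 2)) * t ^ lam = t ^ (-(1 / 2) : ℝ) := by
    rw [← Real.rpow_add ht]; ring_nf
  have e3 : Real.exp (-(x ^ 2 + y ^ 2) / (4 * t)) * Real.exp (x * y / (2 * t)) =
      Real.exp (-(x - y) ^ 2 / (4 * t)) := by
    rw [← Real.exp_add]; congr 1; field_simp; ring
  rw [heatKernel_eq_laplace h hlam ht hx hy]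
  calc _ ≤ heatConst lam * t ^ (-(lam + 1 / 2)) * (Real.exp (-(x ^ 2 + y ^ 2) / (4 * t)) *
        (C * ((x * y / (2 * t)) ^ (-lam) * Real.exp (x * y / (2 * t))))) * y ^ (2 * lam) := by
        gcongr
        exact hC' _ hz
    _ = heatConst lam * C * t ^ (-(lam + 1 / 2)) * (Real.exp (-(x ^ 2 + y ^ 2) / (4 * t)) *
          Real.exp (x * y / (2 * t))) * ((x * y / (2 * t)) ^ (-lam) * y ^ (2 * lam)) := by ring
    _ ≤ heatConst lam * C * t ^ (-(lam + 1 / 2)) * (Real.exp (-(x ^ 2 + y ^ 2) / (4 * t)) *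
          Real.exp (x * y / (2 * t))) * (4 ^ lam * t ^ lam) := by gcongr
    _ = heatConst lam * C * 4 ^ lam * (t ^ (-(lam + 1 / 2)) * t ^ lam) *
          (Real.exp (-(x ^ 2 + y ^ 2) / (4 * t)) * Real.exp (x * y / (2 * t))) := by ring
    _ = _ := by rw [e2, e3]; ring

/-- Integrate the Bessel series term by term. Each Gaussian moment produces the Gamma value in the
denominator, and what remains is `e^{-x²/(4t)} Σ (x²/(4t))^k / k! = 1`. -/
theorem integral_heatKernel (hlam : 0 ≤ lam) {t x : ℝ} (ht : 0 < t) (hx : 0 < x) :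
    ∫ y in Ioi (0 : ℝ), heatKernel lam t x y * y ^ (2 * lam) = 1 := by
  obtain ⟨μ, h⟩ := exists_isAngular hlam
  set A : ℕ → ℝ := fun k => 2 ^ (-(2 * lam)) * t ^ (-(lam + 1 / 2)) * Real.exp (-x ^ 2 / (4 * t)) *
    (x / (4 * t)) ^ (2 * k) / (k.factorial * Real.Gamma (k + lam + 1 / 2)) with hA
  have hG : ∀ k : ℕ, 0 < Real.Gamma (k + lam + 1 / 2) := fun k =>
    Real.Gamma_pos_of_pos (by positivity)
  have hA0 : ∀ k, 0 < A k := fun k => by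
    have := hG k
    simp only [hA]; positivity
  set F : ℕ → ℝ → ℝ := fun k y =>
    A k * (y ^ (2 * k + 2 * lam) * Real.exp (-(1 / (4 * t)) * y ^ (2 : ℝ))) with hF
  have hsum : ∀ y ∈ Ioi (0 : ℝ),
      HasSum (fun k => F k y) (heatKernel lam t x y * y ^ (2 * lam)) := by
    intro y (hy : 0 < y)
    have h1 := ((h.hasSum_laplace hlam (x * y / (2 * t))).mul_left
      (heatConst lam * t ^ (-(lam + 1 / 2)) *
        Real.exp (-(x ^ 2 + y ^ 2) / (4 * t)))).mul_right (y ^ (2 * lam))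
    rw [mul_assoc (heatConst lam * _), ← heatKernel_eq_laplace h hlam ht hx hy] at h1
    convert! h1 using 2 with k
    have e1 : Real.exp (-(x ^ 2 + y ^ 2) / (4 * t)) =
        Real.exp (-x ^ 2 / (4 * t)) * Real.exp (-(1 / (4 * t)) * y ^ (2 : ℝ)) := by
      rw [← Real.exp_add, Real.rpow_two]; congr 1; ring
    have e2 : y ^ (2 * (k : ℝ) + 2 * lam) = y ^ (2 * k) * y ^ (2 * lam) := by
      rw [Real.rpow_add hy, show 2 * (k : ℝ) = ((2 * k : ℕ) : ℝ) by push_cast; ring,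
        Real.rpow_natCast]
    have e3 : (x * y / (2 * t) / 2) ^ (2 * k) = (x / (4 * t)) ^ (2 * k) * y ^ (2 * k) := by
      rw [← mul_pow]; congr 1; field_simp; norm_num
    have e4 : heatConst lam * Real.Gamma (lam + 1 / 2) = 2 ^ (-(2 * lam)) := by
      rw [heatConst, div_mul_cancel₀]
      exact (Real.Gamma_pos_of_pos (by linarith)).ne'
    simp only [hF, hA]
    rw [e1, e2, e3, ← e4]
    ring
  have hb : 0 < 1 / (4 * t) := by positivity
  have hint : ∀ k, ∫ y in Ioi (0 : ℝ), F k y =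
      Real.exp (-x ^ 2 / (4 * t)) * ((x ^ 2 / (4 * t)) ^ k / k.factorial) := by
    intro k
    have hq : (-1 : ℝ) < 2 * k + 2 * lam := by
      have : (0 : ℝ) ≤ k := by positivity
      linarith
    simp only [hF]
    rw [integral_const_mul, integral_rpow_mul_exp_neg_mul_rpow (by norm_num) hq hb,
      show (2 * (k : ℝ) + 2 * lam + 1) / 2 = k + lam + 1 / 2 by ring,
      show -(2 * (k : ℝ) + 2 * lam + 1) / 2 = -(k + (lam + 1 / 2)) by ring, one_div (4 * t),
      Real.inv_rpow (by positivity), ← Real.rpow_neg (by positivity), neg_neg,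
      Real.rpow_add (by positivity), Real.rpow_natCast,
      Real.mul_rpow (by norm_num) ht.le]
    have e1 : (4 : ℝ) ^ (lam + 1 / 2) = 2 * 2 ^ (2 * lam) := by
      rw [show (4 : ℝ) = 2 ^ (2 : ℝ) by norm_num, ← Real.rpow_mul (by norm_num),
        show 2 * (lam + 1 / 2) = 1 + 2 * lam by ring, Real.rpow_add (by norm_num), Real.rpow_one]
    have e2 : (x / (4 * t)) ^ (2 * k) * (4 * t) ^ k = (x ^ 2 / (4 * t)) ^ k := by
      rw [pow_mul, ← mul_pow]; congr 1; field_simp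
    have := (hG k).ne'
    simp only [hA]
    rw [e1, ← e2, Real.rpow_neg (by norm_num), Real.rpow_neg ht.le]
    field_simp
  have hI : ∀ k, IntegrableOn (F k) (Ioi 0) := by
    intro k
    refine not_imp_comm.1 integral_undef ?_
    rw [hint k]; positivity
  have hexp : HasSum (fun k : ℕ => ∫ y in Ioi (0 : ℝ), F k y) 1 := by
    simp_rw [hint]
    have h1 : HasSum (fun k : ℕ => (x ^ 2 / (4 * t)) ^ k / k.factorial)
        (Real.exp (x ^ 2 / (4 * t))) := by
      rw [Real.exp_eq_exp_ℝ]; exact NormedSpace.expSeries_div_hasSum_exp _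
    have h2 := h1.mul_left (Real.exp (-x ^ 2 / (4 * t)))
    rwa [← Real.exp_add, show -x ^ 2 / (4 * t) + x ^ 2 / (4 * t) = 0 by ring, Real.exp_zero] at h2
  have hnorm : ∀ k, ∫ y in Ioi (0 : ℝ), ‖F k y‖ = ∫ y in Ioi (0 : ℝ), F k y := fun k =>
    setIntegral_congr_fun measurableSet_Ioi fun y (hy : 0 < y) =>
      Real.norm_of_nonneg (mul_nonneg (hA0 k).le (by positivity))
  have h1 := hasSum_integral_of_summable_integral_norm hI (by simpa only [hnorm] using hexp.summable)
  rw [setIntegral_congr_fun measurableSet_Ioi fun y hy => (hsum y hy).tsum_eq.symm]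
  exact h1.unique hexp

theorem aestronglyMeasurable_heatKernel (hlam : 0 ≤ lam) {x : ℝ} (hx : 0 < x) :
    AEStronglyMeasurable (fun w : ℝ × ℝ => heatKernel lam w.2 x w.1)
      ((volume.restrict (Ioi (0 : ℝ))).prod (volume.restrict (Ioi (0 : ℝ)))) := by
  obtain ⟨μ, h⟩ := exists_isAngular hlam
  have := h.prob
  have h1 : StronglyMeasurable fun w : ℝ × ℝ =>
      ∫ s, Real.exp (-(x ^ 2 + w.1 ^ 2 - 2 * x * w.1 * s) / (4 * w.2)) ∂μ :=
    StronglyMeasurable.integral_prod_right'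
      (f := fun v : (ℝ × ℝ) × ℝ =>
        Real.exp (-(x ^ 2 + v.1.1 ^ 2 - 2 * x * v.1.1 * v.2) / (4 * v.1.2)))
      (Measurable.stronglyMeasurable (by fun_prop))
  have h2 : Measurable fun w : ℝ × ℝ => heatConst lam * w.2 ^ (-(lam + 1 / 2)) *
      ∫ s, Real.exp (-(x ^ 2 + w.1 ^ 2 - 2 * x * w.1 * s) / (4 * w.2)) ∂μ :=
    Measurable.mul (by fun_prop) h1.measurable
  refine h2.aestronglyMeasurable.congr ?_
  have a1 : ∀ᵐ w ∂((volume.restrict (Ioi (0 : ℝ))).prod (volume.restrict (Ioi (0 : ℝ)))),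
      0 < w.1 := Measure.quasiMeasurePreserving_fst.ae (ae_restrict_mem measurableSet_Ioi)
  have a2 : ∀ᵐ w ∂((volume.restrict (Ioi (0 : ℝ))).prod (volume.restrict (Ioi (0 : ℝ)))),
      0 < w.2 := Measure.quasiMeasurePreserving_snd.ae (ae_restrict_mem measurableSet_Ioi)
  filter_upwards [a1, a2] with w h1 h2
  exact (heatKernel_eq h hlam h2 hx h1).symm

/-- Constants must be admissible because the far part of the convergence argument integrates `f - f
x`. -/
theorem finiteAgainst_heatFactor_one (hlam : 0 ≤ lam) {t : ℝ} (ht : 0 < t) :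
    FiniteAgainst (heatFactor lam t) fun _ => 1 := by
  have h1 : IntegrableOn (fun y : ℝ => y ^ (2 * lam) * Real.exp (-(1 / (4 * t)) * y ^ 2)) (Ioi 0) :=
    (integrable_rpow_mul_exp_neg_mul_sq (by positivity) (by linarith)).integrableOn
  refine lt_of_le_of_lt ?_ h1.lintegral_lt_top
  refine setLIntegral_mono' measurableSet_Ioi fun y (hy : 0 < y) => ENNReal.ofReal_le_ofReal ?_
  rw [heatFactor_eq hy, abs_one, mul_one,
    show -(1 / (4 * t)) * y ^ 2 = -y ^ 2 / (4 * t) by ring]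
  have : (1 + y) ^ (-lam) ≤ 1 := Real.rpow_le_one_of_one_le_of_nonpos (by linarith) (by linarith)
  gcongr
  exact mul_le_of_le_one_right (by positivity) this

theorem finiteAgainst_poissonFactor_one (hlam : 0 ≤ lam) :
    FiniteAgainst (poissonFactor lam) fun _ => 1 := by
  have h1 : IntegrableOn (fun y : ℝ => (1 + y ^ 2)⁻¹) (Ioi 0) :=
    integrable_inv_one_add_sq.integrableOn
  refine lt_of_le_of_lt ?_ h1.lintegral_lt_top
  refine setLIntegral_mono' measurableSet_Ioi fun y (hy : 0 < y) => ENNReal.ofReal_le_ofReal ?_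
  rw [poissonFactor, abs_one, mul_one, Real.rpow_add (by positivity), Real.rpow_one, ← div_div,
    add_comm 1, ← one_div]
  gcongr
  rw [div_le_one (by positivity), Real.rpow_mul hy.le, Real.rpow_two]
  gcongr
  linarith

theorem integrableOn_heatKernel (hlam : 0 ≤ lam) {t x : ℝ} (ht : 0 < t) (hx : 0 < x) :
    IntegrableOn (fun y => heatKernel lam t x y * y ^ (2 * lam)) (Ioi 0) := by
  refine not_imp_comm.1 integral_undef ?_
  rw [integral_heatKernel hlam ht hx]; exact one_ne_zero

theorem poissonKernel_nonneg (hlam : 0 ≤ lam) {t x y : ℝ} (ht : 0 < t) (hx : 0 < x)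
    (hy : 0 < y) : 0 ≤ poissonKernel lam t x y := by
  have := Real.pi_pos
  refine mul_nonneg (by positivity) (setIntegral_nonneg measurableSet_Ioi fun u (hu : 0 < u) => ?_)
  have := heatKernel_nonneg hlam hu hx hy
  positivity

theorem integral_poisson_subordinator {t : ℝ} (ht : 0 < t) :
    ∫ u in Ioi (0 : ℝ), t / Real.sqrt (4 * Real.pi) *
      (u ^ (-(1 / 2 + 1) : ℝ) * Real.exp (-t ^ 2 / (4 * u))) = 1 := by
  have := Real.pi_pos
  rw [integral_const_mul, integral_rpow_mul_exp_neg_div (by norm_num) (by positivity),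
    Real.Gamma_one_half_eq, Real.rpow_neg (by positivity), ← Real.sqrt_eq_rpow, ← Real.sqrt_eq_rpow,
    Real.sqrt_sq ht.le, Real.sqrt_mul (by norm_num)]
  have : Real.sqrt Real.pi ≠ 0 := by positivity
  field_simp

theorem poissonKernel_mul_eq_integral {t x y : ℝ} :
    poissonKernel lam t x y * y ^ (2 * lam) =
      ∫ u in Ioi (0 : ℝ), t / Real.sqrt (4 * Real.pi) *
        (u ^ (-(1 / 2 + 1) : ℝ) * Real.exp (-t ^ 2 / (4 * u))) *
          (heatKernel lam u x y * y ^ (2 * lam)) := by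
  rw [poissonKernel, ← integral_const_mul, ← integral_mul_const]
  refine setIntegral_congr_fun measurableSet_Ioi fun u (hu : 0 < u) => ?_
  rw [Real.rpow_neg hu.le, show (1 / 2 + 1 : ℝ) = 3 / 2 by norm_num]
  ring

/-- The Poisson kernel averages heat kernels of mass one against the subordinator, a probability
density in `u`. -/
theorem integral_poissonKernel (hlam : 0 ≤ lam) {t x : ℝ} (ht : 0 < t) (hx : 0 < x) :
    ∫ y in Ioi (0 : ℝ), poissonKernel lam t x y * y ^ (2 * lam) = 1 := by
  have := Real.pi_pos
  set k : ℝ → ℝ := fun u => t / Real.sqrt (4 * Real.pi) *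
    (u ^ (-(1 / 2 + 1) : ℝ) * Real.exp (-t ^ 2 / (4 * u))) with hk
  have hk1 : ∫ u in Ioi (0 : ℝ), k u = 1 := integral_poisson_subordinator ht
  have hkI : IntegrableOn k (Ioi 0) := by
    refine not_imp_comm.1 integral_undef ?_
    rw [hk1]; exact one_ne_zero
  have hin : ∀ u, 0 < u →
      ∫ y in Ioi (0 : ℝ), k u * (heatKernel lam u x y * y ^ (2 * lam)) = k u := fun u hu => by
    rw [integral_const_mul, integral_heatKernel hlam hu hx, mul_one]
  simp_rw [poissonKernel_mul_eq_integral]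
  rw [integral_integral_swap]
  · rw [setIntegral_congr_fun measurableSet_Ioi fun u hu => hin u hu, hk1]
  · rw [integrable_prod_iff']
    · constructor
      · filter_upwards [ae_restrict_mem measurableSet_Ioi] with u hu
        exact (integrableOn_heatKernel hlam hu hx).const_mul (k u)
      · refine hkI.congr ?_
        filter_upwards [ae_restrict_mem measurableSet_Ioi] with u (hu : 0 < u)
        rw [← hin u hu]
        refine setIntegral_congr_fun measurableSet_Ioi fun y (hy : 0 < y) => ?_
        have := heatKernel_nonneg hlam hu hx hy
        simp only [Function.uncurry, hk]
        rw [Real.norm_of_nonneg (by positivity)]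
    · exact (Measurable.aestronglyMeasurable (by fun_prop : Measurable fun w : ℝ × ℝ =>
        t / Real.sqrt (4 * Real.pi) * (w.2 ^ (-(1 / 2 + 1) : ℝ) *
          Real.exp (-t ^ 2 / (4 * w.2))))).mul
        ((aestronglyMeasurable_heatKernel hlam hx).mul
          (by fun_prop : Measurable fun w : ℝ × ℝ => w.1 ^ (2 * lam)).aestronglyMeasurable)

theorem integrableOn_poissonKernel (hlam : 0 ≤ lam) {t x : ℝ} (ht : 0 < t) (hx : 0 < x) :
    IntegrableOn (fun y => poissonKernel lam t x y * y ^ (2 * lam)) (Ioi 0) := by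
  refine not_imp_comm.1 integral_undef ?_
  rw [integral_poissonKernel hlam ht hx]; exact one_ne_zero

/-- The near bound of the heat kernel holds at every time `u`, so it can be subordinated: `∫ u^{-2}
e^{-D/(4u)} du = 4/D` with `D = t² + (y-x)²`. -/
theorem exists_poissonKernel_near_le (hlam : 0 ≤ lam) {x : ℝ} (hx : 0 < x) :
    ∃ C > 0, ∀ t y, 0 < t → 0 < y → y ≤ 2 * x →
      poissonKernel lam t x y * y ^ (2 * lam) ≤ C * (t / (t ^ 2 + (y - x) ^ 2)) := by
  have := Real.pi_pos
  obtain ⟨C, hC, hC'⟩ := exists_heatKernel_near_le hlam hx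
  refine ⟨C * 4 / Real.sqrt (4 * Real.pi), by positivity, fun t y ht hy hyx => ?_⟩
  have hD : 0 < t ^ 2 + (y - x) ^ 2 := by positivity
  rw [poissonKernel_mul_eq_integral]
  calc _ ≤ ∫ u in Ioi (0 : ℝ), t / Real.sqrt (4 * Real.pi) * C *
        (u ^ (-(1 + 1) : ℝ) * Real.exp (-(t ^ 2 + (y - x) ^ 2) / (4 * u))) := by
        refine integral_mono_of_nonneg ?_
          ((integrableOn_rpow_mul_exp_neg_div one_pos hD).const_mul _) ?_
        · filter_upwards [ae_restrict_mem measurableSet_Ioi] with u (hu : 0 < u)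
          have := heatKernel_nonneg hlam hu hx hy
          simp only [Pi.zero_apply]
          positivity
        · filter_upwards [ae_restrict_mem measurableSet_Ioi] with u (hu : 0 < u)
          have e1 : u ^ (-(1 + 1) : ℝ) = u ^ (-(1 / 2 + 1) : ℝ) * u ^ (-(1 / 2) : ℝ) := by
            rw [← Real.rpow_add hu]; norm_num
          have e2 : Real.exp (-(t ^ 2 + (y - x) ^ 2) / (4 * u)) =
              Real.exp (-t ^ 2 / (4 * u)) * Real.exp (-(x - y) ^ 2 / (4 * u)) := by
            rw [← Real.exp_add]; congr 1; ring
          calc _ ≤ t / Real.sqrt (4 * Real.pi) *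
                (u ^ (-(1 / 2 + 1) : ℝ) * Real.exp (-t ^ 2 / (4 * u))) *
                (C * (u ^ (-(1 / 2) : ℝ) * Real.exp (-(x - y) ^ 2 / (4 * u)))) := by
                refine mul_le_mul_of_nonneg_left (hC' u y hu hy hyx) (by positivity)
            _ = _ := by rw [e1, e2]; ring
    _ = _ := by
        rw [integral_const_mul, integral_rpow_mul_exp_neg_div one_pos hD, Real.Gamma_one,
          Real.rpow_one, Real.rpow_neg_one]
        field_simp

theorem poissonKernel_le (hlam : 0 ≤ lam) {t x y : ℝ} (ht : 0 < t) (hx : 0 < x) (hy : 0 < y)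
    (hxy : x ≠ y) :
    poissonKernel lam t x y ≤ poissonConst lam * t * ((x - y) ^ 2) ^ (-(lam + 1)) := by
  obtain ⟨μ, h⟩ := exists_isAngular hlam
  have := h.prob
  have := poissonConst_pos hlam
  have hpos : 0 < (x - y) ^ 2 := by have := sub_ne_zero.2 hxy; positivity
  rw [poissonKernel_eq h hlam ht hx hy]
  refine mul_le_mul_of_nonneg_left ?_ (by positivity)
  calc _ ≤ ∫ _, ((x - y) ^ 2) ^ (-(lam + 1)) ∂μ := by
        refine integral_mono_of_nonneg ?_ (integrable_const _) ?_
        · filter_upwards [h.ae_abs_le] with s hs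
          exact Real.rpow_nonneg (by nlinarith [sq_sub_le hx hy hs]) _
        · filter_upwards [h.ae_abs_le] with s hs
          exact Real.rpow_le_rpow_of_nonpos hpos
            (by nlinarith [sq_sub_le hx hy hs]) (by linarith)
    _ = _ := by simp

theorem exists_le_poissonKernel (hlam : 0 ≤ lam) {t x : ℝ} (ht : 0 < t) (hx : 0 < x) :
    ∃ c > 0, ∀ y, 0 < y → c * (y ^ 2 + 1) ^ (-(lam + 1)) ≤ poissonKernel lam t x y := by
  obtain ⟨μ, h⟩ := exists_isAngular hlam
  have := h.prob
  have := poissonConst_pos hlam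
  -- Since `-2xys ≤ x² + y²`, the denominator is at most `t² + 2x² + 2y² ≤ K(y²+1)`.
  set K := t ^ 2 + 2 * x ^ 2 + 2 with hK
  have hK0 : 0 < K := by positivity
  refine ⟨poissonConst lam * t * K ^ (-(lam + 1)), by positivity, fun y hy => ?_⟩
  rw [poissonKernel_eq h hlam ht hx hy, mul_assoc]
  refine mul_le_mul_of_nonneg_left ?_ (by positivity)
  have hD : ∀ᵐ s ∂μ, t ^ 2 ≤ t ^ 2 + (x ^ 2 + y ^ 2 - 2 * x * y * s) :=
    h.ae_abs_le.mono fun s hs => by nlinarith [sq_sub_le hx hy hs, sq_nonneg (x - y)]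
  calc _ = ∫ _, (K * (y ^ 2 + 1)) ^ (-(lam + 1)) ∂μ := by
        rw [Real.mul_rpow hK0.le (by positivity)]; simp
    _ ≤ _ := by
        refine integral_mono_ae (integrable_const _) ?_ ?_
        · refine Integrable.of_bound (C := (t ^ 2) ^ (-(lam + 1)))
            (Measurable.aestronglyMeasurable (by fun_prop)) ?_
          filter_upwards [hD] with s hs
          have h0 : 0 < t ^ 2 := by positivity
          rw [Real.norm_of_nonneg (Real.rpow_nonneg (h0.le.trans hs) _)]
          exact Real.rpow_le_rpow_of_nonpos h0 hs (by linarith)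
        · filter_upwards [hD, h.ae_abs_le] with s hs hs1
          refine Real.rpow_le_rpow_of_nonpos (lt_of_lt_of_le (by positivity) hs) ?_ (by linarith)
          have h1 : -(2 * x * y * s) ≤ 2 * x * y := by
            nlinarith [(abs_le.1 hs1).1, mul_pos hx hy]
          rw [hK]
          nlinarith [sq_nonneg (x - y), sq_nonneg (t * y), sq_nonneg (x * y)]

end

/-! ### Almost everywhere convergence and necessity -/

section

variable {lam : ℝ} {f : ℝ → ℝ}

/-- A positive continuous factor is bounded below on compact subintervals. The resulting local
integrability is the input of `ae_lebesguePoint`. -/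
theorem FiniteAgainst.integrableOn_Icc {φ : ℝ → ℝ} (h : FiniteAgainst φ f)
    (hφm : Measurable φ) (hφ : ContinuousOn φ (Ioi 0)) (hφ0 : ∀ y, 0 < y → 0 < φ y)
    (hf : AEMeasurable f (volume.restrict (Ioi (0 : ℝ)))) {a : ℝ} (b : ℝ) (ha : 0 < a) :
    IntegrableOn f (Icc a b) := by
  rcases lt_or_ge b a with hab | hab
  · rw [Icc_eq_empty_of_lt hab]; exact integrableOn_empty
  have hsub : Icc a b ⊆ Ioi 0 := fun y hy => lt_of_lt_of_le ha hy.1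
  obtain ⟨c, hc, hmin⟩ := isCompact_Icc.exists_isMinOn (nonempty_Icc.2 hab) (hφ.mono hsub)
  have hc0 : 0 < φ c := hφ0 c (hsub hc)
  have hI := (h.integrableOn hφm (fun y hy => (hφ0 y hy).le) hf).mono_set hsub
  refine Integrable.mono' (hI.const_mul (φ c)⁻¹)
    (hf.mono_measure (Measure.restrict_mono hsub le_rfl)).aestronglyMeasurable ?_
  filter_upwards [ae_restrict_mem measurableSet_Icc] with y hy
  have h1 : φ c ≤ φ y := hmin hy
  rw [Real.norm_eq_abs, ← mul_assoc, inv_mul_eq_div]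
  exact le_mul_of_one_le_left (abs_nonneg _) ((one_le_div hc0).2 h1)

theorem continuousOn_heatFactor (lam t : ℝ) : ContinuousOn (heatFactor lam t) (Ioi 0) := by
  unfold heatFactor
  refine ContinuousOn.mul (ContinuousOn.mul ?_ ?_) (by fun_prop)
  · exact continuousOn_id.rpow_const fun y (hy : 0 < y) => Or.inl hy.ne'
  · refine ContinuousOn.rpow_const ?_ fun y (hy : 0 < y) => Or.inl (by positivity)
    exact continuousOn_id.div (by fun_prop) fun y (hy : 0 < y) => by positivity

theorem heatFactor_pos {t y : ℝ} (hy : 0 < y) : 0 < heatFactor lam t y := by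
  rw [heatFactor_eq hy]; positivity

theorem continuousOn_poissonFactor (lam : ℝ) : ContinuousOn (poissonFactor lam) (Ioi 0) := by
  unfold poissonFactor
  refine ContinuousOn.div ?_ ?_ fun y (hy : 0 < y) => by positivity
  · exact continuousOn_id.rpow_const fun y (hy : 0 < y) => Or.inl hy.ne'
  · exact ContinuousOn.rpow_const (by fun_prop) fun y (hy : 0 < y) => Or.inl (by positivity)

theorem poissonFactor_pos {y : ℝ} (hy : 0 < y) : 0 < poissonFactor lam y := by
  unfold poissonFactor; positivity

theorem tendsto_rpow_neg_mul_exp_neg_div (p : ℝ) {c : ℝ} (hc : 0 < c) :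
    Tendsto (fun t : ℝ => t ^ (-p) * Real.exp (-c / t)) (𝓝[>] 0) (𝓝 0) := by
  refine ((tendsto_rpow_mul_exp_neg_mul_atTop_nhds_zero p c hc).comp
    tendsto_inv_nhdsGT_zero).congr' ?_
  filter_upwards [self_mem_nhdsWithin] with t (ht : 0 < t)
  simp only [Function.comp_apply]
  rw [Real.inv_rpow ht.le, Real.rpow_neg ht.le, div_eq_mul_inv]

/-- Half of the Gaussian exponent gives `e^{-δ²/(8t)}`, which defeats the power of `t`. For `t <
t₀/8` the other half is at most `e^{-(x-y)²/t₀}`, whose rate `1/t₀` exceeds the `1/(4t₀)` of the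
factor. -/
theorem exists_heatKernel_far_le (hlam : 0 ≤ lam) {x t₀ : ℝ} (hx : 0 < x) (ht₀ : 0 < t₀)
    {δ : ℝ} (hδ : 0 < δ) :
    ∃ η : ℝ → ℝ, Tendsto η (𝓝[>] 0) (𝓝 0) ∧ ∀ᶠ t in 𝓝[>] 0, 0 ≤ η t ∧
      ∀ y, 0 < y → δ ≤ |y - x| →
        heatKernel lam t x y * y ^ (2 * lam) ≤ η t * heatFactor lam t₀ y := by
  obtain ⟨C, hC, hC'⟩ := exists_exp_mul_rpow_le_heatFactor hlam
    (t := t₀) (α := 1 / t₀) (one_div_lt_one_div_of_lt ht₀ (by linarith)) (2 * x / t₀)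
  have hc := heatConst_pos hlam
  refine ⟨fun t => heatConst lam * C * (t ^ (-(lam + 1 / 2)) * Real.exp (-(δ ^ 2 / 8) / t)), ?_, ?_⟩
  · simpa using (tendsto_rpow_neg_mul_exp_neg_div (lam + 1 / 2)
      (by positivity : 0 < δ ^ 2 / 8)).const_mul (heatConst lam * C)
  · filter_upwards [Ioo_mem_nhdsGT (by positivity : 0 < t₀ / 8)] with t ht
    have ht0 : 0 < t := ht.1
    refine ⟨by positivity, fun y hy hyδ => ?_⟩
    have hsq : δ ^ 2 ≤ (x - y) ^ 2 := by
      rw [← sq_abs (x - y), abs_sub_comm]; gcongr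
    have e1 : Real.exp (-(x - y) ^ 2 / (4 * t)) ≤
        Real.exp (-(δ ^ 2 / 8) / t) * Real.exp (-(1 / t₀) * y ^ 2 + 2 * x / t₀ * y) := by
      rw [← Real.exp_add, Real.exp_le_exp]
      have h1 : -(x - y) ^ 2 / (4 * t) = -((x - y) ^ 2 / 8) / t + -((x - y) ^ 2 / (8 * t)) := by
        field_simp; ring
      have h2 : -((x - y) ^ 2 / 8) / t ≤ -(δ ^ 2 / 8) / t := by gcongr
      have h3 : (x - y) ^ 2 / t₀ ≤ (x - y) ^ 2 / (8 * t) := by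
        gcongr; linarith [ht.2]
      have h4 : -((x - y) ^ 2 / t₀) ≤ -(1 / t₀) * y ^ 2 + 2 * x / t₀ * y := by
        have : -(1 / t₀) * y ^ 2 + 2 * x / t₀ * y + (x - y) ^ 2 / t₀ = x ^ 2 / t₀ := by
          field_simp; ring
        have h5 : 0 ≤ x ^ 2 / t₀ := by positivity
        linarith
      linarith
    calc _ ≤ heatConst lam * t ^ (-(lam + 1 / 2)) * Real.exp (-(x - y) ^ 2 / (4 * t)) *
          y ^ (2 * lam) := by
          gcongr
          exact heatKernel_le hlam ht0 hx hy
      _ ≤ heatConst lam * t ^ (-(lam + 1 / 2)) * (Real.exp (-(δ ^ 2 / 8) / t) *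
          Real.exp (-(1 / t₀) * y ^ 2 + 2 * x / t₀ * y)) * y ^ (2 * lam) := by gcongr
      _ = heatConst lam * t ^ (-(lam + 1 / 2)) * Real.exp (-(δ ^ 2 / 8) / t) *
          (Real.exp (-(1 / t₀) * y ^ 2 + 2 * x / t₀ * y) * y ^ (2 * lam)) := by ring
      _ ≤ heatConst lam * t ^ (-(lam + 1 / 2)) * Real.exp (-(δ ^ 2 / 8) / t) *
          (C * heatFactor lam t₀ y) := by
          exact mul_le_mul_of_nonneg_left (hC' y hy) (by positivity)
      _ = _ := by ring

theorem ae_tendsto_heatIntegral (hlam : 0 ≤ lam)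
    (hf : AEMeasurable f (volume.restrict (Ioi (0 : ℝ)))) {t₀ : ℝ} (ht₀ : 0 < t₀)
    (hfin : FiniteAgainst (heatFactor lam t₀) f) :
    ∀ᵐ x ∂(volume.restrict (Ioi (0 : ℝ))),
      Tendsto (fun t => heatIntegral lam f t x) (𝓝[>] 0) (𝓝 (f x)) := by
  obtain ⟨μ, hμ⟩ := exists_isAngular hlam
  have hloc := fun a b ha => hfin.integrableOn_Icc (measurable_heatFactor lam t₀)
    (continuousOn_heatFactor lam t₀) (fun y hy => heatFactor_pos hy) hf (a := a) b ha
  filter_upwards [ae_lebesguePoint hloc, ae_restrict_mem measurableSet_Ioi] with x hL (hx : 0 < x)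
  have hone := (finiteAgainst_heatFactor_one hlam ht₀).integrableOn (measurable_heatFactor lam t₀)
    (fun y hy => heatFactor_nonneg hy) aemeasurable_const
  simp only [abs_one, mul_one] at hone
  have key := tendsto_integral_of_lebesguePoint
    (H := fun t y => heatKernel lam t x y * y ^ (2 * lam)) (φ := heatFactor lam t₀)
    (ρ := Real.sqrt) hx hf
    (fun t y ht hy => mul_nonneg (heatKernel_nonneg hlam ht hx hy) (by positivity))
    (fun t ht => integrableOn_heatKernel hlam ht hx) (fun t ht => integral_heatKernel hlam ht hx)
    (fun t ht => Real.sqrt_pos.2 ht) ?_ (fun δ hδ => exists_heatKernel_far_le hlam hx ht₀ hδ)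
    (fun y hy => heatFactor_nonneg hy) hone
    (hfin.integrableOn (measurable_heatFactor lam t₀) (fun y hy => heatFactor_nonneg hy) hf) ?_ hL
  · refine key.congr fun t => ?_
    rw [heatIntegral]
    congr 1; ext y; ring
  · obtain ⟨C, hC, hC'⟩ := exists_heatKernel_near_le hlam hx
    refine ⟨4 * C, by positivity, fun t y ht hy hyx => (hC' t y ht hy hyx).trans ?_⟩
    rw [mul_comm 4 C, mul_assoc]
    refine mul_le_mul_of_nonneg_left ?_ hC.le
    -- The inequality `e^{-w} ≤ 1/(1+w)` turns the Gaussian into a Cauchy kernel of width `√t`.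
    have h1 : Real.exp (-(x - y) ^ 2 / (4 * t)) ≤ 4 * t / (t + (y - x) ^ 2) := by
      have h2 := Real.add_one_le_exp ((x - y) ^ 2 / (4 * t))
      rw [neg_div, Real.exp_neg, inv_le_comm₀ (Real.exp_pos _) (by positivity), inv_div]
      refine le_trans ?_ h2
      rw [div_le_iff₀ (by positivity), add_mul, div_mul_cancel₀ _ (by positivity)]
      nlinarith [sq_nonneg (x - y)]
    have h3 : t ^ (-(1 / 2) : ℝ) * t = Real.sqrt t := by
      rw [← Real.rpow_add_one ht.ne', Real.sqrt_eq_rpow]; norm_num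
    rw [Real.sq_sqrt ht.le]
    calc _ ≤ t ^ (-(1 / 2) : ℝ) * (4 * t / (t + (y - x) ^ 2)) := by gcongr
      _ = 4 * ((t ^ (-(1 / 2) : ℝ) * t) / (t + (y - x) ^ 2)) := by ring
      _ = _ := by rw [h3]
  · filter_upwards [Ioo_mem_nhdsGT ht₀] with t ht
    refine (integrableOn_heatKernel_mul hμ hlam hf hfin ht.1 ht.2 hx).congr
      (ae_of_all _ fun y => ?_)
    ring

theorem exists_poissonKernel_far_le (hlam : 0 ≤ lam) {x : ℝ} (hx : 0 < x)
    {δ : ℝ} (hδ : 0 < δ) :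
    ∃ η : ℝ → ℝ, Tendsto η (𝓝[>] 0) (𝓝 0) ∧ ∀ᶠ t in 𝓝[>] 0, 0 ≤ η t ∧
      ∀ y, 0 < y → δ ≤ |y - x| →
        poissonKernel lam t x y * y ^ (2 * lam) ≤ η t * poissonFactor lam y := by
  have hc := poissonConst_pos hlam
  -- From `y² ≤ 2(x-y)² + 2x²` and `δ² ≤ (x-y)²` one gets `y² + 1 ≤ K (x-y)²`.
  set K := (1 + 2 * x ^ 2) / δ ^ 2 + 2 with hK
  have hK0 : 0 < K := by positivity
  refine ⟨fun t => t * (poissonConst lam * K ^ (lam + 1)), ?_, ?_⟩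
  · have : Tendsto (fun t : ℝ => t) (𝓝[>] 0) (𝓝 0) := tendsto_nhdsWithin_of_tendsto_nhds tendsto_id
    simpa using this.mul_const (poissonConst lam * K ^ (lam + 1))
  · filter_upwards [self_mem_nhdsWithin] with t (ht : 0 < t)
    refine ⟨by positivity, fun y hy hyδ => ?_⟩
    have hxy : x ≠ y := by
      rintro rfl
      rw [sub_self, abs_zero] at hyδ
      linarith
    have hsq : δ ^ 2 ≤ (x - y) ^ 2 := by
      rw [← sq_abs (x - y), abs_sub_comm]; gcongr
    have h1 : (y ^ 2 + 1) / K ≤ (x - y) ^ 2 := by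
      rw [div_le_iff₀ hK0, hK]
      have h2 : 1 + 2 * x ^ 2 ≤ (x - y) ^ 2 * ((1 + 2 * x ^ 2) / δ ^ 2) := by
        rw [mul_div_assoc', le_div_iff₀ (by positivity), mul_comm]
        gcongr
      nlinarith [sq_nonneg (2 * x - y)]
    calc _ ≤ poissonConst lam * t * ((x - y) ^ 2) ^ (-(lam + 1)) * y ^ (2 * lam) := by
          gcongr
          exact poissonKernel_le hlam ht hx hy hxy
      _ ≤ poissonConst lam * t * ((y ^ 2 + 1) / K) ^ (-(lam + 1)) * y ^ (2 * lam) := by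
          gcongr poissonConst lam * t * ?_ * _
          exact Real.rpow_le_rpow_of_nonpos (by positivity) h1 (by linarith)
      _ = _ := by
          rw [Real.rpow_neg (by positivity), Real.div_rpow (by positivity) hK0.le, inv_div,
            poissonFactor]
          ring

theorem ae_tendsto_poissonIntegral (hlam : 0 ≤ lam)
    (hf : AEMeasurable f (volume.restrict (Ioi (0 : ℝ))))
    (hfin : FiniteAgainst (poissonFactor lam) f) :
    ∀ᵐ x ∂(volume.restrict (Ioi (0 : ℝ))),
      Tendsto (fun t => poissonIntegral lam f t x) (𝓝[>] 0) (𝓝 (f x)) := by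
  obtain ⟨μ, hμ⟩ := exists_isAngular hlam
  have hloc := fun a b ha => hfin.integrableOn_Icc (measurable_poissonFactor lam)
    (continuousOn_poissonFactor lam) (fun y hy => poissonFactor_pos hy) hf (a := a) b ha
  filter_upwards [ae_lebesguePoint hloc, ae_restrict_mem measurableSet_Ioi] with x hL (hx : 0 < x)
  have hone := (finiteAgainst_poissonFactor_one hlam).integrableOn (measurable_poissonFactor lam)
    (fun y hy => poissonFactor_nonneg hy) aemeasurable_const
  simp only [abs_one, mul_one] at hone
  have key := tendsto_integral_of_lebesguePoint
    (H := fun t y => poissonKernel lam t x y * y ^ (2 * lam)) (φ := poissonFactor lam)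
    (ρ := id) hx hf
    (fun t y ht hy => mul_nonneg (poissonKernel_nonneg hlam ht hx hy) (by positivity))
    (fun t ht => integrableOn_poissonKernel hlam ht hx)
    (fun t ht => integral_poissonKernel hlam ht hx)
    (fun t ht => ht) (exists_poissonKernel_near_le hlam hx)
    (fun δ hδ => exists_poissonKernel_far_le hlam hx hδ)
    (fun y hy => poissonFactor_nonneg hy) hone
    (hfin.integrableOn (measurable_poissonFactor lam) (fun y hy => poissonFactor_nonneg hy) hf)
    ?_ hL
  · refine key.congr fun t => ?_
    rw [poissonIntegral]
    congr 1; ext y; ring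
  · filter_upwards [self_mem_nhdsWithin] with t ht
    refine (integrableOn_poissonKernel_mul hμ hlam hf hfin ht hx).congr
      (ae_of_all _ fun y => ?_)
    ring

/-- Pointwise domination of a factor by a multiple of a kernel transfers finiteness. -/
theorem FiniteAgainst.of_le_mul {φ F : ℝ → ℝ} {C : ℝ} (hC : 0 ≤ C)
    (hf : ∀ y : ℝ, 0 < y → 0 ≤ f y) (h : ∀ y, 0 < y → φ y ≤ C * F y)
    (hfin : ∫⁻ y in Ioi (0 : ℝ), ENNReal.ofReal (F y * f y) < ⊤) : FiniteAgainst φ f := by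
  calc _ ≤ ∫⁻ y in Ioi (0 : ℝ), ENNReal.ofReal C * ENNReal.ofReal (F y * f y) := by
        refine setLIntegral_mono' measurableSet_Ioi fun y hy => ?_
        rw [← ENNReal.ofReal_mul hC, abs_of_nonneg (hf y hy), ← mul_assoc]
        exact ENNReal.ofReal_le_ofReal (mul_le_mul_of_nonneg_right (h y hy) (hf y hy))
    _ = ENNReal.ofReal C * ∫⁻ y in Ioi (0 : ℝ), ENNReal.ofReal (F y * f y) :=
        lintegral_const_mul' _ _ ENNReal.ofReal_ne_top
    _ < ⊤ := ENNReal.mul_lt_top ENNReal.ofReal_lt_top hfin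

/-- `le_heatKernel` bounds the kernel below by a multiple of `e^{-y²/(4t)}`. This dominates the
factor at every `s ≤ t`, as `(1+y)^{-λ} ≤ 1` and the Gaussian increases with time. -/
theorem finiteAgainst_heatFactor_of_lintegral (hlam : 0 ≤ lam) (hf : ∀ y : ℝ, 0 < y → 0 ≤ f y)
    {t x s : ℝ} (ht : 0 < t) (hx : 0 < x)
    (hfin : ∫⁻ y in Ioi (0 : ℝ), ENNReal.ofReal (heatKernel lam t x y * f y * y ^ (2 * lam)) < ⊤)
    (hs : 0 < s) (hst : s ≤ t) : FiniteAgainst (heatFactor lam s) f := by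
  have hc := heatConst_pos hlam
  set A := heatConst lam * t ^ (-(lam + 1 / 2)) * Real.exp (-x ^ 2 / (4 * t)) with hA
  have hA0 : 0 < A := by positivity
  refine FiniteAgainst.of_le_mul (F := fun y => heatKernel lam t x y * y ^ (2 * lam))
    (inv_nonneg.2 hA0.le) hf (fun y hy => ?_) ?_
  · have h1 : A * Real.exp (-y ^ 2 / (4 * t)) ≤ heatKernel lam t x y := by
      refine le_trans (le_of_eq ?_) (le_heatKernel hlam ht hx hy)
      rw [hA, mul_assoc, ← Real.exp_add]; ring_nf
    have h2 : (1 + y) ^ (-lam) ≤ 1 :=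
      Real.rpow_le_one_of_one_le_of_nonpos (by linarith) (by linarith)
    have h3 : Real.exp (-y ^ 2 / (4 * s)) ≤ Real.exp (-y ^ 2 / (4 * t)) := by
      rw [Real.exp_le_exp, neg_div, neg_div, neg_le_neg_iff]
      gcongr
    rw [heatFactor_eq hy, inv_mul_eq_div, le_div_iff₀ hA0]
    calc _ ≤ y ^ (2 * lam) * 1 * Real.exp (-y ^ 2 / (4 * t)) * A := by gcongr
      _ = (A * Real.exp (-y ^ 2 / (4 * t))) * y ^ (2 * lam) := by ring
      _ ≤ _ := by gcongr
  · simpa only [mul_assoc, mul_comm (f _)] using hfin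

theorem finiteAgainst_poissonFactor_of_lintegral (hlam : 0 ≤ lam)
    (hf : ∀ y : ℝ, 0 < y → 0 ≤ f y) {t x : ℝ} (ht : 0 < t) (hx : 0 < x)
    (hfin : ∫⁻ y in Ioi (0 : ℝ),
      ENNReal.ofReal (poissonKernel lam t x y * f y * y ^ (2 * lam)) < ⊤) :
    FiniteAgainst (poissonFactor lam) f := by
  obtain ⟨c, hc, hc'⟩ := exists_le_poissonKernel hlam ht hx
  refine FiniteAgainst.of_le_mul (F := fun y => poissonKernel lam t x y * y ^ (2 * lam))
    (inv_nonneg.2 hc.le) hf (fun y hy => ?_) ?_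
  · have h1 := hc' y hy
    rw [Real.rpow_neg (by positivity)] at h1
    rw [poissonFactor, inv_mul_eq_div, le_div_iff₀ hc]
    calc _ = (c * ((y ^ 2 + 1) ^ (lam + 1))⁻¹) * y ^ (2 * lam) := by ring
      _ ≤ _ := by gcongr
  · simpa only [mul_assoc, mul_comm (f _)] using hfin

theorem exists_real_between {T : EReal} {t : ℝ} (h : (t : EReal) < T) :
    ∃ t₀ : ℝ, t < t₀ ∧ (t₀ : EReal) < T := by
  obtain ⟨t₀, h1, h2⟩ := EReal.lt_iff_exists_real_btwn.1 h
  exact ⟨t₀, EReal.coe_lt_coe_iff.1 h1, h2⟩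

end

end BesselProblem

end

theorem theorem1p1 (lam : ℝ) (hlam : 0 ≤ lam) (T : EReal) (hT : 0 < T)
    (f : ℝ → ℝ) (hf : AEMeasurable f (volume.restrict (Ioi (0 : ℝ)))) :
    -- heat problem, sufficiency
    ((∀ t : ℝ, 0 < t → (t : EReal) < T →
        BesselProblem.FiniteAgainst (BesselProblem.heatFactor lam t) f) →
      (∀ t x : ℝ, 0 < t → (t : EReal) < T → 0 < x →
        IntegrableOn (fun y => BesselProblem.heatKernel lam t x y * f y * y ^ (2 * lam))
          (Ioi (0 : ℝ))) ∧
      ContDiffOn ℝ ∞ (fun p : ℝ × ℝ => BesselProblem.heatIntegral lam f p.1 p.2)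
        {p : ℝ × ℝ | 0 < p.1 ∧ (p.1 : EReal) < T ∧ 0 < p.2} ∧
      (∀ t x : ℝ, 0 < t → (t : EReal) < T → 0 < x →
        deriv (fun s => BesselProblem.heatIntegral lam f s x) t =
          -BesselProblem.besselOp lam (BesselProblem.heatIntegral lam f t) x) ∧
      (∀ᵐ x ∂(volume.restrict (Ioi (0 : ℝ))),
        Tendsto (fun t => BesselProblem.heatIntegral lam f t x) (𝓝[>] 0) (𝓝 (f x)))) ∧
    -- Poisson problem, sufficiency
    (BesselProblem.FiniteAgainst (BesselProblem.poissonFactor lam) f →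
      (∀ t x : ℝ, 0 < t → 0 < x →
        IntegrableOn (fun y => BesselProblem.poissonKernel lam t x y * f y * y ^ (2 * lam))
          (Ioi (0 : ℝ))) ∧
      ContDiffOn ℝ ∞ (fun p : ℝ × ℝ => BesselProblem.poissonIntegral lam f p.1 p.2)
        {p : ℝ × ℝ | 0 < p.1 ∧ 0 < p.2} ∧
      (∀ t x : ℝ, 0 < t → 0 < x →
        iteratedDeriv 2 (fun s => BesselProblem.poissonIntegral lam f s x) t =
          BesselProblem.besselOp lam (BesselProblem.poissonIntegral lam f t) x) ∧
      (∀ᵐ x ∂(volume.restrict (Ioi (0 : ℝ))),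
        Tendsto (fun t => BesselProblem.poissonIntegral lam f t x) (𝓝[>] 0) (𝓝 (f x)))) ∧
    -- necessity, for nonnegative data
    ((∀ y : ℝ, 0 < y → 0 ≤ f y) →
      -- heat: finiteness at one point `(t, x)` gives the condition at all times up to `t`
      (∀ t x : ℝ, 0 < t → (t : EReal) < T → 0 < x →
        (∫⁻ y in Ioi (0 : ℝ),
          ENNReal.ofReal (BesselProblem.heatKernel lam t x y * f y * y ^ (2 * lam))) < ⊤ →
        ∀ s : ℝ, 0 < s → s ≤ t →
          BesselProblem.FiniteAgainst (BesselProblem.heatFactor lam s) f) ∧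
      -- heat: finiteness for each `t ∈ (0, T)` at some `x` gives the condition on `(0, T)`
      ((∀ t : ℝ, 0 < t → (t : EReal) < T → ∃ x : ℝ, 0 < x ∧
          (∫⁻ y in Ioi (0 : ℝ),
            ENNReal.ofReal (BesselProblem.heatKernel lam t x y * f y * y ^ (2 * lam))) < ⊤) →
        ∀ t : ℝ, 0 < t → (t : EReal) < T →
          BesselProblem.FiniteAgainst (BesselProblem.heatFactor lam t) f) ∧
      -- Poisson: finiteness at one point gives the condition
      ((∃ t x : ℝ, 0 < t ∧ 0 < x ∧
          (∫⁻ y in Ioi (0 : ℝ),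
            ENNReal.ofReal (BesselProblem.poissonKernel lam t x y * f y * y ^ (2 * lam))) < ⊤) →
        BesselProblem.FiniteAgainst (BesselProblem.poissonFactor lam) f)) := by
  obtain ⟨μ, hμ⟩ := BesselProblem.exists_isAngular hlam
  refine ⟨fun hfin => ⟨?_, ?_, ?_, ?_⟩, fun hfin => ⟨?_, ?_, ?_, ?_⟩, fun hf0 => ⟨?_, ?_, ?_⟩⟩
  · intro t x ht htT hx
    -- A strictly later time `t₀ < T` supplies the spare Gaussian decay that absorbs `e^{xy/(2t)}`.
    obtain ⟨t₀, htt₀, ht₀T⟩ := BesselProblem.exists_real_between htT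
    exact BesselProblem.integrableOn_heatKernel_mul hμ hlam hf
      (hfin t₀ (ht.trans htt₀) ht₀T) ht htt₀ hx
  · rintro ⟨t, x⟩ ⟨ht, htT, hx⟩
    obtain ⟨t₀, htt₀, ht₀T⟩ := BesselProblem.exists_real_between htT
    -- Smoothness is local, so `t₀` may depend on the point.
    refine ((BesselProblem.contDiffOn_heatIntegral hμ hlam hf
      (hfin t₀ (ht.trans htt₀) ht₀T)).contDiffAt ?_).contDiffWithinAt
    refine IsOpen.mem_nhds ?_ ⟨ht, htt₀, hx⟩
    exact (isOpen_lt continuous_const continuous_fst).inter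
      ((isOpen_lt continuous_fst continuous_const).inter
        (isOpen_lt continuous_const continuous_snd))
  · intro t x ht htT hx
    obtain ⟨t₀, htt₀, ht₀T⟩ := BesselProblem.exists_real_between htT
    exact BesselProblem.deriv_heatIntegral hμ hlam hf
      (hfin t₀ (ht.trans htt₀) ht₀T) ht htt₀ hx
  · obtain ⟨t₀, ht₀, ht₀T⟩ := BesselProblem.exists_real_between (t := 0) (by simpa using hT)
    exact BesselProblem.ae_tendsto_heatIntegral hlam hf ht₀ (hfin t₀ ht₀ ht₀T)
  · exact fun t x ht hx => BesselProblem.integrableOn_poissonKernel_mul hμ hlam hf hfin ht hx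
  · exact BesselProblem.contDiffOn_poissonIntegral hμ hlam hf hfin
  · exact fun t x ht hx => BesselProblem.iteratedDeriv_poissonIntegral hμ hlam hf hfin ht hx
  · exact BesselProblem.ae_tendsto_poissonIntegral hlam hf hfin
  · exact fun t x ht _ hx h s hs hst =>
      BesselProblem.finiteAgainst_heatFactor_of_lintegral hlam hf0 ht hx h hs hst
  · intro h t ht htT
    obtain ⟨x, hx, hfin⟩ := h t ht htT
    exact BesselProblem.finiteAgainst_heatFactor_of_lintegral hlam hf0 ht hx hfin ht le_rfl
  · rintro ⟨t, x, ht, hx, hfin⟩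
    exact BesselProblem.finiteAgainst_poissonFactor_of_lintegral hlam hf0 ht hx hfin
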